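/- Notation. Fix $n$ and let $w_0\in S_n$ be the longest permutation, $w_0(i)=n+1-i$. For $0\le k\le n$ put $\Delta_k(t\mid X_k)=\det M_k=\sum_{i=0}^k e_i(X_k|q)\,t^{k-i}$, where $M_k$ is the $k\times k$ tridiagonal matrix with diagonal entries $x_i+t$ ($1\le i\le k$), superdiagonal entries $q_1,\dots,q_{k-1}$ and subdiagonal entries $-1$. Let $\widetilde I_n\subset\mathbb Q[x_1,\dots,x_n,q_1,\dots,q_{n-1}]$ be the ideal generated by $e_i(X_n|q)$, $1\le i\le n$, and $QH^*(Fl_n)=\mathbb Q[x,q]/\widetilde I_n$. The quantum Schubert polynomials are $\widetilde{\mathfrak S}_w(x)=\partial^{(y)}_{ww_0}\prod_{k=1}^{n-1}\Delta_k(y_{n-k}\mid X_k)\big|_{y=0}$, $w\in S_n$, where $\partial_v^{(y)}=\partial_{a_1}\cdots\partial_{a_p}$ for a reduced word $v=s_{a_1}\cdots s_{a_p}$ and $\partial_i f=(f-s_if)/(y_i-y_{i+1})$. Let $t=(t_w)_{w\in S_n}$ be independent variables, $R=\mathbb Q[q][[t]]$ and $Q_tH^*(Fl_n)=QH^*(Fl_n)[[t]]$.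 For $f\in\mathbb Q[x,q][[t]]$ let $[f]$ be the element of the $R$-span of the polynomials $\widetilde{\mathfrak S}_w(x)$ that is congruent to $f$ modulo $\widetilde I_n$ (coefficientwise in $t$), let $\langle f\rangle$ (the residue) be the coefficient of $\widetilde{\mathfrak S}_{w_0}$ in $[f]$, and write $f\circ g=[fg]$. Put $$K(x,t)=\Big[\exp\Big(\sum_{w\in S_n}t_w\widetilde{\mathfrak S}_w(x)\Big)\Big],\qquad \mathcal F(t)=\langle K(x,t)\rangle,\qquad \widetilde{\mathfrak S}{}_w^t(x)=[K(x,t)\,\widetilde{\mathfrak S}_w(x)].$$ Define $\Lambda_{uw\tau}(t)\in R$ by $\widetilde{\mathfrak S}{}_u^t\circ\widetilde{\mathfrak S}{}_w^t=\sum_{\tau}\Lambda_{uw\tau}(t)\,\widetilde{\mathfrak S}{}_{w_0\tau}^t$ (an identity in $Q_tH^*(Fl_n)$). On $Q_tH^*(Fl_n)$ define the $R$-bilinear multiplication $*$ and, for each $u\in S_n$, the $R$-linear operator $\nabla_u$ by $$\widetilde{\mathfrak S}_u*\widetilde{\mathfrak S}_w=\sum_\tau\Lambda_{uw\tau}(t)\,\widetilde{\mathfrak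 S}_{w_0\tau},\qquad \nabla_u\widetilde{\mathfrak S}_w=\frac{\partial}{\partial t_u}\widetilde{\mathfrak S}{}_w^t .$$ Statement. The classes of $\widetilde{\mathfrak S}_w$, $w\in S_n$, form an $R$-basis of $Q_tH^*(Fl_n)$, and so do the classes of $\widetilde{\mathfrak S}{}_w^t$, $w\in S_n$; hence all the objects above are well defined. For all $u,w,\tau\in S_n$: 1. $\Lambda_{uw\tau}(t)=\dfrac{\partial^3\mathcal F(t)}{\partial t_u\,\partial t_w\,\partial t_\tau}$; 2. $\dfrac{\partial}{\partial t_u}\widetilde{\mathfrak S}{}_w^t=\widetilde{\mathfrak S}_u\circ\widetilde{\mathfrak S}{}_w^t$, as an identity of series with polynomial coefficients in $x$; 3. $\nabla_u$ and $*$ take on the Schubert classes the values prescribed above, and $\nabla_u\widetilde{\mathfrak S}_w=\widetilde{\mathfrak S}_u*\widetilde{\mathfrak S}_w$. -/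

import Mathlib

namespace QFlag

noncomputable section

open Equiv

/-- `ℚ[q₁, …, q_{n-1}]`. -/
abbrev QRing (n : ℕ) : Type := MvPolynomial (Fin (n - 1)) ℚ

/-- `ℚ[x₁, …, x_n, q₁, …, q_{n-1}]`. -/
abbrev XRing (n : ℕ) : Type := MvPolynomial (Fin n) (QRing n)

/-- `ℚ[x₁, …, x_n, q₁, …, q_{n-1}][y₁, …, y_n]`. -/
abbrev XYRing (n : ℕ) : Type := MvPolynomial (Fin n) (XRing n)

/-- The variable `x_{i+1}` (zero-based index `i`). -/
def xVar (n i : ℕ) : XRing n := if h : i < n then MvPolynomial.X ⟨i, h⟩ else 0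

/-- The variable `q_{i+1}` (zero-based index `i`). -/
def qVar (n i : ℕ) : XRing n :=
  if h : i < n - 1 then MvPolynomial.C (MvPolynomial.X ⟨i, h⟩) else 0

/-- The variable `y_{i+1}` (zero-based index `i`). -/
def yVar (n i : ℕ) : XYRing n := if h : i < n then MvPolynomial.X ⟨i, h⟩ else 0

/-- The tridiagonal `k × k` matrix with diagonal entries `x_i + t`, superdiagonal entries `q_i` and
subdiagonal entries `-1`. The polynomial variable is `t`. -/
def deltaMatrix (n k : ℕ) : Matrix (Fin k) (Fin k) (Polynomial (XRing n)) :=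
  Matrix.of fun i j =>
    if i = j then Polynomial.C (xVar n i) + Polynomial.X
    else if (i : ℕ) + 1 = j then Polynomial.C (qVar n i)
    else if (j : ℕ) + 1 = i then -1
    else 0

/-- `Δ_k(t | X_k) = ∑_i e_i(X_k | q) t^{k-i}`. -/
def quantumDelta (n k : ℕ) : Polynomial (XRing n) := (deltaMatrix n k).det

/-- The quantum elementary symmetric polynomial `e_i(X_k | q₁, …, q_{k-1})`, for `i ≤ k`. -/
def quantumElem (n k i : ℕ) : XRing n := (quantumDelta n k).coeff (k - i)

/-- The ideal generated by `e_i(X_n | q)` for `1 ≤ i ≤ n`. -/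
def quantumIdeal (n : ℕ) : Ideal (XRing n) :=
  Ideal.span {e | ∃ i : ℕ, 1 ≤ i ∧ i ≤ n ∧ e = quantumElem n n i}

/-- The small quantum cohomology ring of the flag variety (with rational coefficients). -/
abbrev QH (n : ℕ) : Type := XRing n ⧸ quantumIdeal n

/-! ### Divided differences in the `y` variables -/

/-- The simple transposition `s_{i+1} = (i+1, i+2)` (zero-based index `i`). -/
def simpleTransp (n : ℕ) (i : Fin (n - 1)) : Perm (Fin n) :=
  Equiv.swap ⟨i, by omega⟩ ⟨i + 1, by omega⟩

theorem sub_dvd_sub_swap {σ R : Type*} [DecidableEq σ] [CommRing R] (a b : σ)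
    (f : MvPolynomial σ R) :
    (MvPolynomial.X a - MvPolynomial.X b : MvPolynomial σ R) ∣
      f - MvPolynomial.rename (Equiv.swap a b) f := by
  induction f using MvPolynomial.induction_on with
  | C r => simp
  | add p q hp hq =>
    rw [map_add, add_sub_add_comm]
    exact dvd_add hp hq
  | mul_X p c hp =>
    have h : (MvPolynomial.X a - MvPolynomial.X b : MvPolynomial σ R) ∣
        MvPolynomial.X c - MvPolynomial.X (Equiv.swap a b c) := by
      by_cases hca : c = a
      · subst hca; simp
      · by_cases hcb : c = b
        · subst hcb
          rw [Equiv.swap_apply_right]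
          exact ⟨-1, by ring⟩
        · rw [Equiv.swap_apply_of_ne_of_ne hca hcb, sub_self]
          exact dvd_zero _
    rw [map_mul, MvPolynomial.rename_X]
    have e : p * MvPolynomial.X c -
        MvPolynomial.rename (Equiv.swap a b) p * MvPolynomial.X (Equiv.swap a b c) =
        (p - MvPolynomial.rename (Equiv.swap a b) p) * MvPolynomial.X c +
          MvPolynomial.rename (Equiv.swap a b) p *
            (MvPolynomial.X c - MvPolynomial.X (Equiv.swap a b c)) := by ring
    rw [e]
    exact dvd_add (hp.mul_right _) (h.mul_left _)

/-- The divided difference `∂_i f = (f - s_i f) / (y_i - y_{i+1})`; the quotient is the (unique)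
polynomial `g` with `f - s_i f = (y_i - y_{i+1}) g`. -/
def divDiff (n : ℕ) (i : Fin (n - 1)) (f : XYRing n) : XYRing n :=
  Classical.choose (sub_dvd_sub_swap (⟨i, by omega⟩ : Fin n) ⟨i + 1, by omega⟩ f)

/-- The product `s_{a₁} ⋯ s_{a_p}`. -/
def wordProd (n : ℕ) (a : List (Fin (n - 1))) : Perm (Fin n) := (a.map (simpleTransp n)).prod

/-- `a` is a reduced word of `w`: a word of minimal length among those with product `w`. -/
def IsReducedWord (n : ℕ) (w : Perm (Fin n)) (a : List (Fin (n - 1))) : Prop :=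
  wordProd n a = w ∧ ∀ b, wordProd n b = w → a.length ≤ b.length

theorem exists_word (n : ℕ) (w : Perm (Fin n)) : ∃ a, wordProd n a = w := by
  cases n with
  | zero => exact ⟨[], Subsingleton.elim _ _⟩
  | succ m =>
    have h : w ∈ Submonoid.closure
        (Set.range fun i : Fin m => Equiv.swap i.castSucc i.succ) := by
      rw [Equiv.Perm.mclosure_swap_castSucc_succ]; trivial
    induction h using Submonoid.closure_induction with
    | mem x hx =>
      obtain ⟨i, rfl⟩ := hx
      refine ⟨[i], ?_⟩
      simp [wordProd, simpleTransp, Fin.castSucc, Fin.succ, Fin.castAdd, Fin.castLE]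
    | one => exact ⟨[], rfl⟩
    | mul x y _ _ hx hy =>
      obtain ⟨a, rfl⟩ := hx
      obtain ⟨b, rfl⟩ := hy
      exact ⟨a ++ b, by simp [wordProd]⟩

theorem exists_reducedWord (n : ℕ) (w : Perm (Fin n)) : ∃ a, IsReducedWord n w a := by
  classical
  obtain ⟨a₀, h₀⟩ := exists_word n w
  have hex : ∃ l : ℕ, ∃ a, wordProd n a = w ∧ a.length = l := ⟨_, a₀, h₀, rfl⟩
  obtain ⟨a, ha, hl⟩ := Nat.find_spec hex
  refine ⟨a, ha, fun b hb => ?_⟩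
  rw [hl]
  exact Nat.find_min' hex ⟨b, hb, rfl⟩

/-- `∂_w = ∂_{a₁} ∘ ⋯ ∘ ∂_{a_p}` for a reduced word `w = s_{a₁} ⋯ s_{a_p}` (by the braid relations
it does not matter which one is chosen). -/
def divDiffPerm (n : ℕ) (w : Perm (Fin n)) (f : XYRing n) : XYRing n :=
  (Classical.choose (exists_reducedWord n w)).foldr (divDiff n) f

/-! ### Quantum Schubert polynomials -/

/-- The longest permutation `w₀`, `i ↦ n + 1 - i`. -/
def longest (n : ℕ) : Perm (Fin n) := Fin.revPerm

/-- `𝔖̃_{w₀}(x, y) = ∏_{k=1}^{n-1} Δ_k(y_{n-k} | X_k)`. -/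
def topDouble (n : ℕ) : XYRing n :=
  ∏ k ∈ Finset.Icc 1 (n - 1), Polynomial.aeval (yVar n (n - k - 1)) (quantumDelta n k)

/-- The quantum double Schubert polynomial `𝔖̃_w(x, y) = ∂^{(y)}_{w w₀} 𝔖̃_{w₀}(x, y)`. -/
def doubleSchubert (n : ℕ) (w : Perm (Fin n)) : XYRing n :=
  divDiffPerm n (w * longest n) (topDouble n)

/-- The quantum Schubert polynomial `𝔖̃_w(x) = 𝔖̃_w(x, 0)`. -/
def schubert (n : ℕ) (w : Perm (Fin n)) : XRing n :=
  MvPolynomial.eval (fun _ => 0) (doubleSchubert n w)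

/-! ### The `t`-deformation -/

/-- The coefficient ring `ℚ[q][[t_w : w ∈ S_n]]`. -/
abbrev TQ (n : ℕ) : Type := MvPowerSeries (Perm (Fin n)) (QRing n)

/-- `ℚ[x, q][[t_w : w ∈ S_n]]`. -/
abbrev TX (n : ℕ) : Type := MvPowerSeries (Perm (Fin n)) (XRing n)

/-- `Q_t H^*(Fl_n) = QH^*(Fl_n)[[t_w : w ∈ S_n]]`. -/
abbrev QtH (n : ℕ) : Type := MvPowerSeries (Perm (Fin n)) (QH n)

/-- Reduction modulo the quantum ideal, coefficientwise in `t`. -/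
def toQtH (n : ℕ) : TX n →+* QtH n := MvPowerSeries.map (Ideal.Quotient.mk (quantumIdeal n))

/-- `𝔖̃_w(x)`, as a series that is constant in `t`. -/
def schubertX (n : ℕ) (w : Perm (Fin n)) : TX n := MvPowerSeries.C (schubert n w)

/-- The class of `𝔖̃_w` in `Q_t H^*(Fl_n)`. -/
def schubertClass (n : ℕ) (w : Perm (Fin n)) : QtH n := toQtH n (schubertX n w)

/-- The coefficients `c_w` in the expansion `g = ∑_w c_w 𝔖̃_w` of an element of `Q_t H^*(Fl_n)`. -/
def schubertCoord (n : ℕ) (g : QtH n) : Perm (Fin n) → TQ n :=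
  Classical.epsilon fun c => g = ∑ w, c w • schubertClass n w

/-- The projection `[f]` of `f` on the `ℚ[q][[t]]`-span of the polynomials `𝔖̃_w(x)`: the element
of the span that is congruent to `f` modulo the quantum ideal. -/
def bracket (n : ℕ) (f : TX n) : TX n :=
  ∑ w, schubertCoord n (toQtH n f) w • schubertX n w

/-- The residue `⟨f⟩` with respect to the quantum ideal: the coefficient of `𝔖̃_{w₀}` in `[f]`. -/
def residue (n : ℕ) (f : TX n) : TQ n := schubertCoord n (toQtH n f) (longest n)

/-- `∑_w t_w 𝔖̃_w(x)`. -/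
def exponent (n : ℕ) : TX n := ∑ w, MvPowerSeries.X w * schubertX n w

/-- `exp (∑_w t_w 𝔖̃_w(x))`; the exponent has no constant term in `t`. -/
def expSeries (n : ℕ) : TX n := (PowerSeries.exp ℚ).subst (exponent n)

/-- The kernel `K(x, t) = [exp (∑_w t_w 𝔖̃_w(x))]`. -/
def kernelK (n : ℕ) : TX n := bracket n (expSeries n)

/-- The toy Gromov–Witten potential `F(t) = ⟨K(x, t)⟩`. -/
def potential (n : ℕ) : TQ n := residue n (kernelK n)

/-- The `t`-deformed quantum Schubert polynomial `𝔖̃_w^t(x) = [K(x, t) 𝔖̃_w(x)]`. -/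
def schubertT (n : ℕ) (w : Perm (Fin n)) : TX n := bracket n (kernelK n * schubertX n w)

/-- The class of `𝔖̃_w^t` in `Q_t H^*(Fl_n)`. -/
def schubertTClass (n : ℕ) (w : Perm (Fin n)) : QtH n := toQtH n (schubertT n w)

/-- The coefficients `c_w` in the expansion `g = ∑_w c_w 𝔖̃_w^t` of an element of
`Q_t H^*(Fl_n)`. -/
def schubertTCoord (n : ℕ) (g : QtH n) : Perm (Fin n) → TQ n :=
  Classical.epsilon fun c => g = ∑ w, c w • schubertTClass n w

/-- `f ∘ g = [f g]`. -/
def circ (n : ℕ) (f g : TX n) : TX n := bracket n (f * g)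

/-- The functions `Λ_{u w τ}(t)` defined by
`𝔖̃_u^t ∘ 𝔖̃_w^t = ∑_τ Λ_{u w τ}(t) 𝔖̃_{w₀ τ}^t`. -/
def Lam (n : ℕ) (u w τ : Perm (Fin n)) : TQ n :=
  schubertTCoord n (toQtH n (circ n (schubertT n u) (schubertT n w))) (longest n * τ)

/-- `∂ / ∂ t_u` on series over `ℚ[q]`. -/
def dQ (n : ℕ) (u : Perm (Fin n)) (f : TQ n) : TQ n := MvPowerSeries.pderiv (QRing n) u f

/-- `∂ / ∂ t_u` on series over `ℚ[x, q]`. -/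
def dX (n : ℕ) (u : Perm (Fin n)) (f : TX n) : TX n := MvPowerSeries.pderiv (XRing n) u f

/-- The new multiplication on `Q_t H^*(Fl_n)`: the `ℚ[q][[t]]`-bilinear product with
`𝔖̃_u * 𝔖̃_w = ∑_τ Λ_{u w τ}(t) 𝔖̃_{w₀ τ}`. -/
def star (n : ℕ) (f g : QtH n) : QtH n :=
  ∑ u, ∑ w, (schubertCoord n f u * schubertCoord n g w) •
    ∑ τ, Lam n u w τ • schubertClass n (longest n * τ)

/-- The `ℚ[q][[t]]`-linear operator `∇_u` on `Q_t H^*(Fl_n)` with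
`∇_u 𝔖̃_w = ∂ 𝔖̃_w^t / ∂ t_u`. -/
def nabla (n : ℕ) (u : Perm (Fin n)) (f : QtH n) : QtH n :=
  ∑ w, schubertCoord n f w • toQtH n (dX n u (schubertT n w))

end

end QFlag

/-! The whole statement rests on one duality: if `l` is the coefficient of the top class in `QH n`,
then every class satisfies `b = ∑ w, l (b * S_{w₀w}) • S_w`, and the `S_w` are independent.
Coordinates in the Schubert basis then become residues of products.

Duality. Give the quantum parameters degree zero, so that passing from classical to quantum only
adds terms of lower degree in `x`. The polynomial ring is free over the symmetric polynomials with
the classical Schubert polynomials as basis. Comparing leading forms, it stays free, on the same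
polynomials, over the quantum elementary polynomials (`bijective_combo`). Hence the quotient is free
of rank `n!` and the residue is a genuine linear functional, equal to 1 on the quantum Schubert
class of `w₀` and 0 on the others (`coinvCoord_qSchub`).

The element `D = ∑ w, S_w ⊗ S_{w₀w}` (`diagonal`) is the value at `y = 0` of `∂_{w₀}` applied to a
product over `j` of one-variable polynomials `(Δ_k Δ'_k)(y_j)`, by a coproduct formula for `∂_{w₀}`
(`evalZero_ddPerm_longest_mul`). The three-term recurrence of the tridiagonal determinants gives a
Christoffel–Darboux recursion, and in the quotient `Δ_n = t^n`. Inserting the Darboux kernels into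
one factor of that product yields `(x_i ⊗ 1 - 1 ⊗ x_i) D = 0` (`sub_mul_diagonal`), where each
nonzero `q_k` is cancelled. So `(f ⊗ 1) D = (1 ⊗ f) D`, and applying `l ⊗ id` gives the expansion of
`f`, because `S_1 = 1`. A spanning family of `n!` elements in a free module of rank `n!` is
independent.

Deformation. Let `K` be the class of the exponential. It has constant term 1, hence is a unit, and
`∂K/∂t_u = K S_u`. The class of `S_w^t` is `K S_w`, which gives the deformed basis. Since `S_u^t
S_w^t = K (K S_u S_w)`, cancelling `K` shows that `Λ_{uwτ}` is the coefficient of `S_{w₀τ}` in `K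
S_u S_w`; by duality this is the residue of `K S_u S_w S_τ`, the third derivative of the residue of
`K`. The statements on `∂/∂t_u` and `∇_u` follow because derivatives in `t` commute with reduction
and with taking coordinates. -/

namespace QFlag

noncomputable section

open Equiv

/-! ### Length of permutations -/

/-- The position `i`. -/
def lo {n : ℕ} (i : Fin (n - 1)) : Fin n := ⟨i, by omega⟩

/-- The position `i + 1`. -/
def hi {n : ℕ} (i : Fin (n - 1)) : Fin n := ⟨i + 1, by omega⟩

theorem lo_lt_hi {n : ℕ} (i : Fin (n - 1)) : lo i < hi i := by
  simp [lo, hi]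

theorem lo_ne_hi {n : ℕ} (i : Fin (n - 1)) : lo i ≠ hi i := (lo_lt_hi i).ne

theorem simpleTransp_lo {n : ℕ} (i : Fin (n - 1)) : simpleTransp n i (lo i) = hi i :=
  Equiv.swap_apply_left _ _

theorem simpleTransp_hi {n : ℕ} (i : Fin (n - 1)) : simpleTransp n i (hi i) = lo i :=
  Equiv.swap_apply_right _ _

theorem simpleTransp_of_ne {n : ℕ} {i : Fin (n - 1)} {p : Fin n} (h₁ : p ≠ lo i) (h₂ : p ≠ hi i) :
    simpleTransp n i p = p :=
  Equiv.swap_apply_of_ne_of_ne h₁ h₂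

theorem simpleTransp_mul_self {n : ℕ} (i : Fin (n - 1)) :
    simpleTransp n i * simpleTransp n i = 1 :=
  Equiv.swap_mul_self _ _

theorem simpleTransp_simpleTransp {n : ℕ} (i : Fin (n - 1)) (p : Fin n) :
    simpleTransp n i (simpleTransp n i p) = p :=
  Equiv.swap_apply_self _ _ _

theorem simpleTransp_inv {n : ℕ} (i : Fin (n - 1)) :
    (simpleTransp n i)⁻¹ = simpleTransp n i :=
  Equiv.swap_inv _ _

theorem simpleTransp_mul_cancel {n : ℕ} (i : Fin (n - 1)) (w : Perm (Fin n)) :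
    simpleTransp n i * (simpleTransp n i * w) = w := by
  rw [← mul_assoc, simpleTransp_mul_self, one_mul]

theorem simpleTransp_lt {n : ℕ} {i : Fin (n - 1)} {p q : Fin n} (h : p < q)
    (hne : ¬(p = lo i ∧ q = hi i)) : simpleTransp n i p < simpleTransp n i q := by
  have hval : ∀ r : Fin n, ((simpleTransp n i r : Fin n) : ℕ) =
      if (r : ℕ) = i then (i : ℕ) + 1 else if (r : ℕ) = i + 1 then (i : ℕ) else r := by
    intro r
    by_cases h1 : r = lo i
    · subst h1; rw [simpleTransp_lo]; simp [lo, hi]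
    · by_cases h2 : r = hi i
      · subst h2; rw [simpleTransp_hi]; simp [lo, hi]
      · rw [simpleTransp_of_ne h1 h2]
        have h1' : (r : ℕ) ≠ i := fun h => h1 (Fin.ext h)
        have h2' : (r : ℕ) ≠ i + 1 := fun h => h2 (Fin.ext h)
        simp [h1', h2']
  have hne' : ¬((p : ℕ) = i ∧ (q : ℕ) = i + 1) := fun h => hne ⟨Fin.ext h.1, Fin.ext h.2⟩
  rw [Fin.lt_def] at h ⊢
  rw [hval, hval]
  split_ifs <;> omega

/-- The set of inversions of `v`. -/
def invSet {n : ℕ} (v : Perm (Fin n)) : Finset (Fin n × Fin n) :=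
  {p | p.1 < p.2 ∧ v p.2 < v p.1}

theorem mem_invSet {n : ℕ} {v : Perm (Fin n)} {p : Fin n × Fin n} :
    p ∈ invSet v ↔ p.1 < p.2 ∧ v p.2 < v p.1 := by simp [invSet]

/-- The transposition keeps the order of every pair of positions except `(i, i+1)`, so it carries
the old inversions to the new ones and adds just that pair. -/
theorem card_invSet_mul {n : ℕ} (v : Perm (Fin n)) (i : Fin (n - 1)) (h : v (lo i) < v (hi i)) :
    (invSet (v * simpleTransp n i)).card = (invSet v).card + 1 := by
  have hset : invSet (v * simpleTransp n i) = insert (lo i, hi i)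
      ((invSet v).map ((simpleTransp n i).prodCongr (simpleTransp n i)).toEmbedding) := by
    ext ⟨p, q⟩
    simp only [Finset.mem_insert, Finset.mem_map_equiv, mem_invSet, Equiv.prodCongr_symm,
      Equiv.prodCongr_apply, Prod.map_apply, Perm.mul_apply, Prod.mk.injEq]
    have hs : (simpleTransp n i).symm = simpleTransp n i := simpleTransp_inv i
    rw [hs]
    by_cases hpq : p = lo i ∧ q = hi i
    · obtain ⟨rfl, rfl⟩ := hpq
      simp [simpleTransp_lo, simpleTransp_hi, lo_lt_hi, h]
    · simp only [hpq, false_or]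
      refine and_congr_left fun hv => ⟨fun h' => simpleTransp_lt h' hpq, fun h' => ?_⟩
      have := simpleTransp_lt (i := i) h' ?_
      · simpa [simpleTransp_simpleTransp] using this
      · rintro ⟨h1, h2⟩
        rw [h1, h2] at hv
        exact absurd hv h.not_gt
  rw [hset, Finset.card_insert_of_notMem, Finset.card_map]
  rw [Finset.mem_map_equiv]
  have hs : (simpleTransp n i).symm = simpleTransp n i := simpleTransp_inv i
  simp [mem_invSet, hs, simpleTransp_lo, simpleTransp_hi, (lo_lt_hi i).not_gt]

/-- The length of `w`. -/
def plen {n : ℕ} (w : Perm (Fin n)) : ℕ := (invSet w⁻¹).card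

/-- Because `plen` counts the inversions of the inverse, left multiplication of `w` is right
multiplication of `w⁻¹`. -/
theorem plen_simpleTransp_mul_of_lt {n : ℕ} {w : Perm (Fin n)} {i : Fin (n - 1)}
    (h : w⁻¹ (lo i) < w⁻¹ (hi i)) : plen (simpleTransp n i * w) = plen w + 1 := by
  rw [plen, mul_inv_rev, simpleTransp_inv, card_invSet_mul _ _ h, plen]

theorem plen_of_gt {n : ℕ} {w : Perm (Fin n)} {i : Fin (n - 1)}
    (h : w⁻¹ (hi i) < w⁻¹ (lo i)) : plen w = plen (simpleTransp n i * w) + 1 := by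
  conv_lhs => rw [← simpleTransp_mul_cancel i w]
  refine plen_simpleTransp_mul_of_lt ?_
  simpa [mul_inv_rev, simpleTransp_inv, simpleTransp_lo, simpleTransp_hi] using h

theorem lt_or_gt_lo_hi {n : ℕ} (w : Perm (Fin n)) (i : Fin (n - 1)) :
    w (lo i) < w (hi i) ∨ w (hi i) < w (lo i) :=
  lt_or_gt_of_ne fun h => lo_ne_hi i (w.injective h)

theorem plen_one {n : ℕ} : plen (1 : Perm (Fin n)) = 0 := by
  rw [plen, Finset.card_eq_zero, Finset.eq_empty_iff_forall_notMem]
  rintro ⟨p, q⟩ h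
  rw [mem_invSet] at h
  simp only [inv_one, Perm.one_apply] at h
  exact h.1.not_gt h.2

theorem strictMono_of_lo_lt_hi {n : ℕ} {v : Perm (Fin n)} (h : ∀ i, v (lo i) < v (hi i)) :
    StrictMono v := by
  cases n with
  | zero => intro a; exact a.elim0
  | succ m => exact Fin.strictMono_iff_lt_succ.2 fun i => h i

theorem eq_one_of_strictMono {n : ℕ} {v : Perm (Fin n)} (h : StrictMono v) : v = 1 := by
  have : (h.orderIsoOfSurjective v v.surjective) = OrderIso.refl _ := Subsingleton.elim _ _
  ext p
  have := congrArg (fun e : Fin n ≃o Fin n => ((e p : Fin n) : ℕ)) this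
  simpa using this

theorem exists_descent {n : ℕ} {w : Perm (Fin n)} (hw : w ≠ 1) :
    ∃ i : Fin (n - 1), w⁻¹ (hi i) < w⁻¹ (lo i) := by
  by_contra hcon
  push Not at hcon
  refine hw (inv_eq_one.1 (eq_one_of_strictMono (strictMono_of_lo_lt_hi fun i => ?_)))
  exact (hcon i).lt_of_ne fun h => lo_ne_hi i (w⁻¹.injective h)

theorem wordProd_cons {n : ℕ} (i : Fin (n - 1)) (l : List (Fin (n - 1))) :
    wordProd n (i :: l) = simpleTransp n i * wordProd n l := by simp [wordProd]

theorem wordProd_append {n : ℕ} (a b : List (Fin (n - 1))) :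
    wordProd n (a ++ b) = wordProd n a * wordProd n b := by simp [wordProd]

theorem wordProd_reverse {n : ℕ} (a : List (Fin (n - 1))) :
    wordProd n a.reverse = (wordProd n a)⁻¹ := by
  induction a with
  | nil => simp [wordProd]
  | cons i l ih =>
    rw [List.reverse_cons, wordProd_append, ih, wordProd_cons i l, mul_inv_rev,
      simpleTransp_inv]
    simp [wordProd]

theorem plen_wordProd_le {n : ℕ} (a : List (Fin (n - 1))) : plen (wordProd n a) ≤ a.length := by
  induction a with
  | nil => simp [wordProd, plen_one]
  | cons i l ih =>
    rw [wordProd_cons, List.length_cons]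
    rcases lt_or_gt_lo_hi (wordProd n l)⁻¹ i with h | h
    · rw [plen_simpleTransp_mul_of_lt h]; omega
    · have := plen_of_gt h; omega

theorem exists_word_length_eq {n : ℕ} (w : Perm (Fin n)) :
    ∃ a, wordProd n a = w ∧ a.length = plen w := by
  induction h : plen w using Nat.strong_induction_on generalizing w with
  | _ k ih =>
    by_cases hw : w = 1
    · subst hw
      exact ⟨[], by simp [wordProd], by rw [← h, plen_one]; rfl⟩
    · obtain ⟨i, hi⟩ := exists_descent hw
      have h1 := plen_of_gt hi
      obtain ⟨a, ha, hl⟩ := ih _ (by omega) (simpleTransp n i * w) rfl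
      refine ⟨i :: a, ?_, ?_⟩
      · rw [wordProd_cons, ha, simpleTransp_mul_cancel]
      · rw [List.length_cons, hl]; omega

theorem IsReducedWord.length_eq {n : ℕ} {w : Perm (Fin n)} {a : List (Fin (n - 1))}
    (h : IsReducedWord n w a) : a.length = plen w := by
  obtain ⟨b, hb, hl⟩ := exists_word_length_eq w
  have h1 := h.2 b hb
  have h2 := plen_wordProd_le a
  rw [h.1] at h2
  omega

theorem plen_inv {n : ℕ} (w : Perm (Fin n)) : plen w⁻¹ = plen w := by
  have key : ∀ v : Perm (Fin n), plen v⁻¹ ≤ plen v := by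
    intro v
    obtain ⟨a, ha, hl⟩ := exists_word_length_eq v
    have := plen_wordProd_le a.reverse
    rwa [wordProd_reverse, ha, List.length_reverse, hl] at this
  refine le_antisymm (key w) ?_
  simpa using key w⁻¹

theorem longest_apply {n : ℕ} (p : Fin n) : longest n p = Fin.rev p := rfl

theorem longest_inv {n : ℕ} : (longest n)⁻¹ = longest n := by
  rw [inv_eq_iff_mul_eq_one]
  ext p
  simp [longest_apply]

theorem longest_mul_self {n : ℕ} : longest n * longest n = 1 := by
  ext p
  simp [longest_apply]

theorem longest_mul_cancel {n : ℕ} (w : Perm (Fin n)) : longest n * (longest n * w) = w := by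
  rw [← mul_assoc, longest_mul_self, one_mul]

theorem plen_longest_eq_card {n : ℕ} :
    plen (longest n) = (Finset.univ.filter fun p : Fin n × Fin n => p.1 < p.2).card := by
  rw [plen, longest_inv]
  congr 1
  ext p
  simp only [mem_invSet, longest_apply, Fin.rev_lt_rev, and_self, Finset.mem_filter,
    Finset.mem_univ, true_and]

/-- Composing `w⁻¹` with the reversal of values exchanges inversions and non-inversions. -/
theorem plen_mul_longest {n : ℕ} (w : Perm (Fin n)) :
    plen (w * longest n) + plen w = plen (longest n) := by
  rw [plen_longest_eq_card, plen, plen, mul_inv_rev, longest_inv, add_comm,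
    ← Finset.card_filter_add_card_filter_not (s := Finset.univ.filter fun p : Fin n × Fin n => p.1 < p.2)
      (fun p : Fin n × Fin n => w⁻¹ p.2 < w⁻¹ p.1),
    Finset.filter_filter, Finset.filter_filter]
  congr 2
  ext p
  simp only [mem_invSet, Perm.mul_apply, longest_apply, Fin.rev_lt_rev, Finset.mem_filter,
    Finset.mem_univ, true_and, not_lt]
  refine and_congr_right fun h => ⟨fun h' => h'.le, fun h' => h'.lt_of_ne fun h'' => ?_⟩
  exact h.ne (w⁻¹.injective h'')

theorem plen_longest_mul {n : ℕ} (w : Perm (Fin n)) :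
    plen (longest n * w) + plen w = plen (longest n) := by
  have := plen_mul_longest w⁻¹
  rwa [plen_inv, ← plen_inv, mul_inv_rev, inv_inv, longest_inv] at this

theorem plen_le_longest {n : ℕ} (w : Perm (Fin n)) : plen w ≤ plen (longest n) := by
  have := plen_mul_longest w
  omega

theorem eq_one_of_plen_eq_zero {n : ℕ} {w : Perm (Fin n)} (h : plen w = 0) : w = 1 := by
  by_contra hw
  obtain ⟨i, hi⟩ := exists_descent hw
  have := plen_of_gt hi
  omega

theorem eq_longest_of_plen {n : ℕ} {w : Perm (Fin n)} (h : plen w = plen (longest n)) :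
    w = longest n := by
  have h1 := plen_mul_longest w
  have h2 : w * longest n = 1 := eq_one_of_plen_eq_zero (by omega)
  rw [mul_eq_one_iff_eq_inv.1 h2, longest_inv]

theorem plen_longest {n : ℕ} : plen (longest n) = ∑ i : Fin n, (n - 1 - (i : ℕ)) := by
  rw [plen_longest_eq_card, Finset.card_filter, Fintype.sum_prod_type]
  refine Finset.sum_congr rfl fun i _ => ?_
  rw [← Finset.card_filter]
  have : (Finset.univ.filter fun j : Fin n => i < j) = Finset.Ioi i := by ext; simp
  rw [this, Fin.card_Ioi]

/-! ### Divided differences over a general base ring -/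

theorem simpleTransp_comm {n : ℕ} {i j : Fin (n - 1)} (h : (i : ℕ) + 1 < j) :
    simpleTransp n i * simpleTransp n j = simpleTransp n j * simpleTransp n i := by
  have hll : lo j ≠ lo i := fun h' => by have := congrArg Fin.val h'; simp [lo] at this; omega
  have hlh : lo j ≠ hi i := fun h' => by have := congrArg Fin.val h'; simp [lo, hi] at this; omega
  have hhl : hi j ≠ lo i := fun h' => by have := congrArg Fin.val h'; simp [lo, hi] at this; omega
  have hhh : hi j ≠ hi i := fun h' => by have := congrArg Fin.val h'; simp [hi] at this; omega
  have hdis : Perm.Disjoint (simpleTransp n i) (simpleTransp n j) := by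
    intro p
    by_cases h1 : p = lo i
    · subst h1; exact Or.inr (simpleTransp_of_ne hll.symm hhl.symm)
    · by_cases h2 : p = hi i
      · subst h2; exact Or.inr (simpleTransp_of_ne hlh.symm hhh.symm)
      · exact Or.inl (simpleTransp_of_ne h1 h2)
  exact hdis.commute.eq

theorem simpleTransp_braid {n : ℕ} {i j : Fin (n - 1)} (h : (i : ℕ) + 1 = j) :
    simpleTransp n i * (simpleTransp n j * simpleTransp n i) =
      simpleTransp n j * (simpleTransp n i * simpleTransp n j) := by
  have hlj : lo j = hi i := Fin.ext (by simp [lo, hi, h])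
  have hli : lo i ≠ lo j := hlj ▸ lo_ne_hi i
  have hlh : lo i ≠ hi j := fun h' => by have := congrArg Fin.val h'; simp [lo, hi] at this; omega
  have hhh : hi j ≠ hi i := fun h' => by have := congrArg Fin.val h'; simp [hi] at this; omega
  have si_hj := simpleTransp_of_ne hlh.symm hhh
  have sj_li := simpleTransp_of_ne hli hlh
  have si_lj : simpleTransp n i (lo j) = lo i := by rw [hlj, simpleTransp_hi]
  have sj_hi : simpleTransp n j (hi i) = hi j := by rw [← hlj, simpleTransp_lo]
  ext p
  simp only [Perm.mul_apply]
  congr 1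
  by_cases h1 : p = lo i
  · subst h1
    rw [sj_li, simpleTransp_lo, sj_hi, si_hj]
  · by_cases h2 : p = hi i
    · subst h2
      rw [simpleTransp_hi, sj_li, simpleTransp_lo, sj_hi, si_hj, simpleTransp_hi, hlj]
    · by_cases h3 : p = hi j
      · subst h3
        rw [si_hj, simpleTransp_hi, si_lj, sj_li]
      · have h4 : p ≠ lo j := hlj ▸ h2
        rw [simpleTransp_of_ne h1 h2, simpleTransp_of_ne h4 h3,
          simpleTransp_of_ne h1 h2, simpleTransp_of_ne h4 h3]

/-- The substitution `X_a ↦ X_a + X_b` is injective and turns the difference into a variable. No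
domain hypothesis enters, which matters because divided differences are later taken over tensor
products. -/
theorem isRegular_X_sub_X {σ R : Type*} [CommRing R] {a b : σ} (hab : a ≠ b) :
    IsRegular (MvPolynomial.X a - MvPolynomial.X b : MvPolynomial σ R) := by
  classical
  let F : MvPolynomial σ R →ₐ[R] MvPolynomial σ R :=
    MvPolynomial.aeval fun c => if c = a then MvPolynomial.X a + MvPolynomial.X b
      else MvPolynomial.X c
  let G : MvPolynomial σ R →ₐ[R] MvPolynomial σ R :=
    MvPolynomial.aeval fun c => if c = a then MvPolynomial.X a - MvPolynomial.X b
      else MvPolynomial.X c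
  have hGF : G.comp F = AlgHom.id R _ := by
    ext c : 1
    by_cases hc : c = a
    · subst hc; simp [F, G, hab.symm]
    · simp [F, G, hc]
  have hF : ∀ p, G (F p) = p := fun p => DFunLike.congr_fun hGF p
  have hl : IsLeftRegular (MvPolynomial.X a - MvPolynomial.X b : MvPolynomial σ R) := by
    intro f g hfg
    have h := congrArg F hfg
    simp only [map_mul, map_sub] at h
    have hX : F (MvPolynomial.X a) - F (MvPolynomial.X b) = MvPolynomial.X a := by
      simp [F, hab.symm]
    rw [hX] at h
    have h2 := MvPolynomial.isRegular_X.left h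
    rw [← hF f, ← hF g, h2]
  exact ⟨hl, hl.right_of_commute (fun _ => mul_comm _ _)⟩

section DividedDifference

variable {n : ℕ} {R : Type*} [CommRing R]

/-- The root `y_i - y_{i+1}`. -/
def root (R : Type*) [CommRing R] {n : ℕ} (i : Fin (n - 1)) : MvPolynomial (Fin n) R :=
  MvPolynomial.X (lo i) - MvPolynomial.X (hi i)

theorem root_mul_cancel (i : Fin (n - 1)) {f g : MvPolynomial (Fin n) R}
    (h : root R i * f = root R i * g) : f = g :=
  (isRegular_X_sub_X (lo_ne_hi i)).left h

/-- The action of the simple transposition. -/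
abbrev refl (R : Type*) [CommRing R] {n : ℕ} (i : Fin (n - 1)) :
    MvPolynomial (Fin n) R →ₐ[R] MvPolynomial (Fin n) R :=
  MvPolynomial.rename (simpleTransp n i)

theorem exists_root_mul (i : Fin (n - 1)) (f : MvPolynomial (Fin n) R) :
    ∃ g, f - refl R i f = root R i * g :=
  sub_dvd_sub_swap (lo i) (hi i) f

theorem refl_refl (i : Fin (n - 1)) (f : MvPolynomial (Fin n) R) :
    refl R i (refl R i f) = f := by
  rw [MvPolynomial.rename_rename]
  have : (simpleTransp n i ∘ simpleTransp n i : Fin n → Fin n) = id :=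
    funext fun p => simpleTransp_simpleTransp i p
  rw [this, MvPolynomial.rename_id_apply]

theorem refl_root (i : Fin (n - 1)) : refl R i (root R i) = -root R i := by
  simp [root, simpleTransp_lo, simpleTransp_hi]

/-- The divided difference `∂_i`. -/
def dd (R : Type*) [CommRing R] {n : ℕ} (i : Fin (n - 1)) :
    MvPolynomial (Fin n) R →ₗ[R] MvPolynomial (Fin n) R where
  toFun f := Classical.choose (exists_root_mul i f)
  map_add' f g := by
    apply root_mul_cancel i
    rw [mul_add, ← Classical.choose_spec (exists_root_mul i f),
      ← Classical.choose_spec (exists_root_mul i g),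
      ← Classical.choose_spec (exists_root_mul i (f + g)), map_add]
    ring
  map_smul' c f := by
    apply root_mul_cancel i
    rw [RingHom.id_apply, mul_smul_comm, ← Classical.choose_spec (exists_root_mul i f),
      ← Classical.choose_spec (exists_root_mul i (c • f)), map_smul, smul_sub]

theorem root_mul_dd (i : Fin (n - 1)) (f : MvPolynomial (Fin n) R) :
    root R i * dd R i f = f - refl R i f :=
  (Classical.choose_spec (exists_root_mul i f)).symm

theorem dd_eq_of_root_mul {i : Fin (n - 1)} {f g : MvPolynomial (Fin n) R}
    (h : root R i * g = f - refl R i f) : dd R i f = g :=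
  root_mul_cancel i (by rw [root_mul_dd, h])

theorem dd_eq_zero_iff {i : Fin (n - 1)} {f : MvPolynomial (Fin n) R} :
    dd R i f = 0 ↔ refl R i f = f := by
  constructor
  · intro h
    have := root_mul_dd i f
    rw [h, mul_zero] at this
    exact (sub_eq_zero.1 this.symm).symm
  · intro h
    exact dd_eq_of_root_mul (by rw [h, sub_self, mul_zero])

theorem dd_mul (i : Fin (n - 1)) (f g : MvPolynomial (Fin n) R) :
    dd R i (f * g) = dd R i f * g + refl R i f * dd R i g := by
  apply dd_eq_of_root_mul
  rw [map_mul]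
  linear_combination g * root_mul_dd i f + refl R i f * root_mul_dd i g

theorem dd_mul_of_refl_eq {i : Fin (n - 1)} {f : MvPolynomial (Fin n) R} (h : refl R i f = f)
    (g : MvPolynomial (Fin n) R) : dd R i (f * g) = f * dd R i g := by
  rw [dd_mul, dd_eq_zero_iff.2 h, h, zero_mul, zero_add]

theorem refl_dd (i : Fin (n - 1)) (f : MvPolynomial (Fin n) R) :
    refl R i (dd R i f) = dd R i f := by
  apply root_mul_cancel i
  have h := congrArg (refl R i) (root_mul_dd i f)
  rw [map_mul, map_sub, refl_refl, refl_root] at h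
  linear_combination -h - root_mul_dd i f

theorem dd_dd (i : Fin (n - 1)) (f : MvPolynomial (Fin n) R) : dd R i (dd R i f) = 0 :=
  dd_eq_zero_iff.2 (refl_dd i f)

theorem dd_refl (i : Fin (n - 1)) (f : MvPolynomial (Fin n) R) :
    dd R i (refl R i f) = -dd R i f := by
  apply dd_eq_of_root_mul
  rw [refl_refl]
  linear_combination -root_mul_dd i f

theorem dd_dd_mul (i : Fin (n - 1)) (f g : MvPolynomial (Fin n) R) :
    dd R i (dd R i f * g) = dd R i (f * dd R i g) := by
  rw [dd_mul_of_refl_eq (refl_dd i f), mul_comm f, dd_mul_of_refl_eq (refl_dd i g), mul_comm]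

theorem map_dd {S : Type*} [CommRing S] (φ : R →+* S) (i : Fin (n - 1))
    (f : MvPolynomial (Fin n) R) :
    MvPolynomial.map φ (dd R i f) = dd S i (MvPolynomial.map φ f) := by
  symm
  apply dd_eq_of_root_mul
  have h := congrArg (MvPolynomial.map φ) (root_mul_dd i f)
  simp only [root, map_mul, map_sub, MvPolynomial.map_X, MvPolynomial.map_rename] at h
  exact h

/-- Multiplied by both roots, each side becomes the signed sum of `f` over the four products of the
two commuting reflections. -/
theorem dd_comm {i j : Fin (n - 1)} (h : (i : ℕ) + 1 < j) (f : MvPolynomial (Fin n) R) :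
    dd R i (dd R j f) = dd R j (dd R i f) := by
  have hll : lo j ≠ lo i := fun h' => by have := congrArg Fin.val h'; simp [lo] at this; omega
  have hlh : lo j ≠ hi i := fun h' => by have := congrArg Fin.val h'; simp [lo, hi] at this; omega
  have hhl : hi j ≠ lo i := fun h' => by have := congrArg Fin.val h'; simp [lo, hi] at this; omega
  have hhh : hi j ≠ hi i := fun h' => by have := congrArg Fin.val h'; simp [hi] at this; omega
  have hij : refl R i (root R j) = root R j := by
    simp [root, simpleTransp_of_ne hll hlh, simpleTransp_of_ne hhl hhh]
  have hji : refl R j (root R i) = root R i := by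
    simp [root, simpleTransp_of_ne hll.symm hhl.symm, simpleTransp_of_ne hlh.symm hhh.symm]
  have hcomm : refl R i (refl R j f) = refl R j (refl R i f) := by
    have e : (simpleTransp n i ∘ simpleTransp n j : Fin n → Fin n) =
        simpleTransp n j ∘ simpleTransp n i :=
      funext fun p => DFunLike.congr_fun (simpleTransp_comm h) p
    rw [MvPolynomial.rename_rename, MvPolynomial.rename_rename, e]
  apply root_mul_cancel i
  apply root_mul_cancel j
  have e1 := root_mul_dd i (dd R j f)
  have e2 := root_mul_dd j (dd R i f)
  have e3 := root_mul_dd i f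
  have e4 := root_mul_dd j f
  have e5 := congrArg (refl R i) e4
  have e6 := congrArg (refl R j) e3
  rw [map_mul, map_sub, hij] at e5
  rw [map_mul, map_sub, hji] at e6
  linear_combination root R j * e1 - root R i * e2 + e4 - e5 - e3 + e6 + hcomm

/-- Multiplied by `(x - y)(y - z)(x - z)`, each side becomes the antisymmetrization of `f` over the
copy of `S_3` permuting these three variables. -/
theorem dd_braid {i j : Fin (n - 1)} (h : (i : ℕ) + 1 = j) (f : MvPolynomial (Fin n) R) :
    dd R i (dd R j (dd R i f)) = dd R j (dd R i (dd R j f)) := by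
  have hij : lo j = hi i := Fin.ext (by simp [lo, hi, h])
  have hli : lo i ≠ lo j := hij ▸ lo_ne_hi i
  have hlh : lo i ≠ hi j := fun h' => by have := congrArg Fin.val h'; simp [lo, hi] at this; omega
  have hhh : hi j ≠ hi i := fun h' => by have := congrArg Fin.val h'; simp [hi] at this; omega
  obtain ⟨x, hx⟩ : ∃ x : MvPolynomial (Fin n) R, x = MvPolynomial.X (lo i) := ⟨_, rfl⟩
  obtain ⟨y, hy⟩ : ∃ y : MvPolynomial (Fin n) R, y = MvPolynomial.X (hi i) := ⟨_, rfl⟩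
  obtain ⟨z, hz⟩ : ∃ z : MvPolynomial (Fin n) R, z = MvPolynomial.X (hi j) := ⟨_, rfl⟩
  have six : refl R i x = y := by simp [hx, hy, simpleTransp_lo]
  have siy : refl R i y = x := by simp [hx, hy, simpleTransp_hi]
  have siz : refl R i z = z := by simp [hz, simpleTransp_of_ne hlh.symm hhh]
  have sjx : refl R j x = x := by simp [hx, simpleTransp_of_ne hli hlh]
  have sjy : refl R j y = z := by simp [hy, hz, ← hij, simpleTransp_lo]
  have sjz : refl R j z = y := by simp [hy, hz, ← hij, simpleTransp_hi]
  have ri : root R i = x - y := by rw [root, hx, hy]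
  have rj : root R j = y - z := by rw [root, hij, hy, hz]
  have hb : refl R i (refl R j (refl R i f)) = refl R j (refl R i (refl R j f)) := by
    have e : (simpleTransp n i ∘ (simpleTransp n j ∘ simpleTransp n i) : Fin n → Fin n) =
        simpleTransp n j ∘ (simpleTransp n i ∘ simpleTransp n j) :=
      funext fun p => DFunLike.congr_fun (simpleTransp_braid h) p
    simp only [MvPolynomial.rename_rename]
    rw [e]
  have hreg : ∀ {p q : MvPolynomial (Fin n) R}, (x - z) * p = (x - z) * q → p = q := by
    intro p q hpq
    rw [hx, hz] at hpq
    exact (isRegular_X_sub_X hlh).left hpq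
  have a1 := root_mul_dd i f
  have a2 := congrArg (refl R j) a1
  have a3 := congrArg (refl R i) a2
  have a4 := root_mul_dd j (dd R i f)
  have a5 := congrArg (refl R i) a4
  have a6 := root_mul_dd i (dd R j (dd R i f))
  have b1 := root_mul_dd j f
  have b2 := congrArg (refl R i) b1
  have b3 := congrArg (refl R j) b2
  have b4 := root_mul_dd i (dd R j f)
  have b5 := congrArg (refl R j) b4
  have b6 := root_mul_dd j (dd R i (dd R j f))
  rw [ri] at a1 a2 a3 a6 b4 b5
  rw [rj] at a4 a5 b1 b2 b3 b6
  simp only [map_mul, map_sub, six, siy, siz, sjx, sjy, sjz, refl_dd] at a1 a2 a3 a4 a5 a6 b1 b2 b3 b4 b5 b6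
  apply root_mul_cancel i
  apply root_mul_cancel j
  apply hreg
  rw [ri, rj]
  linear_combination (y - z) * (x - z) * a6 + (x - z) * a4 - (y - z) * a5 + a1 - a2 + a3
    - ((x - y) * (x - z) * b6 + (x - z) * b4 - (x - y) * b5 + b1 - b2 + b3) - hb

theorem IsSymmetric.of_dd {f : MvPolynomial (Fin n) R} (h : ∀ i, dd R i f = 0) :
    f.IsSymmetric := by
  intro w
  obtain ⟨a, rfl⟩ := exists_word n w
  induction a with
  | nil => simp [wordProd]
  | cons i l ih =>
    have e : (⇑(wordProd n (i :: l)) : Fin n → Fin n) = simpleTransp n i ∘ wordProd n l := by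
      rw [wordProd_cons]; rfl
    rw [e, ← MvPolynomial.rename_rename, ih]
    exact dd_eq_zero_iff.1 (h i)

theorem dd_mul_of_isSymmetric {i : Fin (n - 1)} {f : MvPolynomial (Fin n) R} (h : f.IsSymmetric)
    (g : MvPolynomial (Fin n) R) : dd R i (f * g) = f * dd R i g :=
  dd_mul_of_refl_eq (h _) g

theorem dd_C (i : Fin (n - 1)) (c : R) : dd R i (MvPolynomial.C c) = 0 :=
  dd_eq_zero_iff.2 (MvPolynomial.rename_C _ _)

theorem isHomogeneous_dd_X (i : Fin (n - 1)) (p : Fin n) :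
    (dd R i (MvPolynomial.X p)).IsHomogeneous 0 := by
  by_cases h1 : p = lo i
  · have : dd R i (MvPolynomial.X p) = MvPolynomial.C 1 := by
      apply dd_eq_of_root_mul
      rw [h1, MvPolynomial.rename_X, simpleTransp_lo, root]
      simp
    rw [this]
    exact MvPolynomial.isHomogeneous_C _ _
  · by_cases h2 : p = hi i
    · have : dd R i (MvPolynomial.X p) = MvPolynomial.C (-1) := by
        apply dd_eq_of_root_mul
        rw [h2, MvPolynomial.rename_X, simpleTransp_hi, root]
        simp
      rw [this]
      exact MvPolynomial.isHomogeneous_C _ _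
    · have : dd R i (MvPolynomial.X p) = 0 := by
        rw [dd_eq_zero_iff, MvPolynomial.rename_X, simpleTransp_of_ne h1 h2]
      rw [this]
      exact MvPolynomial.isHomogeneous_zero _ _ _

theorem isHomogeneous_dd_monomial (i : Fin (n - 1)) (d : ℕ) (m : Fin n →₀ ℕ)
    (hm : m.degree = d + 1) (c : R) : (dd R i (MvPolynomial.monomial m c)).IsHomogeneous d := by
  induction d generalizing m with
  | zero =>
    obtain ⟨p, rfl⟩ : ∃ p, m = Finsupp.single p 1 := by
      have hne : m ≠ 0 := by rintro rfl; simp at hm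
      obtain ⟨p, hp⟩ := Finsupp.ne_iff.1 hne
      have hle : Finsupp.single p 1 ≤ m := by
        rw [Finsupp.single_le_iff]; exact Nat.one_le_iff_ne_zero.2 hp
      obtain ⟨m', rfl⟩ := exists_add_of_le hle
      rw [map_add, Finsupp.degree_single] at hm
      have : m' = 0 := (Finsupp.degree_eq_zero_iff _).1 (by omega)
      exact ⟨p, by rw [this, add_zero]⟩
    have : MvPolynomial.monomial (Finsupp.single p 1) c = c • MvPolynomial.X p := by
      rw [MvPolynomial.X, MvPolynomial.smul_monomial, smul_eq_mul, mul_one]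
    rw [this, map_smul, MvPolynomial.smul_eq_C_mul]
    simpa using (MvPolynomial.isHomogeneous_C (Fin n) c).mul (isHomogeneous_dd_X i p)
  | succ d ih =>
    have hne : m ≠ 0 := by rintro rfl; simp at hm
    obtain ⟨p, hp⟩ := Finsupp.ne_iff.1 hne
    have hle : Finsupp.single p 1 ≤ m := by
      rw [Finsupp.single_le_iff]; exact Nat.one_le_iff_ne_zero.2 hp
    obtain ⟨m', rfl⟩ := exists_add_of_le hle
    rw [map_add, Finsupp.degree_single] at hm
    have hm' : m'.degree = d + 1 := by omega
    have : MvPolynomial.monomial (Finsupp.single p 1 + m') c =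
        MvPolynomial.X p * MvPolynomial.monomial m' c := by
      rw [MvPolynomial.X, MvPolynomial.monomial_mul, one_mul]
    rw [this, dd_mul, MvPolynomial.rename_X]
    refine MvPolynomial.IsHomogeneous.add ?_ ?_
    · simpa using (isHomogeneous_dd_X i p).mul (MvPolynomial.isHomogeneous_monomial c hm')
    · simpa [add_comm] using (MvPolynomial.isHomogeneous_X R _).mul (ih m' hm')

theorem isHomogeneous_dd {i : Fin (n - 1)} {d : ℕ} {f : MvPolynomial (Fin n) R}
    (hf : f.IsHomogeneous (d + 1)) : (dd R i f).IsHomogeneous d := by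
  rw [f.as_sum, map_sum]
  refine MvPolynomial.IsHomogeneous.sum _ _ _ fun m hm => isHomogeneous_dd_monomial i d m ?_ _
  have := hf (MvPolynomial.mem_support_iff.1 hm)
  rw [Finsupp.degree_eq_weight_one]
  exact this

theorem dd_eq_zero_of_isHomogeneous_zero {i : Fin (n - 1)} {f : MvPolynomial (Fin n) R}
    (hf : f.IsHomogeneous 0) : dd R i f = 0 := by
  rw [MvPolynomial.totalDegree_eq_zero_iff_eq_C.1 ((MvPolynomial.totalDegree_zero_iff_isHomogeneous _).2 hf), dd_C]

/-! ### Composition along words -/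

/-- The operator `∂_{a₁} ⋯ ∂_{a_p}` of a word. -/
def ddWord (R : Type*) [CommRing R] {n : ℕ} (a : List (Fin (n - 1))) :
    MvPolynomial (Fin n) R →ₗ[R] MvPolynomial (Fin n) R :=
  a.foldr (fun i L => (dd R i).comp L) LinearMap.id

theorem ddWord_nil (f : MvPolynomial (Fin n) R) : ddWord R [] f = f := rfl

theorem ddWord_cons (i : Fin (n - 1)) (a : List (Fin (n - 1))) (f : MvPolynomial (Fin n) R) :
    ddWord R (i :: a) f = dd R i (ddWord R a f) := rfl

theorem ddWord_append (a b : List (Fin (n - 1))) (f : MvPolynomial (Fin n) R) :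
    ddWord R (a ++ b) f = ddWord R a (ddWord R b f) := by
  induction a with
  | nil => rfl
  | cons i a ih => rw [List.cons_append, ddWord_cons, ddWord_cons, ih]

theorem descent_of_reduced {i : Fin (n - 1)} {a : List (Fin (n - 1))}
    (h : (i :: a).length = plen (wordProd n (i :: a))) :
    a.length = plen (wordProd n a) ∧
      (wordProd n (i :: a))⁻¹ (hi i) < (wordProd n (i :: a))⁻¹ (lo i) := by
  have h1 := plen_wordProd_le a
  rw [List.length_cons] at h
  rcases lt_or_gt_lo_hi (wordProd n (i :: a))⁻¹ i with h2 | h2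
  · have := plen_simpleTransp_mul_of_lt h2
    rw [← h, wordProd_cons, simpleTransp_mul_cancel] at this
    omega
  · refine ⟨?_, h2⟩
    have := plen_of_gt h2
    rw [← h, wordProd_cons, simpleTransp_mul_cancel] at this
    omega

/-- Two descents of a permutation that commute or braid: the inductive step in the proof that
`∂_w` does not depend on the reduced word. -/
theorem ddWord_cons_eq_of_lt {i j : Fin (n - 1)} (hlt : (i : ℕ) < j) {a b : List (Fin (n - 1))}
    {w : Perm (Fin n)} (hdi : w⁻¹ (hi i) < w⁻¹ (lo i)) (hdj : w⁻¹ (hi j) < w⁻¹ (lo j))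
    (hwa : wordProd n a = simpleTransp n i * w) (hwb : wordProd n b = simpleTransp n j * w)
    (iha : ∀ c, wordProd n a = wordProd n c → c.length = plen (wordProd n c) →
      ddWord R a = ddWord R c)
    (ihb : ∀ c, wordProd n b = wordProd n c → c.length = plen (wordProd n c) →
      ddWord R b = ddWord R c) :
    ddWord R (i :: a) = ddWord R (j :: b) := by
  have hl1 := plen_of_gt hdi
  have hl2 := plen_of_gt hdj
  rcases Nat.lt_or_ge ((i : ℕ) + 1) j with hfar | hnear
  · have hll : lo j ≠ lo i := fun h' => by
      have := congrArg Fin.val h'; simp [lo] at this; omega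
    have hlh : lo j ≠ hi i := fun h' => by
      have := congrArg Fin.val h'; simp [lo, hi] at this; omega
    have hhl : hi j ≠ lo i := fun h' => by
      have := congrArg Fin.val h'; simp [lo, hi] at this; omega
    have hhh : hi j ≠ hi i := fun h' => by
      have := congrArg Fin.val h'; simp [hi] at this; omega
    have hd : (simpleTransp n i * w)⁻¹ (hi j) < (simpleTransp n i * w)⁻¹ (lo j) := by
      rw [mul_inv_rev, simpleTransp_inv, Perm.mul_apply, Perm.mul_apply,
        simpleTransp_of_ne hll hlh, simpleTransp_of_ne hhl hhh]
      exact hdj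
    have hl3 := plen_of_gt hd
    -- A common tail: by induction `a` may be replaced by `j :: c` and `b` by `i :: c`, so only the
    -- first two letters differ.
    obtain ⟨c, hc, hcl⟩ := exists_word_length_eq (simpleTransp n j * (simpleTransp n i * w))
    have hjc : wordProd n (j :: c) = simpleTransp n i * w := by
      rw [wordProd_cons, hc, simpleTransp_mul_cancel]
    have hic : wordProd n (i :: c) = simpleTransp n j * w := by
      rw [wordProd_cons, hc, ← mul_assoc (simpleTransp n j), ← simpleTransp_comm hfar, mul_assoc,
        simpleTransp_mul_cancel]
    have e1 : ddWord R a = ddWord R (j :: c) :=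
      iha _ (by rw [hwa, hjc]) (by rw [hjc, List.length_cons]; omega)
    have e2 : ddWord R b = ddWord R (i :: c) :=
      ihb _ (by rw [hwb, hic]) (by rw [hic, List.length_cons]; omega)
    refine LinearMap.ext fun f => ?_
    rw [ddWord_cons, ddWord_cons, e1, e2, ddWord_cons, ddWord_cons, dd_comm hfar]
  · have hnear' : (i : ℕ) + 1 = j := by omega
    have hlj : lo j = hi i := Fin.ext (by simp [lo, hi, hnear'])
    have hli : lo i ≠ lo j := hlj ▸ lo_ne_hi i
    have hlh : lo i ≠ hi j := fun h' => by
      have := congrArg Fin.val h'; simp [lo, hi] at this; omega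
    have hhh : hi j ≠ hi i := fun h' => by
      have := congrArg Fin.val h'; simp [hi] at this; omega
    have si_hj := simpleTransp_of_ne hlh.symm hhh
    have sj_li := simpleTransp_of_ne hli hlh
    have si_lj : simpleTransp n i (lo j) = lo i := by rw [hlj, simpleTransp_hi]
    have sj_hi : simpleTransp n j (hi i) = hi j := by rw [← hlj, simpleTransp_lo]
    have hdj' : w⁻¹ (hi j) < w⁻¹ (hi i) := hlj ▸ hdj
    have hbraid : simpleTransp n i * (simpleTransp n j * (simpleTransp n i * w)) =
        simpleTransp n j * (simpleTransp n i * (simpleTransp n j * w)) := by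
      have := congrArg (· * w) (simpleTransp_braid hnear')
      simpa only [mul_assoc] using this
    have hd1 : (simpleTransp n i * w)⁻¹ (hi j) < (simpleTransp n i * w)⁻¹ (lo j) := by
      rw [mul_inv_rev, simpleTransp_inv, Perm.mul_apply, Perm.mul_apply, si_hj, si_lj]
      exact hdj'.trans hdi
    have hd2 : (simpleTransp n j * (simpleTransp n i * w))⁻¹ (hi i) <
        (simpleTransp n j * (simpleTransp n i * w))⁻¹ (lo i) := by
      simp only [mul_inv_rev, simpleTransp_inv, Perm.mul_apply, sj_hi, sj_li, si_hj,
        simpleTransp_lo]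
      exact hdj'
    have hl3 := plen_of_gt hd1
    have hl4 := plen_of_gt hd2
    -- Having both descents allows three letters to be stripped; the two words become `i j i c` and
    -- `j i j c`.
    obtain ⟨c, hc, hcl⟩ := exists_word_length_eq
      (simpleTransp n i * (simpleTransp n j * (simpleTransp n i * w)))
    have hjc : wordProd n (j :: i :: c) = simpleTransp n i * w := by
      rw [wordProd_cons, wordProd_cons, hc, simpleTransp_mul_cancel, simpleTransp_mul_cancel]
    have hic : wordProd n (i :: j :: c) = simpleTransp n j * w := by
      rw [wordProd_cons, wordProd_cons, hc, hbraid, simpleTransp_mul_cancel,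
        simpleTransp_mul_cancel]
    have e1 : ddWord R a = ddWord R (j :: i :: c) :=
      iha _ (by rw [hwa, hjc]) (by rw [hjc, List.length_cons, List.length_cons]; omega)
    have e2 : ddWord R b = ddWord R (i :: j :: c) :=
      ihb _ (by rw [hwb, hic]) (by rw [hic, List.length_cons, List.length_cons]; omega)
    refine LinearMap.ext fun f => ?_
    rw [ddWord_cons, ddWord_cons, e1, e2]
    simp only [ddWord_cons]
    rw [dd_braid hnear']

/-- Strong induction on the length. Equal first letters are removed; different ones are both
descents of the same permutation, and the commutation or braid relation links them through shorter
words. -/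
theorem ddWord_eq_of_wordProd_eq (a b : List (Fin (n - 1))) (hab : wordProd n a = wordProd n b)
    (ha : a.length = plen (wordProd n a)) (hb : b.length = plen (wordProd n b)) :
    ddWord R a = ddWord R b := by
  induction hk : a.length using Nat.strong_induction_on generalizing a b with
  | _ k ih =>
    cases a with
    | nil =>
      have : b = [] := by
        rw [← List.length_eq_zero_iff, hb, ← hab, ← ha]; rfl
      rw [this]
    | cons i a =>
      cases b with
      | nil => rw [← hab, ← ha] at hb; simp at hb
      | cons j b =>
        obtain ⟨ha', hdi⟩ := descent_of_reduced ha
        obtain ⟨hb', hdj⟩ := descent_of_reduced hb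
        have hlen : (i :: a).length = (j :: b).length := by rw [ha, hb, hab]
        rw [List.length_cons] at hk
        rw [List.length_cons, List.length_cons] at hlen
        have iha : ∀ c, wordProd n a = wordProd n c → c.length = plen (wordProd n c) →
            ddWord R a = ddWord R c := fun c h1 h2 => ih _ (by omega) a c h1 ha' h2 rfl
        have ihb : ∀ c, wordProd n b = wordProd n c → c.length = plen (wordProd n c) →
            ddWord R b = ddWord R c := fun c h1 h2 => ih _ (by omega) b c h1 hb' h2 rfl
        have hwa : wordProd n a = simpleTransp n i * wordProd n (i :: a) := by
          rw [wordProd_cons, simpleTransp_mul_cancel]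
        have hwb : wordProd n b = simpleTransp n j * wordProd n (i :: a) := by
          rw [hab, wordProd_cons, simpleTransp_mul_cancel]
        rw [← hab] at hdj
        rcases lt_trichotomy (i : ℕ) j with hlt | heq | hgt
        · exact ddWord_cons_eq_of_lt hlt hdi hdj hwa hwb iha ihb
        · obtain rfl : i = j := Fin.ext heq
          have := iha b (by rw [hwa, hwb]) hb'
          refine LinearMap.ext fun f => ?_
          rw [ddWord_cons, ddWord_cons, this]
        · exact (ddWord_cons_eq_of_lt hgt hdj hdi hwb hwa ihb iha).symm

/-- The divided difference operator of a permutation. -/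
def ddPerm (R : Type*) [CommRing R] {n : ℕ} (w : Perm (Fin n)) :
    MvPolynomial (Fin n) R →ₗ[R] MvPolynomial (Fin n) R :=
  ddWord R (Classical.choose (exists_reducedWord n w))

theorem ddWord_eq_ddPerm {a : List (Fin (n - 1))} (ha : a.length = plen (wordProd n a)) :
    ddWord R a = ddPerm R (wordProd n a) := by
  have h := Classical.choose_spec (exists_reducedWord n (wordProd n a))
  refine ddWord_eq_of_wordProd_eq _ _ h.1.symm ha ?_
  rw [h.1]
  exact h.length_eq

theorem dd_ddPerm_of_lt {i : Fin (n - 1)} {w : Perm (Fin n)} (h : w⁻¹ (lo i) < w⁻¹ (hi i))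
    (f : MvPolynomial (Fin n) R) :
    dd R i (ddPerm R w f) = ddPerm R (simpleTransp n i * w) f := by
  obtain ⟨a, rfl, ha⟩ := exists_word_length_eq w
  rw [← ddWord_eq_ddPerm ha, ← wordProd_cons, ← ddWord_eq_ddPerm, ddWord_cons]
  rw [wordProd_cons, plen_simpleTransp_mul_of_lt h, List.length_cons, ha]

theorem dd_ddPerm_of_gt {i : Fin (n - 1)} {w : Perm (Fin n)} (h : w⁻¹ (hi i) < w⁻¹ (lo i))
    (f : MvPolynomial (Fin n) R) : dd R i (ddPerm R w f) = 0 := by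
  have h' : (simpleTransp n i * w)⁻¹ (lo i) < (simpleTransp n i * w)⁻¹ (hi i) := by
    simpa [mul_inv_rev, simpleTransp_inv, simpleTransp_lo, simpleTransp_hi] using h
  have := dd_ddPerm_of_lt h' f
  rw [simpleTransp_mul_cancel] at this
  rw [← this, dd_dd]

/-- In a non-reduced word, take the longest reduced suffix, with product `v`. The letter before it
is a descent of `v`, so `∂_v` starts with the same `∂_i` and `∂_i ∂_i = 0`. -/
theorem ddWord_eq_zero {a : List (Fin (n - 1))} (ha : a.length ≠ plen (wordProd n a))
    (f : MvPolynomial (Fin n) R) : ddWord R a f = 0 := by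
  induction a with
  | nil => simp [wordProd, plen_one] at ha
  | cons i a ih =>
    rw [ddWord_cons]
    by_cases h : a.length = plen (wordProd n a)
    · rcases lt_or_gt_lo_hi (wordProd n a)⁻¹ i with h1 | h1
      · rw [wordProd_cons, plen_simpleTransp_mul_of_lt h1, List.length_cons, h] at ha
        exact absurd rfl ha
      · rw [ddWord_eq_ddPerm h, dd_ddPerm_of_gt h1]
    · rw [ih h, map_zero]

theorem ddPerm_one (f : MvPolynomial (Fin n) R) : ddPerm R 1 f = f := by
  have : ddWord R [] = ddPerm R (wordProd n []) := ddWord_eq_ddPerm (by simp [wordProd, plen_one])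
  simp only [wordProd, List.map_nil, List.prod_nil] at this
  rw [← this, ddWord_nil]

theorem ddPerm_ddPerm_of_add_eq {u v : Perm (Fin n)} (h : plen u + plen v = plen (u * v))
    (f : MvPolynomial (Fin n) R) : ddPerm R u (ddPerm R v f) = ddPerm R (u * v) f := by
  obtain ⟨a, rfl, ha⟩ := exists_word_length_eq u
  obtain ⟨b, rfl, hb⟩ := exists_word_length_eq v
  rw [← ddWord_eq_ddPerm ha, ← ddWord_eq_ddPerm hb, ← ddWord_append, ← wordProd_append,
    ← ddWord_eq_ddPerm]
  rw [wordProd_append, ← h, List.length_append, ha, hb]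

theorem ddPerm_ddPerm_of_add_ne {u v : Perm (Fin n)} (h : plen u + plen v ≠ plen (u * v))
    (f : MvPolynomial (Fin n) R) : ddPerm R u (ddPerm R v f) = 0 := by
  obtain ⟨a, rfl, ha⟩ := exists_word_length_eq u
  obtain ⟨b, rfl, hb⟩ := exists_word_length_eq v
  rw [← ddWord_eq_ddPerm ha, ← ddWord_eq_ddPerm hb, ← ddWord_append, ddWord_eq_zero]
  rwa [wordProd_append, List.length_append, ha, hb]

theorem ddWord_mul_of_isSymmetric {f : MvPolynomial (Fin n) R} (h : f.IsSymmetric)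
    (a : List (Fin (n - 1))) (g : MvPolynomial (Fin n) R) :
    ddWord R a (f * g) = f * ddWord R a g := by
  induction a with
  | nil => rfl
  | cons i a ih => rw [ddWord_cons, ddWord_cons, ih, dd_mul_of_isSymmetric h]

theorem ddPerm_mul_of_isSymmetric {f : MvPolynomial (Fin n) R} (h : f.IsSymmetric)
    (w : Perm (Fin n)) (g : MvPolynomial (Fin n) R) :
    ddPerm R w (f * g) = f * ddPerm R w g :=
  ddWord_mul_of_isSymmetric h _ g

theorem map_ddPerm {S : Type*} [CommRing S] (φ : R →+* S) (w : Perm (Fin n))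
    (f : MvPolynomial (Fin n) R) :
    MvPolynomial.map φ (ddPerm R w f) = ddPerm S w (MvPolynomial.map φ f) := by
  rw [ddPerm, ddPerm]
  induction Classical.choose (exists_reducedWord n w) with
  | nil => rfl
  | cons i a ih => rw [ddWord_cons, ddWord_cons, map_dd, ih]

theorem isHomogeneous_ddWord {d : ℕ} {f : MvPolynomial (Fin n) R} (hf : f.IsHomogeneous d)
    (a : List (Fin (n - 1))) :
    (∀ e, a.length + e = d → (ddWord R a f).IsHomogeneous e) ∧
      (d < a.length → ddWord R a f = 0) := by
  induction a with
  | nil =>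
    refine ⟨fun e he => ?_, fun h => absurd h (by simp)⟩
    rw [List.length_nil, zero_add] at he
    rw [he]; exact hf
  | cons i a ih =>
    refine ⟨fun e he => ?_, fun h => ?_⟩
    · rw [List.length_cons] at he
      exact isHomogeneous_dd (ih.1 (e + 1) (by omega))
    · rw [List.length_cons] at h
      rw [ddWord_cons]
      rcases Nat.lt_or_ge d a.length with h1 | h1
      · rw [ih.2 h1, map_zero]
      · exact dd_eq_zero_of_isHomogeneous_zero (ih.1 0 (by omega))

theorem isHomogeneous_ddPerm {d e : ℕ} {f : MvPolynomial (Fin n) R} (hf : f.IsHomogeneous d)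
    {w : Perm (Fin n)} (h : plen w + e = d) : (ddPerm R w f).IsHomogeneous e := by
  obtain ⟨a, rfl, ha⟩ := exists_word_length_eq w
  rw [← ddWord_eq_ddPerm ha]
  exact (isHomogeneous_ddWord hf a).1 e (by omega)

theorem ddPerm_eq_zero_of_isHomogeneous {d : ℕ} {f : MvPolynomial (Fin n) R}
    (hf : f.IsHomogeneous d) {w : Perm (Fin n)} (h : d < plen w) : ddPerm R w f = 0 := by
  obtain ⟨a, rfl, ha⟩ := exists_word_length_eq w
  rw [← ddWord_eq_ddPerm ha]
  exact (isHomogeneous_ddWord hf a).2 (by omega)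

end DividedDifference

theorem divDiff_eq_dd {n : ℕ} (i : Fin (n - 1)) (f : XYRing n) :
    divDiff n i f = dd (XRing n) i f := rfl

theorem divDiffPerm_eq_ddPerm {n : ℕ} (w : Perm (Fin n)) (f : XYRing n) :
    divDiffPerm n w f = ddPerm (XRing n) w f := by
  rw [divDiffPerm, ddPerm]
  induction Classical.choose (exists_reducedWord n w) with
  | nil => rfl
  | cons i a ih => rw [List.foldr_cons, ih, divDiff_eq_dd, ddWord_cons]

/-! ### Schubert polynomials over a general base ring -/

section Schubert

variable {n : ℕ} {R : Type*} [CommRing R]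

/-- Evaluation at zero. -/
abbrev evalZero (R : Type*) [CommRing R] (n : ℕ) : MvPolynomial (Fin n) R →+* R :=
  MvPolynomial.eval fun _ => 0

theorem evalZero_eq_zero_of_isHomogeneous {d : ℕ} {f : MvPolynomial (Fin n) R}
    (hf : f.IsHomogeneous d) (hd : d ≠ 0) : evalZero R n f = 0 := by
  have h : evalZero R n f = MvPolynomial.constantCoeff f := by
    have : evalZero R n = MvPolynomial.constantCoeff :=
      MvPolynomial.ringHom_ext (by simp) (by simp)
    rw [this]
  rw [h, MvPolynomial.constantCoeff_eq]
  exact hf.coeff_eq_zero (by simpa using hd.symm)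

/-- The monomial `∏ y_i ^ e_i`. -/
def mono (R : Type*) [CommRing R] {n : ℕ} (e : Fin n → ℕ) : MvPolynomial (Fin n) R :=
  ∏ i, MvPolynomial.X i ^ e i

theorem isHomogeneous_mono (e : Fin n → ℕ) : (mono R e).IsHomogeneous (∑ i, e i) :=
  MvPolynomial.IsHomogeneous.prod _ _ _ fun i _ => by
    simpa using (MvPolynomial.isHomogeneous_X R i).pow (e i)

theorem refl_mono {i : Fin (n - 1)} {e : Fin n → ℕ} (h : e (lo i) = e (hi i)) :
    refl R i (mono R e) = mono R e := by
  rw [mono, map_prod]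
  simp only [map_pow, MvPolynomial.rename_X]
  refine Fintype.prod_equiv (simpleTransp n i) _ _ fun p => ?_
  congr 1
  by_cases h1 : p = lo i
  · subst h1; rw [simpleTransp_lo, h]
  · by_cases h2 : p = hi i
    · subst h2; rw [simpleTransp_hi, h]
    · rw [simpleTransp_of_ne h1 h2]

theorem dd_X_lo (i : Fin (n - 1)) : dd R i (MvPolynomial.X (lo i)) = 1 := by
  apply dd_eq_of_root_mul
  rw [MvPolynomial.rename_X, simpleTransp_lo, root, mul_one]

theorem dd_mono {i : Fin (n - 1)} {e e' : Fin n → ℕ} (h : e' (lo i) = e' (hi i))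
    (hlo : e (lo i) = e' (lo i) + 1) (hne : ∀ p, p ≠ lo i → e p = e' p) :
    dd R i (mono R e) = mono R e' := by
  have hm : mono R e = mono R e' * MvPolynomial.X (lo i) := by
    rw [mono, mono, ← Finset.mul_prod_erase _ _ (Finset.mem_univ (lo i)),
      ← Finset.mul_prod_erase _ _ (Finset.mem_univ (lo i)), hlo, pow_succ,
      Finset.prod_congr rfl fun p hp => by rw [hne p (Finset.ne_of_mem_erase hp)]]
    ring
  rw [hm, dd_mul_of_refl_eq (refl_mono h), dd_X_lo, mul_one]

/-- The staircase monomial `y₁^{n-1} y₂^{n-2} ⋯ y_{n-1}`. -/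
def stair (R : Type*) [CommRing R] (n : ℕ) : MvPolynomial (Fin n) R :=
  mono R fun i => n - 1 - (i : ℕ)

theorem isHomogeneous_stair : (stair R n).IsHomogeneous (plen (longest n)) := by
  rw [plen_longest]
  exact isHomogeneous_mono _

/-- One row of the staircase is removed from left to right: when `∂_j` is applied, the exponents of
the neighbours `y_j, y_{j+1}` differ by exactly one, so `∂_j` lowers the first by one. -/
theorem exists_ddWord_stair_row {r : ℕ} (a : List (Fin (n - 1)))
    (ha : ddWord R a (stair R n) = mono R fun i => n - 1 - r - (i : ℕ)) (j : ℕ)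
    (hj : j + r ≤ n - 1) :
    ∃ b, ddWord R b (stair R n) =
      mono R fun i => if (i : ℕ) < j then n - 2 - r - (i : ℕ) else n - 1 - r - (i : ℕ) := by
  induction j with
  | zero => exact ⟨a, by simpa using ha⟩
  | succ j ih =>
    obtain ⟨b, hb⟩ := ih (by omega)
    refine ⟨⟨j, by omega⟩ :: b, ?_⟩
    rw [ddWord_cons, hb]
    apply dd_mono
    · change (if j < j + 1 then n - 2 - r - j else n - 1 - r - j) =
        if j + 1 < j + 1 then n - 2 - r - (j + 1) else n - 1 - r - (j + 1)
      rw [if_pos (by omega), if_neg (by omega)]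
      omega
    · change (if j < j then n - 2 - r - j else n - 1 - r - j) =
        (if j < j + 1 then n - 2 - r - j else n - 1 - r - j) + 1
      rw [if_neg (by omega), if_pos (by omega)]
      omega
    · intro p hp
      have hp' : (p : ℕ) ≠ j := fun h => hp (Fin.ext h)
      by_cases h : (p : ℕ) < j
      · rw [if_pos h, if_pos (by omega)]
      · rw [if_neg h, if_neg (by omega)]

theorem exists_ddWord_stair (r : ℕ) (hr : r ≤ n - 1) :
    ∃ a, ddWord R a (stair R n) = mono R fun i => n - 1 - r - (i : ℕ) := by
  induction r with
  | zero => exact ⟨[], rfl⟩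
  | succ r ih =>
    obtain ⟨a, ha⟩ := ih (by omega)
    obtain ⟨b, hb⟩ := exists_ddWord_stair_row a ha (n - 1 - r) (by omega)
    refine ⟨b, hb.trans ?_⟩
    congr 1
    funext i
    split_ifs <;> omega

/-- Some word sends the staircase monomial to 1. No bookkeeping of its product is needed:
homogeneity forces its length to be that of `w₀`, and a nonzero result forces it to be reduced, so
its product can only be `w₀`. -/
theorem ddPerm_longest_stair : ddPerm R (longest n) (stair R n) = 1 := by
  nontriviality MvPolynomial (Fin n) R
  obtain ⟨a, ha⟩ := exists_ddWord_stair (R := R) (n := n) (n - 1) le_rfl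
  have h1 : ddWord R a (stair R n) = 1 := by
    rw [ha, mono]
    exact Finset.prod_eq_one fun i _ => by simp
  have hh := isHomogeneous_ddWord (R := R) isHomogeneous_stair a
  have hlen : a.length = plen (longest n) := by
    rcases lt_trichotomy a.length (plen (longest n)) with h | h | h
    · obtain ⟨e, he⟩ := Nat.exists_eq_add_of_lt h
      have := hh.1 (e + 1) (by omega)
      rw [h1] at this
      exact absurd (this.inj_right (MvPolynomial.isHomogeneous_one _ _) one_ne_zero) (by omega)
    · exact h
    · exact absurd (h1.symm.trans (hh.2 h)) one_ne_zero
  have hred : a.length = plen (wordProd n a) := by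
    by_contra hcon
    exact one_ne_zero (h1.symm.trans (ddWord_eq_zero hcon _))
  have hw : wordProd n a = longest n := eq_longest_of_plen (by rw [← hred, hlen])
  rw [← hw, ← ddWord_eq_ddPerm hred, h1]

/-- The Schubert polynomial `𝔖_v`. -/
def schub (R : Type*) [CommRing R] {n : ℕ} (v : Perm (Fin n)) : MvPolynomial (Fin n) R :=
  ddPerm R (v⁻¹ * longest n) (stair R n)

theorem plen_inv_mul_longest (v : Perm (Fin n)) :
    plen (v⁻¹ * longest n) + plen v = plen (longest n) := by
  have := plen_mul_longest v⁻¹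
  rwa [plen_inv] at this

theorem isHomogeneous_schub (v : Perm (Fin n)) : (schub R v).IsHomogeneous (plen v) :=
  isHomogeneous_ddPerm isHomogeneous_stair (plen_inv_mul_longest v)

theorem schub_longest : schub R (longest n) = stair R n := by
  rw [schub, longest_inv, longest_mul_self, ddPerm_one]

/-- The composite of the two operators survives only if the lengths add. With `plen v ≤ plen u` the
product then has at least the length of `w₀`, so it is `w₀`, which means `u = v`. -/
theorem ddPerm_schub {u v : Perm (Fin n)} (h : plen v ≤ plen u) :
    ddPerm R u (schub R v) = if u = v then 1 else 0 := by
  have hv := plen_inv_mul_longest v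
  rw [schub]
  split_ifs with huv
  · subst huv
    rw [ddPerm_ddPerm_of_add_eq, mul_inv_cancel_left, ddPerm_longest_stair]
    rw [mul_inv_cancel_left]; omega
  · refine ddPerm_ddPerm_of_add_ne (fun hadd => huv ?_) _
    have h1 := plen_le_longest (u * (v⁻¹ * longest n))
    have h2 := eq_longest_of_plen (w := u * (v⁻¹ * longest n)) (by omega)
    rw [← mul_assoc, mul_eq_right] at h2
    exact mul_inv_eq_one.1 h2

theorem evalZero_ddPerm_schub (u v : Perm (Fin n)) :
    evalZero R n (ddPerm R u (schub R v)) = if u = v then 1 else 0 := by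
  rcases Nat.lt_or_ge (plen u) (plen v) with h | h
  · rw [if_neg (by rintro rfl; omega)]
    obtain ⟨e, he⟩ := Nat.exists_eq_add_of_lt h
    exact evalZero_eq_zero_of_isHomogeneous
      (isHomogeneous_ddPerm (isHomogeneous_schub v) (w := u) (e := e + 1) (by omega)) (by omega)
  · rw [ddPerm_schub h]
    split_ifs <;> simp

/-- The induction is on a bound `k` such that `∂_u f = 0` for all `u` of length at least `k`. -/
theorem exists_symmetric_expansion (f : MvPolynomial (Fin n) R) :
    ∃ s : Perm (Fin n) → MvPolynomial (Fin n) R,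
      (∀ v, (s v).IsSymmetric) ∧ f = ∑ v, s v * schub R v := by
  suffices H : ∀ (k : ℕ) (f : MvPolynomial (Fin n) R), (∀ u, k ≤ plen u → ddPerm R u f = 0) →
      ∃ s : Perm (Fin n) → MvPolynomial (Fin n) R,
        (∀ v, (s v).IsSymmetric) ∧ f = ∑ v, s v * schub R v by
    refine H (plen (longest n) + 1) f fun u hu => ?_
    have := plen_le_longest u
    omega
  intro k
  induction k with
  | zero =>
    intro f hf
    refine ⟨0, fun v => MvPolynomial.IsSymmetric.zero, ?_⟩
    have := hf 1 (Nat.zero_le _)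
    rw [ddPerm_one] at this
    simp [this]
  | succ k ih =>
    intro f hf
    -- Applying any further `∂_i` gives either a longer permutation, which kills `f` by assumption,
    -- or zero; so these top derivatives can serve as symmetric coefficients.
    have hsym : ∀ u, plen u = k → (ddPerm R u f).IsSymmetric := by
      intro u hu
      refine IsSymmetric.of_dd fun i => ?_
      rcases lt_or_gt_lo_hi u⁻¹ i with h | h
      · rw [dd_ddPerm_of_lt h]
        exact hf _ (by rw [plen_simpleTransp_mul_of_lt h]; omega)
      · exact dd_ddPerm_of_gt h f
    let c : Perm (Fin n) → MvPolynomial (Fin n) R := fun u =>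
      if plen u = k then ddPerm R u f else 0
    have hc : ∀ u, (c u).IsSymmetric := by
      intro u
      by_cases h : plen u = k
      · simp only [c, if_pos h]; exact hsym u h
      · simp only [c, if_neg h]; exact MvPolynomial.IsSymmetric.zero
    obtain ⟨s, hs, hf'⟩ := ih (f - ∑ v, c v * schub R v) (by
      intro u hu
      rw [map_sub, map_sum]
      have hterm : ∀ v, ddPerm R u (c v * schub R v) = if u = v then c u else 0 := by
        intro v
        rw [ddPerm_mul_of_isSymmetric (hc v)]
        by_cases h : plen v = k
        · rw [ddPerm_schub (by omega)]
          split_ifs with huv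
          · rw [huv, mul_one]
          · rw [mul_zero]
        · have : c v = 0 := if_neg h
          rw [this, zero_mul]
          split_ifs with huv
          · rw [huv, this]
          · rfl
      rw [Finset.sum_congr rfl fun v _ => hterm v, Finset.sum_ite_eq, if_pos (Finset.mem_univ _)]
      by_cases h : plen u = k
      · simp only [c, if_pos h, sub_self]
      · simp only [c, if_neg h, sub_zero]
        exact hf u (by omega))
    refine ⟨s + c, fun v => (hs v).add (hc v), ?_⟩
    simp only [Pi.add_apply, add_mul, Finset.sum_add_distrib]
    rw [← hf', sub_add_cancel]

/-- Triangularity: for `u` of maximal length among the nonzero coefficients, `∂_u` isolates `s u`.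
-/
theorem symmetric_expansion_unique {s : Perm (Fin n) → MvPolynomial (Fin n) R}
    (hs : ∀ v, (s v).IsSymmetric) (h : ∑ v, s v * schub R v = 0) : s = 0 := by
  by_contra hne
  obtain ⟨v₀, hv₀⟩ := Function.ne_iff.1 hne
  classical
  obtain ⟨u, hu, hmax⟩ := Finset.exists_max_image (Finset.univ.filter fun v => s v ≠ 0) plen
    ⟨v₀, by simpa using hv₀⟩
  have hu' : s u ≠ 0 := (Finset.mem_filter.1 hu).2
  apply hu'
  have h1 := congrArg (ddPerm R u) h
  rw [map_sum, map_zero, Finset.sum_eq_single u] at h1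
  · rwa [ddPerm_mul_of_isSymmetric (hs u), ddPerm_schub le_rfl, if_pos rfl, mul_one] at h1
  · intro v _ hv
    rw [ddPerm_mul_of_isSymmetric (hs v)]
    by_cases h0 : s v = 0
    · rw [h0, zero_mul]
    · rw [ddPerm_schub (hmax v (by simpa using h0)), if_neg hv.symm, mul_zero]
  · exact fun h => absurd (Finset.mem_univ _) h

/-! ### The classical pairing -/

theorem plen_simpleTransp (i : Fin (n - 1)) : plen (simpleTransp n i) = 1 := by
  have := plen_simpleTransp_mul_of_lt (w := (1 : Perm (Fin n))) (i := i) (by simpa using lo_lt_hi i)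
  rwa [mul_one, plen_one] at this

theorem ddPerm_simpleTransp (i : Fin (n - 1)) (f : MvPolynomial (Fin n) R) :
    ddPerm R (simpleTransp n i) f = dd R i f := by
  have hw : wordProd n [i] = simpleTransp n i := by simp [wordProd]
  rw [← hw, ← ddWord_eq_ddPerm (by rw [hw, plen_simpleTransp]; rfl), ddWord_cons, ddWord_nil]

theorem ddPerm_longest_eq (i : Fin (n - 1)) (f : MvPolynomial (Fin n) R) :
    ddPerm R (longest n) f = ddPerm R (longest n * simpleTransp n i) (dd R i f) := by
  have hc : longest n * simpleTransp n i * simpleTransp n i = longest n := by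
    rw [mul_assoc, simpleTransp_mul_self, mul_one]
  rw [← ddPerm_simpleTransp, ddPerm_ddPerm_of_add_eq, hc]
  rw [hc]
  exact plen_longest_mul _

/-- `∂_{w₀}` factors through `∂_i`, and `∂_i` maps both products to `∂_i f · ∂_i g`. So `∂_i` is
self-adjoint for the pairing `∂_{w₀}(f g)`. -/
theorem ddPerm_longest_dd_mul (i : Fin (n - 1)) (f g : MvPolynomial (Fin n) R) :
    ddPerm R (longest n) (dd R i f * g) = ddPerm R (longest n) (f * dd R i g) := by
  rw [ddPerm_longest_eq i, dd_dd_mul, ← ddPerm_longest_eq]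

theorem ddPerm_longest_ddPerm_mul (w : Perm (Fin n)) (f g : MvPolynomial (Fin n) R) :
    ddPerm R (longest n) (ddPerm R w f * g) = ddPerm R (longest n) (f * ddPerm R w⁻¹ g) := by
  obtain ⟨a, rfl, ha⟩ := exists_word_length_eq w
  have hr : a.reverse.length = plen (wordProd n a.reverse) := by
    rw [wordProd_reverse, plen_inv, List.length_reverse, ha]
  rw [← ddWord_eq_ddPerm ha, ← wordProd_reverse, ← ddWord_eq_ddPerm hr]
  clear ha hr
  induction a generalizing g with
  | nil => rfl
  | cons i a ih =>
    rw [ddWord_cons, ddPerm_longest_dd_mul, ih, List.reverse_cons, ddWord_append, ddWord_cons,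
      ddWord_nil]

/-- The operator lowers degree by exactly the degree of the staircase, so a part of `h` of positive
degree keeps positive degree and vanishes at zero. -/
theorem evalZero_ddPerm_longest_stair_mul (h : MvPolynomial (Fin n) R) :
    evalZero R n (ddPerm R (longest n) (stair R n * h)) = evalZero R n h := by
  induction h using MvPolynomial.induction_on' with
  | monomial m c =>
    by_cases hm : m = 0
    · subst hm
      have : stair R n * MvPolynomial.monomial 0 c = c • stair R n := by
        rw [mul_comm, MvPolynomial.smul_eq_C_mul]; rfl
      rw [this, map_smul, ddPerm_longest_stair, MvPolynomial.smul_eq_C_mul, mul_one]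
      rfl
    · have hd : m.degree ≠ 0 := fun h0 => hm ((Finsupp.degree_eq_zero_iff m).1 h0)
      have hmon := MvPolynomial.isHomogeneous_monomial (σ := Fin n) (R := R) c (rfl : m.degree = _)
      rw [evalZero_eq_zero_of_isHomogeneous hmon hd]
      exact evalZero_eq_zero_of_isHomogeneous
        (isHomogeneous_ddPerm (isHomogeneous_stair.mul hmon) rfl) hd
  | add p q hp hq => rw [mul_add, map_add, map_add, map_add, hp, hq]

theorem evalZero_ddPerm_longest_schub_mul (u : Perm (Fin n)) (g : MvPolynomial (Fin n) R) :
    evalZero R n (ddPerm R (longest n) (schub R u * g)) =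
      evalZero R n (ddPerm R (longest n * u) g) := by
  rw [schub, ddPerm_longest_ddPerm_mul, evalZero_ddPerm_longest_stair_mul, mul_inv_rev, inv_inv,
    longest_inv]

/-- A coproduct formula for `∂_{w₀}` at the origin. Expanding `f` over symmetric coefficients, `∂_u`
at zero reads off the coefficient of `𝔖_u`, while pairing `𝔖_u` with `g` gives `∂_{w₀u} g` at zero.
-/
theorem evalZero_ddPerm_longest_mul (f g : MvPolynomial (Fin n) R) :
    evalZero R n (ddPerm R (longest n) (f * g)) =
      ∑ w, evalZero R n (ddPerm R (w * longest n) f) *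
        evalZero R n (ddPerm R (longest n * w * longest n) g) := by
  obtain ⟨s, hs, rfl⟩ := exists_symmetric_expansion f
  have hl : ∀ u, evalZero R n (ddPerm R u (∑ v, s v * schub R v)) = evalZero R n (s u) := by
    intro u
    rw [map_sum, map_sum, Finset.sum_eq_single u]
    · rw [ddPerm_mul_of_isSymmetric (hs u), map_mul, evalZero_ddPerm_schub, if_pos rfl, mul_one]
    · intro v _ hv
      rw [ddPerm_mul_of_isSymmetric (hs v), map_mul, evalZero_ddPerm_schub, if_neg hv.symm,
        mul_zero]
    · exact fun h => absurd (Finset.mem_univ _) h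
  simp only [hl]
  rw [Finset.sum_mul, map_sum, map_sum]
  symm
  refine Fintype.sum_equiv (Equiv.mulRight (longest n)) _ _ fun w => ?_
  rw [Equiv.coe_mulRight, mul_assoc (s _), ddPerm_mul_of_isSymmetric (hs _), map_mul,
    evalZero_ddPerm_longest_schub_mul, mul_assoc]

/-- `∂_{w₀}` is anti-invariant under each simple reflection, so its kernel is stable under all
permutations of the variables. -/
theorem ddPerm_longest_rename_eq_zero {f : MvPolynomial (Fin n) R}
    (hf : ddPerm R (longest n) f = 0) (w : Perm (Fin n)) :
    ddPerm R (longest n) (MvPolynomial.rename w f) = 0 := by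
  obtain ⟨a, rfl⟩ := exists_word n w
  induction a with
  | nil =>
    have : (⇑(wordProd n []) : Fin n → Fin n) = id := by simp [wordProd]
    rw [this, MvPolynomial.rename_id_apply, hf]
  | cons i a ih =>
    have e : (⇑(wordProd n (i :: a)) : Fin n → Fin n) = simpleTransp n i ∘ wordProd n a := by
      rw [wordProd_cons]; rfl
    rw [e, ← MvPolynomial.rename_rename, ddPerm_longest_eq i, dd_refl, map_neg,
      ← ddPerm_longest_eq, ih, neg_zero]

/-- Anti-invariance alone would only give `2 ∂_{w₀} f = 0`. Conjugating the swap to a simple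
transposition makes `∂_i` vanish outright, over any base ring. -/
theorem ddPerm_longest_eq_zero_of_swap {f : MvPolynomial (Fin n) R} {j k : Fin n} (hjk : j ≠ k)
    (hf : MvPolynomial.rename (Equiv.swap j k) f = f) : ddPerm R (longest n) f = 0 := by
  have hn : 0 < n - 1 := by
    have h1 := j.2
    have h2 := k.2
    have h3 : (j : ℕ) ≠ k := fun h => hjk (Fin.ext h)
    omega
  -- Any simple transposition would do; it only has to exist.
  obtain ⟨i, -⟩ : ∃ i : Fin (n - 1), i = ⟨0, hn⟩ := ⟨_, rfl⟩
  obtain ⟨c, hc⟩ := isConj_iff.1 (Equiv.Perm.isConj_swap (lo_ne_hi i) hjk)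
  have hg : refl R i (MvPolynomial.rename (c⁻¹ : Perm (Fin n)) f) =
      MvPolynomial.rename (c⁻¹ : Perm (Fin n)) f := by
    conv_rhs => rw [← hf]
    rw [MvPolynomial.rename_rename, MvPolynomial.rename_rename, ← hc]
    congr 2
    funext p
    simp [simpleTransp, lo, hi]
  have h0 : ddPerm R (longest n) (MvPolynomial.rename (c⁻¹ : Perm (Fin n)) f) = 0 := by
    rw [ddPerm_longest_eq i, dd_eq_zero_iff.2 hg, map_zero]
  have h1 := ddPerm_longest_rename_eq_zero h0 c
  rw [MvPolynomial.rename_rename] at h1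
  have e : (c ∘ (c⁻¹ : Perm (Fin n)) : Fin n → Fin n) = id := by funext p; simp
  rwa [e, MvPolynomial.rename_id_apply] at h1

theorem isHomogeneous_esymm (k : ℕ) : (MvPolynomial.esymm (Fin n) R k).IsHomogeneous k := by
  rw [MvPolynomial.esymm]
  refine MvPolynomial.IsHomogeneous.sum _ _ _ fun t ht => ?_
  have h := MvPolynomial.IsHomogeneous.prod t (fun i => (MvPolynomial.X i : MvPolynomial (Fin n) R))
    (fun _ => 1) fun i _ => MvPolynomial.isHomogeneous_X R i
  rwa [Finset.sum_const, (Finset.mem_powersetCard.1 ht).2, smul_eq_mul, mul_one] at h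

/-- Since `-y_j` is a root of `∏ (t + y_i)`, the power `y_j^n` lies in the ideal of elementary
symmetric polynomials of positive degree. These factors pass through `∂_w` and vanish at zero. -/
theorem evalZero_ddPerm_X_pow_mul (w : Perm (Fin n)) (j : Fin n) (h : MvPolynomial (Fin n) R) :
    evalZero R n (ddPerm R w (MvPolynomial.X j ^ n * h)) = 0 := by
  have key := congrArg (Polynomial.eval (-MvPolynomial.X j))
    (MvPolynomial.prod_C_add_X_eq_sum_esymm R (Fin n))
  rw [Polynomial.eval_prod, Finset.prod_eq_zero (Finset.mem_univ j) (by simp),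
    Polynomial.eval_finsetSum, Finset.sum_range_succ'] at key
  simp only [Polynomial.eval_mul, Polynomial.eval_C, Polynomial.eval_pow, Polynomial.eval_X,
    MvPolynomial.esymm_zero, Fintype.card_fin, one_mul, Nat.sub_zero] at key
  have hX : (MvPolynomial.X j : MvPolynomial (Fin n) R) ^ n * h =
      ∑ k ∈ Finset.range n, MvPolynomial.esymm (Fin n) R (k + 1) *
        (-(-1) ^ n * ((-MvPolynomial.X j) ^ (n - (k + 1)) * h)) := by
    have h1 : (MvPolynomial.X j : MvPolynomial (Fin n) R) ^ n =
        (-1) ^ n * (-MvPolynomial.X j) ^ n := by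
      rw [← mul_pow]; ring
    rw [h1, eq_neg_of_add_eq_zero_right key.symm, mul_neg, neg_mul, Finset.mul_sum, Finset.sum_mul,
      ← Finset.sum_neg_distrib]
    exact Finset.sum_congr rfl fun k _ => by ring
  rw [hX, map_sum, map_sum]
  refine Finset.sum_eq_zero fun k _ => ?_
  rw [ddPerm_mul_of_isSymmetric (MvPolynomial.esymm_isSymmetric _ _ _), map_mul,
    evalZero_eq_zero_of_isHomogeneous (isHomogeneous_esymm _) (by omega), zero_mul]

/-- The functional `f ↦ ∂_{w₀} (f(y_j) ∏_{i ≠ j} P_i(y_i)) |_{y = 0}`. -/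
def slot (P : Fin n → Polynomial R) (j : Fin n) : Polynomial R →ₗ[R] R where
  toFun f := evalZero R n (ddPerm R (longest n) (Polynomial.aeval (MvPolynomial.X j) f *
    ∏ i ∈ Finset.univ.erase j, Polynomial.aeval (MvPolynomial.X i) (P i)))
  map_add' f g := by simp only [map_add, add_mul]
  map_smul' c f := by
    simp only [map_smul, smul_mul_assoc, RingHom.id_apply, MvPolynomial.smul_eval, smul_eq_mul]

theorem slot_self (P : Fin n → Polynomial R) (j : Fin n) :
    slot P j (P j) = evalZero R n (ddPerm R (longest n)
      (∏ i, Polynomial.aeval (MvPolynomial.X i) (P i))) := by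
  rw [← Finset.mul_prod_erase _ _ (Finset.mem_univ j)]
  rfl

theorem slot_X_pow_mul (P : Fin n → Polynomial R) (j : Fin n) (f : Polynomial R) :
    slot P j (Polynomial.X ^ n * f) = 0 := by
  change evalZero R n _ = 0
  rw [map_mul (Polynomial.aeval _), map_pow, Polynomial.aeval_X, mul_assoc, evalZero_ddPerm_X_pow_mul]

/-- With `P k` placed in slot `j`, the variables `y_j` and `y_k` carry the same polynomial, so the
product is fixed by their swap. -/
theorem slot_of_ne (P : Fin n → Polynomial R) {j k : Fin n} (hjk : j ≠ k) :
    slot P j (P k) = 0 := by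
  change evalZero R n _ = 0
  rw [ddPerm_longest_eq_zero_of_swap hjk, map_zero]
  rw [← Finset.mul_prod_erase _ _ (Finset.mem_erase.2 ⟨hjk.symm, Finset.mem_univ k⟩), map_mul,
    map_mul, map_prod]
  have hr : ∀ (i : Fin n) (p : Polynomial R),
      MvPolynomial.rename (Equiv.swap j k) (Polynomial.aeval (MvPolynomial.X i) p) =
        Polynomial.aeval (MvPolynomial.X (Equiv.swap j k i) : MvPolynomial (Fin n) R) p := by
    intro i p
    rw [← Polynomial.aeval_algHom_apply, MvPolynomial.rename_X]
  rw [hr, hr, Equiv.swap_apply_left, Equiv.swap_apply_right, mul_left_comm]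
  congr 2
  refine Finset.prod_congr rfl fun i hi => ?_
  rw [hr, Equiv.swap_apply_of_ne_of_ne]
  · exact Finset.ne_of_mem_erase (Finset.mem_of_mem_erase hi)
  · exact Finset.ne_of_mem_erase hi

end Schubert

/-! ### Deformations of the ring of coinvariants -/

/-! ### Filtration by degree and leading forms. -/

section LowDegree

variable {σ R : Type*} [CommRing R]

/-- Polynomials of degree less than `d`. -/
def lowDeg (σ R : Type*) [CommRing R] (d : ℕ) : Submodule R (MvPolynomial σ R) where
  carrier := {f | ∀ m : σ →₀ ℕ, d ≤ m.degree → MvPolynomial.coeff m f = 0}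
  add_mem' hf hg m hm := by rw [MvPolynomial.coeff_add, hf m hm, hg m hm, add_zero]
  zero_mem' m _ := MvPolynomial.coeff_zero m
  smul_mem' c f hf m hm := by rw [MvPolynomial.coeff_smul, hf m hm, smul_zero]

theorem lowDeg_mono {d e : ℕ} (h : d ≤ e) : lowDeg σ R d ≤ lowDeg σ R e :=
  fun _ hf m hm => hf m (h.trans hm)

theorem eq_zero_of_mem_lowDeg_zero {f : MvPolynomial σ R} (hf : f ∈ lowDeg σ R 0) : f = 0 :=
  MvPolynomial.ext _ _ fun m => by rw [hf m (Nat.zero_le _), MvPolynomial.coeff_zero]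

theorem mem_lowDeg_of_isHomogeneous {d e : ℕ} {f : MvPolynomial σ R} (hf : f.IsHomogeneous d)
    (h : d < e) : f ∈ lowDeg σ R e :=
  fun _ hm => hf.coeff_eq_zero (by omega)

/-- As `lowDeg` is a strict bound, `a + 1` on the first factor means degree at most `a`. -/
theorem mul_mem_lowDeg {a b : ℕ} {f g : MvPolynomial σ R} (hf : f ∈ lowDeg σ R (a + 1))
    (hg : g ∈ lowDeg σ R b) : f * g ∈ lowDeg σ R (a + b) := by
  classical
  intro m hm
  rw [MvPolynomial.coeff_mul]
  refine Finset.sum_eq_zero fun x hx => ?_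
  have hdeg : x.1.degree + x.2.degree = m.degree := by
    rw [← map_add, Finset.HasAntidiagonal.mem_antidiagonal.1 hx]
  rcases Nat.lt_or_ge a x.1.degree with h | h
  · rw [hf _ h, zero_mul]
  · rw [hg _ (by omega), mul_zero]

theorem exists_mem_lowDeg (f : MvPolynomial σ R) : ∃ d, f ∈ lowDeg σ R d := by
  refine ⟨f.totalDegree + 1, fun m hm => ?_⟩
  by_contra h
  have := MvPolynomial.le_totalDegree (MvPolynomial.mem_support_iff.2 h)
  rw [Finsupp.degree_apply] at hm
  simp only [Finsupp.sum] at this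
  omega

/-- `g` is the component of degree `a` of `f`, and `f` has degree at most `a`. -/
def IsLead (a : ℕ) (f g : MvPolynomial σ R) : Prop :=
  g.IsHomogeneous a ∧ f - g ∈ lowDeg σ R a

theorem IsLead.of_isHomogeneous {a : ℕ} {g : MvPolynomial σ R} (hg : g.IsHomogeneous a) :
    IsLead a g g := ⟨hg, by rw [sub_self]; exact zero_mem _⟩

theorem IsLead.mem {a : ℕ} {f g : MvPolynomial σ R} (h : IsLead a f g) :
    f ∈ lowDeg σ R (a + 1) := by
  rw [← sub_add_cancel f g]
  exact add_mem (lowDeg_mono (Nat.le_succ a) h.2)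
    (mem_lowDeg_of_isHomogeneous h.1 (Nat.lt_succ_self a))

theorem IsLead.mul {a b : ℕ} {f g f' g' : MvPolynomial σ R} (h : IsLead a f g)
    (h' : IsLead b f' g') : IsLead (a + b) (f * f') (g * g') := by
  refine ⟨h.1.mul h'.1, ?_⟩
  have e : f * f' - g * g' = f * (f' - g') + g' * (f - g) := by ring
  rw [e]
  refine add_mem (mul_mem_lowDeg h.mem h'.2) ?_
  rw [add_comm a b]
  exact mul_mem_lowDeg (mem_lowDeg_of_isHomogeneous h'.1 (Nat.lt_succ_self b)) h.2

theorem IsLead.one : IsLead 0 (1 : MvPolynomial σ R) 1 :=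
  .of_isHomogeneous (MvPolynomial.isHomogeneous_one _ _)

theorem IsLead.pow {a : ℕ} {f g : MvPolynomial σ R} (h : IsLead a f g) (k : ℕ) :
    IsLead (k * a) (f ^ k) (g ^ k) := by
  induction k with
  | zero => simpa using IsLead.one
  | succ k ih => rw [pow_succ, pow_succ, Nat.succ_mul]; exact ih.mul h

theorem IsLead.prod {ι : Type*} (s : Finset ι) {a : ι → ℕ} {f g : ι → MvPolynomial σ R}
    (h : ∀ i ∈ s, IsLead (a i) (f i) (g i)) :
    IsLead (∑ i ∈ s, a i) (∏ i ∈ s, f i) (∏ i ∈ s, g i) := by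
  classical
  induction s using Finset.induction_on with
  | empty => simpa using IsLead.one
  | insert i s hi ih =>
    rw [Finset.sum_insert hi, Finset.prod_insert hi, Finset.prod_insert hi]
    exact (h i (Finset.mem_insert_self _ _)).mul
      (ih fun k hk => h k (Finset.mem_insert_of_mem hk))

/-- A spanning family of homogeneous polynomials spans in each degree. -/
theorem lowDeg_le_span {J : Type*} {b : J → MvPolynomial σ R} {d : J → ℕ}
    (hb : ∀ j, (b j).IsHomogeneous (d j)) (hspan : ⊤ ≤ Submodule.span R (Set.range b)) (e : ℕ) :
    lowDeg σ R e ≤ Submodule.span R (b '' {j | d j < e}) := by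
  classical
  intro f hf
  -- Truncation to degrees below `e`: it fixes `f`, and it keeps or kills each homogeneous
  -- generator, so any expansion of `f` truncates to one using generators of degree below `e` only.
  let τ : MvPolynomial σ R →ₗ[R] MvPolynomial σ R :=
    ∑ k ∈ Finset.range e, MvPolynomial.homogeneousComponent k
  have hτ : τ f = f := by
    ext m
    simp only [τ, LinearMap.sum_apply, MvPolynomial.coeff_sum,
      MvPolynomial.coeff_homogeneousComponent, Finset.sum_ite_eq, Finset.mem_range]
    split_ifs with h
    · rfl
    · exact (hf m (not_lt.1 h)).symm
  rw [← hτ]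
  have hmem : f ∈ Submodule.span R (Set.range b) := hspan trivial
  clear hτ hf
  induction hmem using Submodule.span_induction with
  | mem x hx =>
    obtain ⟨j, rfl⟩ := hx
    by_cases hj : d j < e
    · have : τ (b j) = b j := by
        simp only [τ, LinearMap.sum_apply]
        rw [Finset.sum_eq_single (d j)]
        · rw [MvPolynomial.homogeneousComponent_of_mem (hb j), if_pos rfl]
        · intro k _ hk
          rw [MvPolynomial.homogeneousComponent_of_mem (hb j), if_neg hk]
        · exact fun h => absurd (Finset.mem_range.2 hj) h
      rw [this]
      exact Submodule.subset_span ⟨j, hj, rfl⟩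
    · have : τ (b j) = 0 := by
        simp only [τ, LinearMap.sum_apply]
        refine Finset.sum_eq_zero fun k hk => ?_
        rw [MvPolynomial.homogeneousComponent_of_mem (hb j), if_neg]
        have := Finset.mem_range.1 hk
        omega
      rw [this]
      exact zero_mem _
  | zero => rw [map_zero]; exact zero_mem _
  | add x y _ _ hx hy => rw [map_add]; exact add_mem hx hy
  | smul c x _ hx => rw [map_smul]; exact Submodule.smul_mem _ _ hx

/-- Induction on the degree: each `b j` is `b' j` minus a correction of lower degree. -/
theorem lowDeg_le_span_of_isLead {J : Type*} {b b' : J → MvPolynomial σ R} {d : J → ℕ}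
    (hb : ∀ j, IsLead (d j) (b' j) (b j)) (hspan : ⊤ ≤ Submodule.span R (Set.range b)) (e : ℕ) :
    lowDeg σ R e ≤ Submodule.span R (b' '' {j | d j < e}) := by
  induction e with
  | zero =>
    intro f hf
    rw [eq_zero_of_mem_lowDeg_zero hf]
    exact zero_mem _
  | succ e ih =>
    refine (lowDeg_le_span (fun j => (hb j).1) hspan (e + 1)).trans (Submodule.span_le.2 ?_)
    rintro _ ⟨j, hj, rfl⟩
    rw [← sub_sub_cancel (b' j) (b j)]
    refine sub_mem (Submodule.subset_span ⟨j, hj, rfl⟩) ?_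
    have h1 : b' j - b j ∈ lowDeg σ R e := lowDeg_mono (Nat.lt_succ_iff.1 hj) (hb j).2
    exact Submodule.span_mono (Set.image_mono fun k (hk : d k < e) => Nat.lt_succ_of_lt hk) (ih h1)

/-- A family whose leading forms are a basis is a basis: the comparison map is bijective. -/
theorem bijective_of_isLead {J : Type*} (b : Module.Basis J R (MvPolynomial σ R)) {d : J → ℕ}
    (L : MvPolynomial σ R →ₗ[R] MvPolynomial σ R) (hb : ∀ j, IsLead (d j) (L (b j)) (b j)) :
    Function.Bijective L := by
  have hspan : ⊤ ≤ Submodule.span R (Set.range b) := b.span_eq.ge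
  constructor
  -- `L - id` strictly lowers degree, so an element of the kernel of `L` has its degree bound
  -- reduced repeatedly until it is zero.
  · have hN : ∀ e (f : MvPolynomial σ R), f ∈ lowDeg σ R (e + 1) → L f - f ∈ lowDeg σ R e := by
      intro e f hf
      have h1 := lowDeg_le_span (fun j => (hb j).1) hspan (e + 1) hf
      have h2 : Submodule.span R (b '' {j | d j < e + 1}) ≤
          (lowDeg σ R e).comap (L - LinearMap.id) := by
        refine Submodule.span_le.2 ?_
        rintro _ ⟨j, hj, rfl⟩
        exact lowDeg_mono (Nat.lt_succ_iff.1 hj) (hb j).2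
      exact h2 h1
    rw [← LinearMap.ker_eq_bot, eq_bot_iff]
    intro f hf
    rw [LinearMap.mem_ker] at hf
    obtain ⟨e, he⟩ := exists_mem_lowDeg f
    induction e with
    | zero => exact eq_zero_of_mem_lowDeg_zero he
    | succ e ih =>
      refine ih ?_
      have := hN e f he
      rwa [hf, zero_sub, neg_mem_iff] at this
  · intro f
    obtain ⟨e, he⟩ := exists_mem_lowDeg f
    have h1 := lowDeg_le_span_of_isLead (b' := fun j => L (b j)) hb hspan e he
    have h2 : Submodule.span R ((fun j => L (b j)) '' {j | d j < e}) ≤ LinearMap.range L :=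
      Submodule.span_le.2 (by rintro _ ⟨j, -, rfl⟩; exact ⟨b j, rfl⟩)
    exact h2 h1

end LowDegree

/-! ### Freeness over deformed elementary symmetric polynomials. -/

section Coinvariants

variable {n : ℕ} {A : Type*} [CommRing A]

/-- The map `(P_v)_v ↦ ∑_v P_v(E) 𝔖_v`. -/
def combo (E : Fin n → MvPolynomial (Fin n) A) :
    (Perm (Fin n) → MvPolynomial (Fin n) A) →ₗ[A] MvPolynomial (Fin n) A :=
  ∑ v, (LinearMap.mulRight A (schub A v)).comp
    ((MvPolynomial.aeval E).toLinearMap.comp (LinearMap.proj v))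

theorem combo_apply (E : Fin n → MvPolynomial (Fin n) A)
    (P : Perm (Fin n) → MvPolynomial (Fin n) A) :
    combo E P = ∑ v, MvPolynomial.aeval E (P v) * schub A v := by
  simp [combo]

theorem combo_single (E : Fin n → MvPolynomial (Fin n) A) (v : Perm (Fin n))
    (P : MvPolynomial (Fin n) A) :
    combo E (Pi.single v P) = MvPolynomial.aeval E P * schub A v := by
  rw [combo_apply, Finset.sum_eq_single v]
  · rw [Pi.single_eq_same]
  · intro u _ hu
    rw [Pi.single_eq_of_ne hu, map_zero, zero_mul]
  · exact fun h => absurd (Finset.mem_univ _) h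

theorem combo_mul (E : Fin n → MvPolynomial (Fin n) A) (Q : MvPolynomial (Fin n) A)
    (P : Perm (Fin n) → MvPolynomial (Fin n) A) :
    combo E (fun v => Q * P v) = MvPolynomial.aeval E Q * combo E P := by
  simp only [combo_apply, map_mul, mul_assoc, Finset.mul_sum]

/-- The fundamental theorem on symmetric polynomials, combined with existence and uniqueness of the
Schubert expansion with symmetric coefficients. -/
theorem bijective_combo_esymm :
    Function.Bijective (combo fun i : Fin n => MvPolynomial.esymm (Fin n) A (i + 1)) := by
  have hbij := MvPolynomial.esymmAlgHom_fin_bijective A n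
  have hsym : ∀ P : MvPolynomial (Fin n) A, (MvPolynomial.aeval (fun i : Fin n => MvPolynomial.esymm (Fin n) A (i + 1))
      P).IsSymmetric := by
    intro P
    rw [← MvPolynomial.esymmAlgHom_apply]
    exact (MvPolynomial.esymmAlgHom (Fin n) A n P).2
  constructor
  · rw [← LinearMap.ker_eq_bot, eq_bot_iff]
    intro P hP
    rw [LinearMap.mem_ker, combo_apply] at hP
    have h0 := symmetric_expansion_unique (fun v => hsym (P v)) hP
    have : P = 0 := by
      funext v
      apply hbij.1
      apply Subtype.ext
      rw [MvPolynomial.esymmAlgHom_apply, Pi.zero_apply, map_zero]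
      exact congrFun h0 v
    exact this
  · intro f
    obtain ⟨s, hs, rfl⟩ := exists_symmetric_expansion f
    choose P hP using fun v => hbij.2 ⟨s v, hs v⟩
    refine ⟨P, ?_⟩
    rw [combo_apply]
    refine Finset.sum_congr rfl fun v _ => ?_
    rw [← MvPolynomial.esymmAlgHom_apply, hP]

/-- The basis `e^m 𝔖_v` of the polynomial ring. -/
def esymmSchubBasis (A : Type*) [CommRing A] (n : ℕ) :
    Module.Basis (Σ _ : Perm (Fin n), Fin n →₀ ℕ) A (MvPolynomial (Fin n) A) :=
  (Pi.basis fun _ => MvPolynomial.basisMonomials (Fin n) A).map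
    (LinearEquiv.ofBijective _ bijective_combo_esymm)

theorem esymmSchubBasis_apply (j : Σ _ : Perm (Fin n), Fin n →₀ ℕ) :
    esymmSchubBasis A n j =
      MvPolynomial.aeval (fun i : Fin n => MvPolynomial.esymm (Fin n) A (i + 1))
        (MvPolynomial.monomial j.2 (1 : A)) * schub A j.1 := by
  rw [esymmSchubBasis, Module.Basis.map_apply, LinearEquiv.ofBijective_apply, Pi.basis_apply,
    MvPolynomial.coe_basisMonomials]
  exact combo_single _ _ _

variable {E : Fin n → MvPolynomial (Fin n) A}

theorem isLead_aeval_monomial_mul_schub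
    (hE : ∀ i : Fin n, IsLead (i + 1) (E i) (MvPolynomial.esymm (Fin n) A (i + 1)))
    (j : Σ _ : Perm (Fin n), Fin n →₀ ℕ) :
    IsLead ((∑ i, j.2 i * (i + 1)) + plen j.1)
      (MvPolynomial.aeval E (MvPolynomial.monomial j.2 (1 : A)) * schub A j.1)
      (esymmSchubBasis A n j) := by
  rw [esymmSchubBasis_apply]
  refine IsLead.mul ?_ (.of_isHomogeneous (isHomogeneous_schub _))
  simp only [MvPolynomial.aeval_monomial, map_one, one_mul]
  rw [Finsupp.prod_fintype _ _ (by simp), Finsupp.prod_fintype _ _ (by simp)]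
  exact IsLead.prod _ fun i _ => (hE i).pow _

/-- Composed with the inverse of the classical map, `combo E` sends `e^m 𝔖_v` to `E^m 𝔖_v`, which
has the same leading form; so it is bijective by `bijective_of_isLead`. -/
theorem bijective_combo
    (hE : ∀ i : Fin n, IsLead (i + 1) (E i) (MvPolynomial.esymm (Fin n) A (i + 1))) :
    Function.Bijective (combo E) := by
  let e := LinearEquiv.ofBijective _ (bijective_combo_esymm (n := n) (A := A))
  have hL := bijective_of_isLead (esymmSchubBasis A n)
    (d := fun j => (∑ i, j.2 i * (i + 1)) + plen j.1) ((combo E).comp e.symm.toLinearMap) (by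
      intro j
      have : e.symm (esymmSchubBasis A n j) = Pi.single j.1 (MvPolynomial.monomial j.2 (1 : A)) := by
        rw [LinearEquiv.symm_apply_eq, esymmSchubBasis_apply, LinearEquiv.ofBijective_apply,
          combo_single]
      rw [LinearMap.comp_apply, LinearEquiv.coe_coe, this, combo_single]
      exact isLead_aeval_monomial_mul_schub hE j)
  have : (combo E : (Perm (Fin n) → MvPolynomial (Fin n) A) → _) =
      ((combo E).comp e.symm.toLinearMap) ∘ e := by
    funext P; simp
  rw [this]
  exact hL.comp e.bijective

/-- The coefficients of a polynomial modulo the ideal generated by `E`. -/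
def coinvCoord
    (hE : ∀ i : Fin n, IsLead (i + 1) (E i) (MvPolynomial.esymm (Fin n) A (i + 1))) :
    MvPolynomial (Fin n) A →ₗ[A] (Perm (Fin n) → A) :=
  (LinearMap.pi fun v : Perm (Fin n) => (MvPolynomial.lcoeff A (0 : Fin n →₀ ℕ)).comp
    (LinearMap.proj (R := A) (φ := fun _ : Perm (Fin n) => MvPolynomial (Fin n) A) v)).comp
    (LinearEquiv.ofBijective _ (bijective_combo hE)).symm.toLinearMap

variable (hE : ∀ i : Fin n, IsLead (i + 1) (E i) (MvPolynomial.esymm (Fin n) A (i + 1)))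

theorem coinvCoord_combo (P : Perm (Fin n) → MvPolynomial (Fin n) A) (v : Perm (Fin n)) :
    coinvCoord hE (combo E P) v = MvPolynomial.coeff 0 (P v) := by
  have : (LinearEquiv.ofBijective _ (bijective_combo hE)).symm (combo E P) = P := by
    rw [LinearEquiv.symm_apply_eq]; rfl
  simp only [coinvCoord, LinearMap.comp_apply, LinearEquiv.coe_coe, this]
  rfl

theorem coinvCoord_schub (u v : Perm (Fin n)) :
    coinvCoord hE (schub A u) v = if v = u then 1 else 0 := by
  have : schub A u = combo E (Pi.single u 1) := by rw [combo_single, map_one, one_mul]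
  rw [this, coinvCoord_combo, Pi.single_apply]
  split_ifs <;> simp

theorem coinvCoord_surjective : Function.Surjective (coinvCoord hE) := by
  intro c
  refine ⟨combo E fun v => MvPolynomial.C (c v), ?_⟩
  funext v
  rw [coinvCoord_combo, MvPolynomial.coeff_zero_C]

/-- Modulo the ideal, `P(E)` equals its constant term. Conversely, multiplying by `E i` multiplies
every coefficient polynomial by the variable `X i`, which kills constant terms. -/
theorem coinvCoord_eq_zero_iff (f : MvPolynomial (Fin n) A) :
    coinvCoord hE f = 0 ↔ f ∈ Ideal.span (Set.range E) := by
  constructor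
  · intro hf
    obtain ⟨P, rfl⟩ := (bijective_combo hE).2 f
    rw [combo_apply]
    refine Ideal.sum_mem _ fun v _ => Ideal.mul_mem_right _ _ ?_
    have h0 : MvPolynomial.coeff 0 (P v) = 0 := by
      rw [← coinvCoord_combo hE P v, hf]; rfl
    have hcomp : (Ideal.Quotient.mk (Ideal.span (Set.range E))).comp
        (MvPolynomial.aeval E).toRingHom =
        ((Ideal.Quotient.mk (Ideal.span (Set.range E))).comp MvPolynomial.C).comp
          MvPolynomial.constantCoeff := by
      refine MvPolynomial.ringHom_ext (fun r => by simp) fun i => ?_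
      simp only [RingHom.comp_apply, AlgHom.toRingHom_eq_coe, RingHom.coe_coe,
        MvPolynomial.aeval_X, MvPolynomial.constantCoeff_X, map_zero]
      exact Ideal.Quotient.eq_zero_iff_mem.2 (Ideal.subset_span ⟨i, rfl⟩)
    have := RingHom.congr_fun hcomp (P v)
    simp only [RingHom.comp_apply, MvPolynomial.constantCoeff_eq, h0, map_zero] at this
    exact Ideal.Quotient.eq_zero_iff_mem.1 this
  · intro hf
    obtain ⟨c, rfl⟩ := Ideal.mem_span_range_iff_exists_fun.1 hf
    rw [map_sum]
    refine Finset.sum_eq_zero fun i _ => ?_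
    obtain ⟨P, hP⟩ := (bijective_combo hE).2 (c i)
    have : c i * E i = combo E fun v => MvPolynomial.X i * P v := by
      rw [combo_mul, hP, MvPolynomial.aeval_X, mul_comm]
    rw [this]
    funext v
    rw [coinvCoord_combo, ← MvPolynomial.constantCoeff_eq, map_mul, MvPolynomial.constantCoeff_X,
      zero_mul]
    rfl

/-- A polynomial of degree below the length of `w₀` is a combination of elements `E^m 𝔖_v` of degree
below that length, and none of these has `v = w₀`. -/
theorem coinvCoord_longest_of_mem_lowDeg {f : MvPolynomial (Fin n) A}
    (hf : f ∈ lowDeg (Fin n) A (plen (longest n))) : coinvCoord hE f (longest n) = 0 := by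
  have h := lowDeg_le_span_of_isLead (fun j => isLead_aeval_monomial_mul_schub hE j)
    (esymmSchubBasis A n).span_eq.ge _ hf
  have h2 : Submodule.span A ((fun j : Σ _ : Perm (Fin n), Fin n →₀ ℕ =>
      MvPolynomial.aeval E (MvPolynomial.monomial j.2 (1 : A)) * schub A j.1) ''
        {j | (∑ i, j.2 i * (i + 1)) + plen j.1 < plen (longest n)}) ≤
      LinearMap.ker ((LinearMap.proj (longest n)).comp (coinvCoord hE)) := by
    refine Submodule.span_le.2 ?_
    rintro _ ⟨⟨v, m⟩, hj, rfl⟩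
    have hv : longest n ≠ v := by
      rintro rfl
      simp only [Set.mem_ofPred_eq] at hj
      omega
    change coinvCoord hE (MvPolynomial.aeval E (MvPolynomial.monomial m (1 : A)) * schub A v) _ = 0
    rw [← combo_single, coinvCoord_combo, Pi.single_eq_of_ne hv, MvPolynomial.coeff_zero]
  exact h2 h

end Coinvariants

/-! ### The tridiagonal determinants -/

section Tridiagonal

variable {S : Type*} [CommRing S] (x q : ℕ → S)

/-- The tridiagonal matrix with diagonal `x_i + t`, superdiagonal `q_i` and subdiagonal `-1`. -/
def tridiagMatrix (k : ℕ) : Matrix (Fin k) (Fin k) (Polynomial S) :=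
  Matrix.of fun i j =>
    if i = j then Polynomial.C (x i) + Polynomial.X
    else if (i : ℕ) + 1 = j then Polynomial.C (q i)
    else if (j : ℕ) + 1 = i then -1
    else 0

/-- The tridiagonal determinant. -/
def tridiag (k : ℕ) : Polynomial S := (tridiagMatrix x q k).det

theorem tridiag_zero : tridiag x q 0 = 1 := Matrix.det_fin_zero

theorem tridiag_one :
    tridiag x q 1 = Polynomial.C (x 0) + Polynomial.X := by
  simp [tridiag, tridiagMatrix]

/-- Expansion along the last row, which has two nonzero entries. The minor of the entry `-1` is then
expanded along its last column, where only `q k` remains; the signs combine to plus. -/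
theorem tridiag_add_two (k : ℕ) :
    tridiag x q (k + 2) =
      (Polynomial.C (x (k + 1)) + Polynomial.X) * tridiag x q (k + 1) +
        Polynomial.C (q k) * tridiag x q k := by
  have h1 : (tridiagMatrix x q (k + 2)).submatrix (Fin.last (k + 1)).succAbove
      (Fin.last (k + 1)).succAbove = tridiagMatrix x q (k + 1) := by
    ext i j : 2
    simp [tridiagMatrix]
  have h2 : ((tridiagMatrix x q (k + 2)).submatrix (Fin.last (k + 1)).succAbove
      (Fin.last k).castSucc.succAbove).det = Polynomial.C (q k) * tridiag x q k := by
    rw [Matrix.det_succ_column _ (Fin.last k), Fin.sum_univ_castSucc, Finset.sum_eq_zero, zero_add]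
    · have h3 : (((tridiagMatrix x q (k + 2)).submatrix (Fin.last (k + 1)).succAbove
          (Fin.last k).castSucc.succAbove).submatrix (Fin.last k).succAbove
            (Fin.last k).succAbove) = tridiagMatrix x q k := by
        ext i j : 2
        have hj : (Fin.last k).castSucc.succAbove j.castSucc = j.castSucc.castSucc :=
          Fin.succAbove_of_castSucc_lt _ _ (by simp [Fin.lt_def])
        simp [tridiagMatrix, hj]
      rw [h3, tridiag]
      have hl : (Fin.last k).castSucc.succAbove (Fin.last k) = Fin.last (k + 1) := by
        rw [Fin.succAbove_of_le_castSucc _ _ le_rfl]; rfl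
      have he : (-1 : Polynomial (S)) ^ (k + k) = 1 := Even.neg_one_pow ⟨k, rfl⟩
      simp [tridiagMatrix, hl, he, Fin.ext_iff]
    · intro i _
      have hl : (Fin.last k).castSucc.succAbove (Fin.last k) = Fin.last (k + 1) := by
        rw [Fin.succAbove_of_le_castSucc _ _ le_rfl]; rfl
      have hi := i.2
      have : (tridiagMatrix x q (k + 2)) (Fin.castSucc (Fin.castSucc i)) (Fin.last (k + 1)) = 0 := by
        simp only [tridiagMatrix, Matrix.of_apply]
        rw [if_neg, if_neg, if_neg]
        · simp; omega
        · simp; omega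
        · simp [Fin.ext_iff]; omega
      simp [hl, this]
  rw [tridiag, Matrix.det_succ_row _ (Fin.last (k + 1)), Fin.sum_univ_castSucc,
    Fin.sum_univ_castSucc, Finset.sum_eq_zero, zero_add, h1, h2]
  · have e1 : (tridiagMatrix x q (k + 2)) (Fin.last (k + 1)) (Fin.last (k + 1)) =
        Polynomial.C (x (k + 1)) + Polynomial.X := by simp [tridiagMatrix]
    have e2 : (tridiagMatrix x q (k + 2)) (Fin.last (k + 1)) (Fin.last k).castSucc = -1 := by
      simp only [tridiagMatrix, Matrix.of_apply]
      rw [if_neg, if_neg, if_pos]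
      · simp
      · simp; omega
      · simp [Fin.ext_iff]
    rw [e1, e2]
    have he : (-1 : Polynomial (S)) ^ (k + 1 + (k + 1)) = 1 := Even.neg_one_pow ⟨_, rfl⟩
    have ho : (-1 : Polynomial (S)) ^ (k + 1 + k) = -1 := Odd.neg_one_pow ⟨k, by ring⟩
    simp only [Fin.val_last, Fin.val_castSucc, he, ho]
    rw [tridiag, tridiag]
    ring
  · intro i _
    have hi := i.2
    have : (tridiagMatrix x q (k + 2)) (Fin.last (k + 1)) (Fin.castSucc (Fin.castSucc i)) = 0 := by
      simp only [tridiagMatrix, Matrix.of_apply]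
      rw [if_neg, if_neg, if_neg]
      · simp; omega
      · simp; omega
      · simp [Fin.ext_iff]; omega
    rw [this]; ring

end Tridiagonal

/-! ### Joint degree in `x` and `t`. -/

section PolyDegree

variable {σ R : Type*} [CommRing R]

/-- Polynomials in `t` of joint degree less than `d`. -/
def lowDegPoly (σ R : Type*) [CommRing R] (d : ℕ) :
    Submodule (R) (Polynomial (MvPolynomial σ R)) where
  carrier := {p | ∀ m, p.coeff m ∈ lowDeg σ R (d - m)}
  add_mem' hf hg m := by rw [Polynomial.coeff_add]; exact add_mem (hf m) (hg m)
  zero_mem' m := by rw [Polynomial.coeff_zero]; exact zero_mem _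
  smul_mem' c f hf m := by rw [Polynomial.coeff_smul]; exact Submodule.smul_mem _ _ (hf m)

theorem lowDegPoly_mono {d e : ℕ} (h : d ≤ e) : lowDegPoly σ R d ≤ lowDegPoly σ R e :=
  fun _ hf m => lowDeg_mono (by omega) (hf m)

theorem C_mul_mem_lowDegPoly {a d : ℕ} {x : MvPolynomial σ R} (hx : x ∈ lowDeg σ R (a + 1))
    {p : Polynomial (MvPolynomial σ R)} (hp : p ∈ lowDegPoly σ R d) :
    Polynomial.C x * p ∈ lowDegPoly σ R (d + a) := by
  intro m
  rw [Polynomial.coeff_C_mul]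
  rcases Nat.lt_or_ge m d with h | h
  · have := mul_mem_lowDeg hx (hp m)
    exact lowDeg_mono (by omega) this
  · have h0 := hp m
    rw [Nat.sub_eq_zero_of_le h] at h0
    rw [eq_zero_of_mem_lowDeg_zero h0, mul_zero]
    exact zero_mem _

theorem C_add_X_mul_mem_lowDegPoly {d : ℕ} {x : MvPolynomial σ R} (hx : x ∈ lowDeg σ R 2)
    {p : Polynomial (MvPolynomial σ R)} (hp : p ∈ lowDegPoly σ R d) :
    (Polynomial.C x + Polynomial.X) * p ∈ lowDegPoly σ R (d + 1) := by
  rw [add_mul]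
  refine add_mem (C_mul_mem_lowDegPoly hx hp) fun m => ?_
  cases m with
  | zero => rw [Polynomial.coeff_X_mul_zero]; exact zero_mem _
  | succ m => rw [Polynomial.coeff_X_mul]; exact lowDeg_mono (by omega) (hp m)

end PolyDegree

/-! ### Tridiagonal determinants with scalar quantum parameters, compared with their classical
limit. -/

section Generic

variable (n : ℕ) {A : Type*} [CommRing A] (q : ℕ → A)

/-- The variable `x_{i+1}`. -/
def xGen (A : Type*) [CommRing A] (n i : ℕ) : MvPolynomial (Fin n) A :=
  if h : i < n then MvPolynomial.X ⟨i, h⟩ else 0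

theorem xGen_val (i : Fin n) : xGen A n i = MvPolynomial.X i := by
  rw [xGen, dif_pos i.2]

/-- `Δ_k(t | X_k)` with quantum parameters `q`. -/
def qDelta (k : ℕ) : Polynomial (MvPolynomial (Fin n) A) :=
  tridiag (xGen A n) (fun i => MvPolynomial.C (q i)) k

theorem xGen_mem_lowDeg (i : ℕ) : xGen A n i ∈ lowDeg (Fin n) A 2 := by
  rw [xGen]
  split_ifs
  · exact mem_lowDeg_of_isHomogeneous (MvPolynomial.isHomogeneous_X _ _) one_lt_two
  · exact zero_mem _

theorem C_mem_lowDeg (c : A) : MvPolynomial.C c ∈ lowDeg (Fin n) A 1 :=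
  mem_lowDeg_of_isHomogeneous (MvPolynomial.isHomogeneous_C _ _) zero_lt_one

/-- The classical limit `∏_{i ≤ k} (x_i + t)` of `Δ_k`. -/
def classicalDelta (A : Type*) [CommRing A] (n k : ℕ) : Polynomial (MvPolynomial (Fin n) A) :=
  ∏ i ∈ Finset.range k, (Polynomial.C (xGen A n i) + Polynomial.X)

/-- The parameters have degree zero here, so the quantum term `q Δ_k` of the recurrence for
`Δ_{k+2}` falls two below the top joint degree in `x` and `t`. -/
theorem qDelta_mem (k : ℕ) :
    qDelta n q k ∈ lowDegPoly (Fin n) A (k + 1) ∧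
      qDelta n q k - classicalDelta A n k ∈ lowDegPoly (Fin n) A k := by
  induction k using Nat.strong_induction_on with
  | _ k ih =>
    match k, ih with
    | 0, _ =>
      rw [qDelta, tridiag_zero, classicalDelta, Finset.range_zero, Finset.prod_empty, sub_self]
      refine ⟨fun m => ?_, zero_mem _⟩
      rw [Polynomial.coeff_one]
      split_ifs with h
      · subst h
        exact mem_lowDeg_of_isHomogeneous (MvPolynomial.isHomogeneous_one _ _) (by omega)
      · exact zero_mem _
    | 1, ih =>
      obtain ⟨h0, -⟩ := ih 0 one_pos
      rw [qDelta, tridiag_zero] at h0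
      rw [qDelta, tridiag_one, classicalDelta, Finset.prod_range_one, sub_self]
      refine ⟨?_, zero_mem _⟩
      simpa using C_add_X_mul_mem_lowDegPoly (xGen_mem_lowDeg n 0) h0
    | k + 2, ih =>
      obtain ⟨h1, h1'⟩ := ih (k + 1) (by omega)
      obtain ⟨h0, -⟩ := ih k (by omega)
      have hq := C_mul_mem_lowDegPoly (C_mem_lowDeg n (q k)) h0
      rw [qDelta, tridiag_add_two]
      refine ⟨add_mem (C_add_X_mul_mem_lowDegPoly (xGen_mem_lowDeg n _) h1)
        (lowDegPoly_mono (by omega) hq), ?_⟩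
      rw [classicalDelta, Finset.prod_range_succ, mul_comm (∏ i ∈ _, _), add_sub_right_comm,
        ← mul_sub]
      exact add_mem (C_add_X_mul_mem_lowDegPoly (xGen_mem_lowDeg n _) h1')
        (lowDegPoly_mono (by omega) hq)

theorem classicalDelta_monic (k : ℕ) : (classicalDelta A n k).Monic :=
  Polynomial.monic_prod_of_monic _ _ fun i _ => by
    rw [add_comm]; exact Polynomial.monic_X_add_C _

theorem natDegree_classicalDelta [Nontrivial A] (k : ℕ) :
    (classicalDelta A n k).natDegree = k := by
  rw [classicalDelta, Polynomial.natDegree_prod_of_monic]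
  · simp [add_comm (Polynomial.C _) Polynomial.X]
  · intro i _
    rw [add_comm]; exact Polynomial.monic_X_add_C _

theorem coeff_qDelta_of_le {k m : ℕ} (h : k ≤ m) :
    (qDelta n q k).coeff m = if m = k then 1 else 0 := by
  nontriviality A
  have h1 := (qDelta_mem n q k).2 m
  rw [Nat.sub_eq_zero_of_le h] at h1
  have h2 := eq_zero_of_mem_lowDeg_zero h1
  rw [Polynomial.coeff_sub, sub_eq_zero] at h2
  rw [h2]
  split_ifs with hmk
  · subst hmk
    have := classicalDelta_monic (A := A) n m
    rwa [Polynomial.Monic, Polynomial.leadingCoeff, natDegree_classicalDelta] at this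
  · apply Polynomial.coeff_eq_zero_of_natDegree_lt
    rw [natDegree_classicalDelta]
    omega

/-- The generator `e_{i+1}(X_n | q)` of the quantum ideal. -/
def qElem (i : Fin n) : MvPolynomial (Fin n) A := (qDelta n q n).coeff (n - (i + 1))

theorem isLead_qElem (i : Fin n) :
    IsLead (i + 1) (qElem n q i) (MvPolynomial.esymm (Fin n) A (i + 1)) := by
  refine ⟨isHomogeneous_esymm _, ?_⟩
  have h := (qDelta_mem n q n).2 (n - (i + 1))
  have hi := i.2
  rw [Nat.sub_sub_self (by omega), Polynomial.coeff_sub] at h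
  have hc : classicalDelta A n n =
      ∏ i : Fin n, (Polynomial.X + Polynomial.C (MvPolynomial.X i : MvPolynomial (Fin n) A)) := by
    rw [classicalDelta, Finset.prod_range]
    refine Finset.prod_congr rfl fun i _ => ?_
    rw [xGen_val, add_comm]
  have he : (classicalDelta A n n).coeff (n - (i + 1)) =
      MvPolynomial.esymm (Fin n) A (i + 1) := by
    rw [hc, MvPolynomial.prod_C_add_X_eq_sum_esymm, Polynomial.finsetSum_coeff,
      Finset.sum_eq_single ((i : ℕ) + 1)]
    · simp
    · intro j hj hne
      rw [Polynomial.coeff_C_mul, Polynomial.coeff_X_pow, if_neg, mul_zero]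
      have := Finset.mem_range.1 hj
      rw [Fintype.card_fin] at this ⊢
      omega
    · intro h
      exact absurd (Finset.mem_range.2 (by rw [Fintype.card_fin]; omega)) h
  rwa [he] at h

theorem map_qDelta_self {T : Type*} [CommRing T] (φ : MvPolynomial (Fin n) A →+* T)
    (hφ : ∀ i, φ (qElem n q i) = 0) : (qDelta n q n).map φ = Polynomial.X ^ n := by
  ext m
  rw [Polynomial.coeff_map, Polynomial.coeff_X_pow]
  rcases Nat.lt_or_ge m n with h | h
  · have := hφ ⟨n - m - 1, by omega⟩
    rw [qElem] at this
    simp only at this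
    rw [Nat.sub_add_cancel (by omega), Nat.sub_sub_self h.le] at this
    rw [this, if_neg h.ne]
  · rw [coeff_qDelta_of_le n q h]
    split_ifs <;> simp

/-! ### The quantum double Schubert polynomial of the longest permutation -/

/-- `∏_k Δ_k(y_{n-k} | X_k)`. -/
def qTop : MvPolynomial (Fin n) (MvPolynomial (Fin n) A) :=
  ∏ j : Fin n, Polynomial.aeval (MvPolynomial.X j : MvPolynomial (Fin n) (MvPolynomial (Fin n) A))
    (qDelta n q (n - 1 - j))

/-- The quantum Schubert polynomial with quantum parameters `q`. -/
def qSchub (w : Perm (Fin n)) : MvPolynomial (Fin n) A :=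
  evalZero _ n (ddPerm _ (w * longest n) (qTop n q))

/-- The condition on `m` says that the monomial is a power of the single variable `X j`. -/
theorem coeff_aeval_X {σ S : Type*} [DecidableEq σ] [CommRing S] (j : σ) (p : Polynomial S)
    (m : σ →₀ ℕ) :
    MvPolynomial.coeff m (Polynomial.aeval (MvPolynomial.X j) p) =
      if m = Finsupp.single j m.degree then p.coeff m.degree else 0 := by
  have hs : ∀ k : ℕ, Finsupp.single j k = m ↔ m = Finsupp.single j m.degree ∧ k = m.degree := by
    intro k
    constructor
    · rintro rfl
      simp
    · rintro ⟨h, rfl⟩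
      exact h.symm
  rw [Polynomial.aeval_eq_sum_range, MvPolynomial.coeff_sum]
  simp only [MvPolynomial.coeff_smul, MvPolynomial.coeff_X_pow, hs, smul_eq_mul]
  by_cases h : m = Finsupp.single j m.degree
  · rw [if_pos h]
    simp only [h.symm, true_and, mul_ite, mul_one, mul_zero, Finset.sum_ite_eq', Finset.mem_range]
    split_ifs with hk
    · rfl
    · exact (Polynomial.coeff_eq_zero_of_natDegree_lt (by omega)).symm
  · rw [if_neg h]
    exact Finset.sum_eq_zero fun k _ => by rw [if_neg (fun h' => h h'.1), mul_zero]

theorem coeff_mul_mem_lowDeg {σ τ : Type*} {a b : ℕ} {f g : MvPolynomial τ (MvPolynomial σ A)}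
    (hf : ∀ m, MvPolynomial.coeff m f ∈ lowDeg σ A (a + 1 - m.degree))
    (hg : ∀ m, MvPolynomial.coeff m g ∈ lowDeg σ A (b + 1 - m.degree)) (m : τ →₀ ℕ) :
    MvPolynomial.coeff m (f * g) ∈ lowDeg σ A (a + b + 1 - m.degree) := by
  classical
  rw [MvPolynomial.coeff_mul]
  refine sum_mem fun x hx => ?_
  have hdeg : x.1.degree + x.2.degree = m.degree := by
    rw [← map_add, Finset.HasAntidiagonal.mem_antidiagonal.1 hx]
  have h1 := hf x.1
  have h2 := hg x.2
  rcases Nat.lt_or_ge a x.1.degree with h | h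
  · rw [Nat.sub_eq_zero_of_le (by omega)] at h1
    rw [eq_zero_of_mem_lowDeg_zero h1, zero_mul]
    exact zero_mem _
  · rcases Nat.lt_or_ge b x.2.degree with h' | h'
    · rw [Nat.sub_eq_zero_of_le (by omega)] at h2
      rw [eq_zero_of_mem_lowDeg_zero h2, mul_zero]
      exact zero_mem _
    · rw [Nat.sub_add_comm h] at h1
      exact lowDeg_mono (by omega) (mul_mem_lowDeg h1 h2)

theorem coeff_prod_mem_lowDeg {σ τ ι : Type*} (s : Finset ι) {a : ι → ℕ}
    {f : ι → MvPolynomial τ (MvPolynomial σ A)}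
    (hf : ∀ i ∈ s, ∀ m, MvPolynomial.coeff m (f i) ∈ lowDeg σ A (a i + 1 - m.degree))
    (m : τ →₀ ℕ) :
    MvPolynomial.coeff m (∏ i ∈ s, f i) ∈ lowDeg σ A (∑ i ∈ s, a i + 1 - m.degree) := by
  classical
  induction s using Finset.induction_on generalizing m with
  | empty =>
    rw [Finset.prod_empty, MvPolynomial.coeff_one]
    split_ifs with h
    · subst h
      exact mem_lowDeg_of_isHomogeneous (MvPolynomial.isHomogeneous_one _ _) (by simp)
    · exact zero_mem _
  | insert i s hi ih =>
    rw [Finset.sum_insert hi, Finset.prod_insert hi]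
    exact coeff_mul_mem_lowDeg (hf i (Finset.mem_insert_self _ _))
      (ih fun k hk => hf k (Finset.mem_insert_of_mem hk)) m

/-- The product has joint degree at most the length of `w₀` in `x` and `y`, so a positive power of
`y` costs degree in `x`. -/
theorem coeff_qTop_mem_lowDeg (m : Fin n →₀ ℕ) :
    MvPolynomial.coeff m (qTop n q) ∈ lowDeg (Fin n) A (plen (longest n) + 1 - m.degree) := by
  rw [plen_longest, qTop]
  refine coeff_prod_mem_lowDeg _ (fun j _ m => ?_) m
  rw [coeff_aeval_X]
  split_ifs
  · exact (qDelta_mem n q _).1 _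
  · exact zero_mem _

theorem coeff_zero_classicalDelta (k : ℕ) :
    (classicalDelta A n k).coeff 0 = ∏ i ∈ Finset.range k, xGen A n i := by
  rw [classicalDelta, Polynomial.coeff_zero_prod]
  simp

theorem isHomogeneous_prod_xGen {k : ℕ} (hk : k ≤ n) :
    (∏ i ∈ Finset.range k, xGen A n i).IsHomogeneous k := by
  have h := MvPolynomial.IsHomogeneous.prod (Finset.range k) (fun i => xGen A n i) (fun _ => 1)
    fun i hi => by
      rw [xGen, dif_pos ((Finset.mem_range.1 hi).trans_le hk)]
      exact MvPolynomial.isHomogeneous_X _ _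
  simpa using h

theorem prod_prod_xGen :
    ∏ j : Fin n, ∏ i ∈ Finset.range (n - 1 - j), xGen A n i = stair A n := by
  have h1 : ∀ j : Fin n, ∏ i ∈ Finset.range (n - 1 - j), xGen A n i =
      ∏ i : Fin n, if (i : ℕ) < n - 1 - j then (MvPolynomial.X i : MvPolynomial (Fin n) A) else 1 := by
    intro j
    have : Finset.range (n - 1 - j) = (Finset.range n).filter (· < n - 1 - j) := by
      ext i; simp; omega
    rw [this, Finset.prod_filter, Finset.prod_range]
    refine Finset.prod_congr rfl fun i _ => ?_
    rw [xGen_val]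
  rw [Finset.prod_congr rfl fun j _ => h1 j, Finset.prod_comm, stair, mono]
  refine Finset.prod_congr rfl fun i _ => ?_
  rw [← Finset.prod_filter, Finset.prod_const]
  congr 1
  have h2 : (Finset.univ.filter fun j : Fin n => (i : ℕ) < n - 1 - j).card =
      ((Finset.range n).filter fun j => (i : ℕ) < n - 1 - j).card := by
    rw [Finset.card_filter, Finset.card_filter, Finset.sum_range]
  have h3 : ((Finset.range n).filter fun j => (i : ℕ) < n - 1 - j) =
      Finset.range (n - 1 - i) := by
    ext j; simp; omega
  rw [h2, h3, Finset.card_range]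

theorem isLead_coeff_zero_qTop :
    IsLead (plen (longest n)) (MvPolynomial.coeff 0 (qTop n q)) (stair A n) := by
  rw [plen_longest, ← prod_prod_xGen, ← MvPolynomial.constantCoeff_eq, qTop, map_prod]
  refine IsLead.prod _ fun j _ => ?_
  rw [MvPolynomial.constantCoeff_eq, coeff_aeval_X]
  simp only [map_zero, Finsupp.single_zero, if_true]
  refine ⟨isHomogeneous_prod_xGen n (by omega), ?_⟩
  rw [← coeff_zero_classicalDelta, ← Polynomial.coeff_sub]
  exact (qDelta_mem n q _).2 0

/-- Here the degree is in `y` alone, since each `Δ_k` is monic in its variable;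
`isLead_coeff_zero_qTop` concerns the degree in `x`. -/
theorem isLead_qTop :
    IsLead (plen (longest n)) (qTop n q) (stair (MvPolynomial (Fin n) A) n) := by
  rw [plen_longest, qTop, stair, mono]
  refine IsLead.prod _ fun j _ => ⟨?_, fun m hm => ?_⟩
  · simpa using (MvPolynomial.isHomogeneous_X _ j).pow (n - 1 - (j : ℕ))
  · rw [MvPolynomial.coeff_sub]
    have hX : (MvPolynomial.X j : MvPolynomial (Fin n) (MvPolynomial (Fin n) A)) ^ (n - 1 - (j : ℕ)) =
        Polynomial.aeval (MvPolynomial.X j)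
          (Polynomial.X ^ (n - 1 - (j : ℕ)) : Polynomial (MvPolynomial (Fin n) A)) := by simp
    rw [hX, coeff_aeval_X, coeff_aeval_X, coeff_qDelta_of_le n q hm, Polynomial.coeff_X_pow,
      sub_self]

theorem ddPerm_eq_zero_of_mem_lowDeg {R : Type*} [CommRing R] {n : ℕ} {w : Perm (Fin n)}
    {f : MvPolynomial (Fin n) R} (hf : f ∈ lowDeg (Fin n) R (plen w)) : ddPerm R w f = 0 := by
  rw [f.as_sum, map_sum]
  refine Finset.sum_eq_zero fun m hm => ?_
  refine ddPerm_eq_zero_of_isHomogeneous (MvPolynomial.isHomogeneous_monomial _ rfl) ?_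
  by_contra hcon
  exact MvPolynomial.mem_support_iff.1 hm (hf m (not_lt.1 hcon))

/-- Everything below the leading staircase in `y` has too small a degree to survive `∂_{w₀}`. -/
theorem qSchub_one : qSchub n q 1 = 1 := by
  have h := ddPerm_eq_zero_of_mem_lowDeg (isLead_qTop n q).2
  rw [map_sub, ddPerm_longest_stair, sub_eq_zero] at h
  rw [qSchub, one_mul, h, map_one]

theorem evalZero_map {R S : Type*} [CommRing R] [CommRing S] (φ : R →+* S) {n : ℕ}
    (f : MvPolynomial (Fin n) R) : evalZero S n (MvPolynomial.map φ f) = φ (evalZero R n f) := by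
  have h : ((evalZero S n).comp (MvPolynomial.map φ)) = φ.comp (evalZero R n) :=
    MvPolynomial.ringHom_ext (by simp) (by simp)
  exact RingHom.congr_fun h f

/-- The coefficient of the top class vanishes on `S̃_w`, `w ≠ w₀`. -/
theorem coinvCoord_qSchub (w : Perm (Fin n)) :
    coinvCoord (isLead_qElem n q) (qSchub n q w) (longest n) = if w = longest n then 1 else 0 := by
  -- Expand in monomials of `y`: the coefficients in `x` pass through the operators, and the
  -- remaining factors are scalars of `A`.
  have hexp : qSchub n q w = ∑ m ∈ (qTop n q).support,
      evalZero A n (ddPerm A (w * longest n) (MvPolynomial.monomial m 1)) •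
        MvPolynomial.coeff m (qTop n q) := by
    rw [qSchub]
    conv_lhs => rw [(qTop n q).as_sum]
    rw [map_sum, map_sum]
    refine Finset.sum_congr rfl fun m _ => ?_
    have h1 : MvPolynomial.monomial m (MvPolynomial.coeff m (qTop n q)) =
        MvPolynomial.coeff m (qTop n q) • (MvPolynomial.map MvPolynomial.C
          (MvPolynomial.monomial m (1 : A)) : MvPolynomial (Fin n) (MvPolynomial (Fin n) A)) := by
      rw [MvPolynomial.map_monomial, MvPolynomial.smul_monomial, map_one, smul_eq_mul, mul_one]
    rw [h1, map_smul, ← map_ddPerm, MvPolynomial.smul_eval, evalZero_map, mul_comm,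
      MvPolynomial.smul_eq_C_mul]
  -- Only `m = 0` matters, because the other coefficients have too small a degree in `x` to have a
  -- top coordinate.
  rw [hexp, map_sum, Finset.sum_apply, Finset.sum_eq_single 0]
  · rw [map_smul, Pi.smul_apply, smul_eq_mul]
    have h0 := isLead_coeff_zero_qTop n q
    have h1 := coinvCoord_longest_of_mem_lowDeg (isLead_qElem n q) h0.2
    rw [map_sub, Pi.sub_apply, ← schub_longest, coinvCoord_schub, if_pos rfl, sub_eq_zero] at h1
    rw [h1, mul_one]
    have hone : (MvPolynomial.monomial 0 1 : MvPolynomial (Fin n) A) = 1 := rfl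
    rw [hone]
    split_ifs with h
    · rw [h, longest_mul_self, ddPerm_one, map_one]
    · rw [ddPerm_eq_zero_of_isHomogeneous (MvPolynomial.isHomogeneous_one _ _), map_zero]
      rw [Nat.pos_iff_ne_zero]
      intro h2
      have := mul_eq_one_iff_eq_inv.1 (eq_one_of_plen_eq_zero h2)
      rw [longest_inv] at this
      exact h this
  · intro m _ hm
    have hd : m.degree ≠ 0 := fun h0 => hm ((Finsupp.degree_eq_zero_iff m).1 h0)
    rw [map_smul, Pi.smul_apply, coinvCoord_longest_of_mem_lowDeg, smul_zero]
    exact lowDeg_mono (by omega) (coeff_qTop_mem_lowDeg n q m)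
  · intro h
    rw [MvPolynomial.notMem_support_iff.1 h, smul_zero, map_zero]
    rfl

end Generic

/-! ### Duality -/

section Duality

open scoped TensorProduct

variable (n : ℕ) {A : Type*} [CommRing A] (q : ℕ → A)

theorem map_aeval_X {R S σ : Type*} [CommRing R] [CommRing S] (φ : R →+* S) (j : σ)
    (p : Polynomial R) :
    MvPolynomial.map φ (Polynomial.aeval (MvPolynomial.X j : MvPolynomial σ R) p) =
      Polynomial.aeval (MvPolynomial.X j : MvPolynomial σ S) (p.map φ) := by
  induction p using Polynomial.induction_on' with
  | add p q hp hq => simp only [map_add, Polynomial.map_add, hp, hq]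
  | monomial k c => simp [Polynomial.aeval_monomial]

theorem evalZero_ddPerm_map {R S : Type*} [CommRing R] [CommRing S] (φ : R →+* S) {n : ℕ}
    (w : Perm (Fin n)) (f : MvPolynomial (Fin n) R) :
    evalZero S n (ddPerm S w (MvPolynomial.map φ f)) = φ (evalZero R n (ddPerm R w f)) := by
  rw [← map_ddPerm, evalZero_map]

/-! ### Christoffel–Darboux identities and the diagonal element. -/

section Commuting

variable {n} {T : Type*} [CommRing T] [Algebra A T]
  (φ ψ : MvPolynomial (Fin n) A →ₐ[A] T)

/-- The Christoffel–Darboux kernels `Δ_{k+1} Δ'_k - Δ_k Δ'_{k+1}`. -/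
def darboux (k : ℕ) : Polynomial T :=
  (qDelta n q (k + 1)).map (φ : MvPolynomial (Fin n) A →+* T) *
      (qDelta n q k).map (ψ : MvPolynomial (Fin n) A →+* T) -
    (qDelta n q k).map (φ : MvPolynomial (Fin n) A →+* T) *
      (qDelta n q (k + 1)).map (ψ : MvPolynomial (Fin n) A →+* T)

/-- The products `Δ_k Δ'_k`. -/
def deltaProd (k : ℕ) : Polynomial T :=
  (qDelta n q k).map (φ : MvPolynomial (Fin n) A →+* T) *
    (qDelta n q k).map (ψ : MvPolynomial (Fin n) A →+* T)

theorem map_qDelta_add_two (k : ℕ) :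
    (qDelta n q (k + 2)).map (φ : MvPolynomial (Fin n) A →+* T) =
      (Polynomial.C (φ (xGen A n (k + 1))) + Polynomial.X) *
          (qDelta n q (k + 1)).map (φ : MvPolynomial (Fin n) A →+* T) +
        Polynomial.C (algebraMap A T (q k)) *
          (qDelta n q k).map (φ : MvPolynomial (Fin n) A →+* T) := by
  have h : φ (MvPolynomial.C (q k)) = algebraMap A T (q k) := φ.commutes (q k)
  rw [qDelta, tridiag_add_two]
  simp only [Polynomial.map_add, Polynomial.map_mul, Polynomial.map_C, Polynomial.map_X,
    RingHom.coe_coe, h]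
  rfl

theorem darboux_zero :
    darboux q φ ψ 0 = Polynomial.C (φ (xGen A n 0) - ψ (xGen A n 0)) * deltaProd q φ ψ 0 := by
  simp only [darboux, deltaProd, zero_add, qDelta, tridiag_zero, tridiag_one, Polynomial.map_add,
    Polynomial.map_one, Polynomial.map_C, Polynomial.map_X, RingHom.coe_coe, map_sub]
  ring

/-- The three-term recurrence substituted for `Δ_{k+2}` and `Δ'_{k+2}`: the terms in `t` cancel, and
the terms in `q k` give the previous kernel with opposite sign. -/
theorem darboux_succ (k : ℕ) :
    darboux q φ ψ (k + 1) =
      Polynomial.C (φ (xGen A n (k + 1)) - ψ (xGen A n (k + 1))) * deltaProd q φ ψ (k + 1) -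
        Polynomial.C (algebraMap A T (q k)) * darboux q φ ψ k := by
  simp only [darboux, deltaProd, map_qDelta_add_two, map_sub]
  ring

/-- In the quotient `Δ_n` becomes `t^n` for both maps, which makes the last kernel divisible by
`t^n`; `slot` kills such multiples. -/
theorem darboux_last (hn : 0 < n) (hφ : ∀ i, φ (qElem n q i) = 0) (hψ : ∀ i, ψ (qElem n q i) = 0) :
    ∃ g, darboux q φ ψ (n - 1) = Polynomial.X ^ n * g := by
  rw [darboux, Nat.sub_add_cancel hn,
    map_qDelta_self n q (φ : MvPolynomial (Fin n) A →+* T) hφ,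
    map_qDelta_self n q (ψ : MvPolynomial (Fin n) A →+* T) hψ]
  exact ⟨(qDelta n q (n - 1)).map (ψ : MvPolynomial (Fin n) A →+* T) -
    (qDelta n q (n - 1)).map (φ : MvPolynomial (Fin n) A →+* T), by ring⟩

theorem slot_C_mul (P : Fin n → Polynomial T) (j : Fin n) (c : T) (f : Polynomial T) :
    slot P j (Polynomial.C c * f) = c * slot P j f := by
  rw [← Polynomial.smul_eq_C_mul, map_smul, smul_eq_mul]

/-- The element `∑_w S̃_w ⊗ S̃_{w₀ w}`, in any algebra with two maps from the polynomial ring. -/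
def diagonal : T := ∑ w, φ (qSchub n q w) * ψ (qSchub n q (longest n * w))

/-- The coproduct formula for `∂_{w₀}`, applied to the images of `qTop` under the two maps. -/
theorem diagonal_eq :
    diagonal q φ ψ = evalZero T n (ddPerm T (longest n)
      (∏ j : Fin n, Polynomial.aeval (MvPolynomial.X j) (deltaProd q φ ψ (n - 1 - j)))) := by
  have h : ∀ j : Fin n, Polynomial.aeval (MvPolynomial.X j : MvPolynomial (Fin n) T)
      (deltaProd q φ ψ (n - 1 - j)) =
      MvPolynomial.map (φ : MvPolynomial (Fin n) A →+* T)
        (Polynomial.aeval (MvPolynomial.X j) (qDelta n q (n - 1 - j))) *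
      MvPolynomial.map (ψ : MvPolynomial (Fin n) A →+* T)
        (Polynomial.aeval (MvPolynomial.X j) (qDelta n q (n - 1 - j))) := by
    intro j
    rw [deltaProd, map_mul, map_aeval_X, map_aeval_X]
  rw [Finset.prod_congr rfl fun j _ => h j, Finset.prod_mul_distrib, ← map_prod, ← map_prod,
    evalZero_ddPerm_longest_mul]
  refine Finset.sum_congr rfl fun w _ => ?_
  rw [evalZero_ddPerm_map, evalZero_ddPerm_map]
  rfl

variable {q}

/-- All products `Δ_k Δ'_k` with `k ≠ i` vanish in the slot that holds `Δ_i Δ'_i`. The Darboux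
recursion is run up from `0` and down from `n - 1`, and at index `i` it leaves only the wanted
product. -/
theorem sub_mul_diagonal (hq : ∀ i, i + 1 < n → ∀ t : T, q i • t = 0 → t = 0)
    (hφ : ∀ i, φ (qElem n q i) = 0) (hψ : ∀ i, ψ (qElem n q i) = 0) (i : Fin n) :
    (φ (MvPolynomial.X i) - ψ (MvPolynomial.X i)) * diagonal q φ ψ = 0 := by
  have hn : 0 < n := i.pos
  obtain ⟨P, hPj⟩ : ∃ P : Fin n → Polynomial T, ∀ j : Fin n, P j = deltaProd q φ ψ (n - 1 - j) :=
    ⟨_, fun _ => rfl⟩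
  have hrev : ∀ k (hk : k < n), P (⟨k, hk⟩ : Fin n).rev = deltaProd q φ ψ k := by
    intro k hk
    rw [hPj, Fin.val_rev]
    congr 1
    change n - 1 - (n - (k + 1)) = k
    omega
  have hdiag : diagonal q φ ψ = slot P i.rev (deltaProd q φ ψ i) := by
    rw [diagonal_eq, ← hrev i i.2, slot_self P i.rev]
    simp only [hPj]
  have hP : ∀ k : ℕ, k < n → k ≠ i → slot P i.rev (deltaProd q φ ψ k) = 0 := by
    intro k hk hki
    rw [← hrev k hk]
    refine slot_of_ne P fun h => hki ?_
    exact (congrArg Fin.val (Fin.rev_injective h)).symm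
  -- Below `i` the recursion starts with a vanishing product and stays zero.
  have hlow : ∀ k : ℕ, k < i → slot P i.rev (darboux q φ ψ k) = 0 := by
    intro k
    induction k with
    | zero =>
      intro h0
      rw [darboux_zero, slot_C_mul, hP 0 hn (by omega), mul_zero]
    | succ k ih =>
      intro hk
      rw [darboux_succ, map_sub, slot_C_mul, slot_C_mul, ih (by omega),
        hP (k + 1) (by omega) (by omega), mul_zero, mul_zero, sub_zero]
  -- From above it starts at a multiple of `t^n`. Each step down isolates `q_k` times the previous
  -- kernel, which is why multiplication by `q_k` has to be injective.
  have hhigh : ∀ m, m + i ≤ n - 1 → slot P i.rev (darboux q φ ψ (n - 1 - m)) = 0 := by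
    intro m
    induction m with
    | zero =>
      intro _
      obtain ⟨g, hg⟩ := darboux_last q φ ψ hn hφ hψ
      rw [Nat.sub_zero, hg, slot_X_pow_mul]
    | succ m ih =>
      intro hm
      have h1 := ih (by omega)
      have e : n - 1 - m = (n - 1 - (m + 1)) + 1 := by omega
      rw [e, darboux_succ, map_sub, slot_C_mul, slot_C_mul, hP _ (by omega) (by omega), mul_zero,
        zero_sub, neg_eq_zero] at h1
      exact hq _ (by omega) _ ((Algebra.smul_def _ _).trans h1)
  have hmid := hhigh (n - 1 - i) (by omega)
  have hi := i.2
  rw [show n - 1 - (n - 1 - (i : ℕ)) = i by omega] at hmid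
  -- The kernel at `i` vanishes by the descent; expanding it once and using the vanishing below `i`
  -- gives the claim.
  rw [hdiag, ← xGen_val]
  cases hk : (i : ℕ) with
  | zero =>
    rw [hk, darboux_zero, slot_C_mul] at hmid
    exact hmid
  | succ k =>
    rw [hk, darboux_succ, map_sub, slot_C_mul, slot_C_mul, hlow k (by omega), mul_zero,
      sub_zero] at hmid
    exact hmid

theorem mul_diagonal (hq : ∀ i, i + 1 < n → ∀ t : T, q i • t = 0 → t = 0)
    (hφ : ∀ i, φ (qElem n q i) = 0) (hψ : ∀ i, ψ (qElem n q i) = 0) (f : MvPolynomial (Fin n) A) :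
    φ f * diagonal q φ ψ = ψ f * diagonal q φ ψ := by
  induction f using MvPolynomial.induction_on with
  | C c =>
    have h1 : φ (MvPolynomial.C c) = algebraMap A T c := φ.commutes c
    have h2 : ψ (MvPolynomial.C c) = algebraMap A T c := ψ.commutes c
    rw [h1, h2]
  | add f g hf hg => rw [map_add, map_add, add_mul, add_mul, hf, hg]
  | mul_X f i hf =>
    have h := sub_mul_diagonal φ ψ hq hφ hψ i
    rw [sub_mul, sub_eq_zero] at h
    rw [map_mul, map_mul, mul_assoc, h, mul_left_comm, hf]
    ring

end Commuting

variable {n q}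

/-- Apply `l ⊗ id` to `(f ⊗ 1) D = (1 ⊗ f) D`. The left side becomes the expansion; on the right
only `w = w₀` survives and contributes `f · S_1 = f`. -/
theorem expansion_of_functional [IsDomain A] {B : Type*} [CommRing B] [Algebra A B]
    [Module.Free A B] (π : MvPolynomial (Fin n) A →ₐ[A] B) (hπ : ∀ i, π (qElem n q i) = 0)
    (hq : ∀ i, i + 1 < n → q i ≠ 0) (l : B →ₗ[A] A)
    (hl : ∀ w, l (π (qSchub n q w)) = if w = longest n then 1 else 0)
    (f : MvPolynomial (Fin n) A) :
    π f = ∑ w, l (π f * π (qSchub n q (longest n * w))) • π (qSchub n q w) := by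
  let φ : MvPolynomial (Fin n) A →ₐ[A] B ⊗[A] B := Algebra.TensorProduct.includeLeft.comp π
  let ψ : MvPolynomial (Fin n) A →ₐ[A] B ⊗[A] B := Algebra.TensorProduct.includeRight.comp π
  have hφ : ∀ i, φ (qElem n q i) = 0 := fun i => by simp [φ, hπ]
  have hψ : ∀ i, ψ (qElem n q i) = 0 := fun i => by simp [ψ, hπ]
  -- Freeness of `B` makes `B ⊗ B` torsion-free, so nonzero parameters can be cancelled.
  have key := mul_diagonal φ ψ
    (fun i hi t ht => (smul_eq_zero.1 ht).resolve_left (hq i hi)) hφ hψ f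
  let L : B ⊗[A] B →ₗ[A] B :=
    (TensorProduct.lid A B).toLinearMap.comp (LinearMap.rTensor B l)
  have hL : ∀ g h : MvPolynomial (Fin n) A, L (φ g * ψ h) = l (π g) • π h := by
    intro g h
    simp [φ, ψ, L]
  have h := congrArg L key
  simp only [diagonal, Finset.mul_sum, map_sum] at h
  have e1 : ∀ w, L (φ f * (φ (qSchub n q w) * ψ (qSchub n q (longest n * w)))) =
      l (π f * π (qSchub n q w)) • π (qSchub n q (longest n * w)) := by
    intro w
    rw [← mul_assoc, ← map_mul φ, hL, map_mul]
  have e2 : ∀ w, L (ψ f * (φ (qSchub n q w) * ψ (qSchub n q (longest n * w)))) =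
      (if w = longest n then (1 : A) else 0) • π (f * qSchub n q (longest n * w)) := by
    intro w
    rw [mul_left_comm, ← map_mul ψ, hL, hl]
  simp only [e1, e2, ite_smul, one_smul, zero_smul, Finset.sum_ite_eq', Finset.mem_univ, if_true,
    longest_mul_self, qSchub_one, mul_one] at h
  refine h.symm.trans ?_
  refine Fintype.sum_equiv (Equiv.mulLeft (longest n)) _ _ fun w => ?_
  rw [Equiv.coe_mulLeft, longest_mul_cancel]

variable {I : Ideal (MvPolynomial (Fin n) A)}

/-- The quotient by the quantum ideal is free. -/
def quotCoord (hI : I = Ideal.span (Set.range (qElem n q))) :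
    (MvPolynomial (Fin n) A ⧸ I) ≃ₗ[A] (Perm (Fin n) → A) :=
  (Submodule.Quotient.restrictScalarsEquiv A I).symm.trans
    ((Submodule.quotEquivOfEq _ _ (by
      ext f
      rw [LinearMap.mem_ker, coinvCoord_eq_zero_iff, Submodule.restrictScalars_mem, hI])).trans
      ((coinvCoord (isLead_qElem n q)).quotKerEquivOfSurjective
        (coinvCoord_surjective (isLead_qElem n q))))

/-- The residue: the coefficient of the top class. -/
def residueMap (hI : I = Ideal.span (Set.range (qElem n q))) :
    (MvPolynomial (Fin n) A ⧸ I) →ₗ[A] A :=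
  (LinearMap.proj (longest n)).comp (quotCoord hI).toLinearMap

theorem residueMap_qSchub (hI : I = Ideal.span (Set.range (qElem n q))) (w : Perm (Fin n)) :
    residueMap hI (Ideal.Quotient.mk I (qSchub n q w)) = if w = longest n then 1 else 0 :=
  coinvCoord_qSchub n q w

theorem sum_residueMap_smul [IsDomain A] (hI : I = Ideal.span (Set.range (qElem n q)))
    (hq : ∀ i, i + 1 < n → q i ≠ 0) (b : MvPolynomial (Fin n) A ⧸ I) :
    b = ∑ w, residueMap hI (b * Ideal.Quotient.mk I (qSchub n q (longest n * w))) •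
      Ideal.Quotient.mk I (qSchub n q w) := by
  obtain ⟨f, rfl⟩ := Ideal.Quotient.mk_surjective b
  have : Module.Free A (MvPolynomial (Fin n) A ⧸ I) :=
    Module.Free.of_basis (Module.Basis.ofEquivFun (quotCoord hI))
  exact expansion_of_functional (Ideal.Quotient.mkₐ A I)
    (fun i => Ideal.Quotient.eq_zero_iff_mem.2 (hI ▸ Ideal.subset_span ⟨i, rfl⟩)) hq
    (residueMap hI) (residueMap_qSchub hI) f

/-- There are as many classes as the rank of the free quotient, and they span; a surjective
endomorphism of a finite module is injective. -/
theorem qSchub_independent [IsDomain A] (hI : I = Ideal.span (Set.range (qElem n q)))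
    (hq : ∀ i, i + 1 < n → q i ≠ 0) {c : Perm (Fin n) → A}
    (hc : ∑ w, c w • Ideal.Quotient.mk I (qSchub n q w) = 0) : c = 0 := by
  let L : (Perm (Fin n) → A) →ₗ[A] (Perm (Fin n) → A) :=
    (quotCoord hI).toLinearMap.comp
      (Fintype.linearCombination A fun w => Ideal.Quotient.mk I (qSchub n q w))
  have hsurj : Function.Surjective L := by
    intro d
    refine ⟨fun w => residueMap hI ((quotCoord hI).symm d *
      Ideal.Quotient.mk I (qSchub n q (longest n * w))), ?_⟩
    simp only [L, LinearMap.comp_apply, LinearEquiv.coe_coe, Fintype.linearCombination_apply]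
    rw [← sum_residueMap_smul hI hq, LinearEquiv.apply_symm_apply]
  have hinj := OrzechProperty.injective_of_surjective_endomorphism L hsurj
  apply hinj
  rw [map_zero]
  simp only [L, LinearMap.comp_apply, Fintype.linearCombination_apply, hc, map_zero]

end Duality

/-! ### The quantum parameters -/

section Parameters

variable (n : ℕ)

/-- The product over `Fin n` has one extra factor, at `j = n - 1`, corresponding to `Δ_0 = 1`. -/
theorem prod_Icc_eq_prod_fin {M : Type*} [CommMonoid M] (f : ℕ → ℕ → M) (hf : ∀ j, f j 0 = 1) :
    ∏ k ∈ Finset.Icc 1 (n - 1), f (n - k - 1) k = ∏ j : Fin n, f j (n - 1 - j) := by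
  cases n with
  | zero => rfl
  | succ m =>
    rw [← Finset.prod_range fun j => f j (m + 1 - 1 - j), Finset.prod_range_succ,
      Nat.add_sub_cancel, Nat.sub_self, hf, mul_one, ← Finset.prod_range_reflect,
      ← Finset.Ico_add_one_right_eq_Icc, Finset.prod_Ico_eq_prod_range, Nat.add_sub_cancel]
    refine Finset.prod_congr rfl fun k hk => ?_
    have := Finset.mem_range.1 hk
    congr 1 <;> omega

/-- The quantum parameter `q_{i+1}`. -/
def qParam (i : ℕ) : QRing n := if h : i < n - 1 then MvPolynomial.X ⟨i, h⟩ else 0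

theorem qParam_ne_zero {i : ℕ} (h : i + 1 < n) : qParam n i ≠ 0 := by
  rw [qParam, dif_pos (by omega)]
  exact MvPolynomial.X_ne_zero _

theorem qVar_eq (i : ℕ) : qVar n i = MvPolynomial.C (qParam n i) := by
  rw [qVar, qParam]
  split_ifs
  · rfl
  · rw [map_zero]

theorem quantumDelta_eq (k : ℕ) : quantumDelta n k = qDelta n (qParam n) k := by
  have h : deltaMatrix n k =
      tridiagMatrix (xGen (QRing n) n) (fun i => MvPolynomial.C (qParam n i)) k := by
    ext i j : 2
    simp only [deltaMatrix, tridiagMatrix, Matrix.of_apply, qVar_eq]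
    rfl
  rw [quantumDelta, h]
  rfl

theorem quantumIdeal_eq :
    quantumIdeal n = Ideal.span (Set.range (qElem n (qParam n))) := by
  rw [quantumIdeal]
  congr 1
  ext e
  constructor
  · rintro ⟨i, h1, h2, rfl⟩
    refine ⟨⟨i - 1, by omega⟩, ?_⟩
    rw [qElem, quantumElem, quantumDelta_eq]
    congr 1
    simp only
    omega
  · rintro ⟨i, rfl⟩
    refine ⟨i + 1, by omega, i.2, ?_⟩
    rw [qElem, quantumElem, quantumDelta_eq]

theorem topDouble_eq : topDouble n = qTop n (qParam n) := by
  have h := prod_Icc_eq_prod_fin n (fun j k => Polynomial.aeval (yVar n j) (quantumDelta n k))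
    fun j => by rw [quantumDelta_eq, qDelta, tridiag_zero, map_one]
  refine h.trans (Finset.prod_congr rfl fun j _ => ?_)
  have hy : yVar n j = MvPolynomial.X j := by rw [yVar, dif_pos j.2]
  rw [hy, quantumDelta_eq]

theorem schubert_eq (w : Perm (Fin n)) : schubert n w = qSchub n (qParam n) w := by
  rw [schubert, doubleSchubert, divDiffPerm_eq_ddPerm, topDouble_eq]
  rfl

/-- The class of `𝔖̃_w` in the quantum cohomology ring. -/
def cls (w : Perm (Fin n)) : QH n := Ideal.Quotient.mk (quantumIdeal n) (schubert n w)

/-- The coefficient of `𝔖̃_{w₀}`. -/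
def topCoeff : QH n →ₗ[QRing n] QRing n := residueMap (quantumIdeal_eq n)

theorem sum_topCoeff_smul (b : QH n) :
    b = ∑ w, topCoeff n (b * cls n (longest n * w)) • cls n w := by
  have := sum_residueMap_smul (quantumIdeal_eq n) (fun i => qParam_ne_zero n) b
  simp only [cls, schubert_eq]
  exact this

theorem cls_independent {c : Perm (Fin n) → QRing n} (hc : ∑ w, c w • cls n w = 0) : c = 0 := by
  simp only [cls, schubert_eq] at hc
  exact qSchub_independent (quantumIdeal_eq n) (fun i => qParam_ne_zero n) hc

theorem cls_one : cls n 1 = 1 := by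
  rw [cls, schubert_eq, qSchub_one]
  rfl

end Parameters

/-! ### Power series -/

section Series

variable {σ : Type*}

/-- Termwise differentiation: `d · (1/d!)` is `1/(d-1)!`, so the series reproduces itself times the
constant derivative of the exponent. -/
theorem pderiv_exp_subst {S : Type*} [CommRing S] [Algebra ℚ S] {a : MvPowerSeries σ S}
    (ha : MvPowerSeries.constantCoeff a = 0) {u : σ} {s : S}
    (hs : MvPowerSeries.pderiv S u a = MvPowerSeries.C s) :
    MvPowerSeries.pderiv S u ((PowerSeries.exp ℚ).subst a) =
      (PowerSeries.exp ℚ).subst a * MvPowerSeries.C s := by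
  have hsub : PowerSeries.HasSubst a := PowerSeries.HasSubst.of_constantCoeff_zero ha
  -- Each coefficient of the substituted series is a finite sum, which may be cut off at any large
  -- enough bound.
  have key (f : PowerSeries ℚ) (e : σ →₀ ℕ) : ∃ N, ∀ M, N ≤ M →
      MvPowerSeries.coeff e (f.subst a) =
        ∑ d ∈ Finset.range M, PowerSeries.coeff d f • MvPowerSeries.coeff e (a ^ d) := by
    obtain ⟨N, hN⟩ := (PowerSeries.coeff_subst_finite hsub f e).bddAbove
    refine ⟨N + 1, fun M hM => ?_⟩
    rw [PowerSeries.coeff_subst hsub]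
    refine finsum_eq_sum_of_support_subset _ fun d hd => ?_
    have := hN hd
    exact Finset.mem_coe.2 (Finset.mem_range.2 (by omega))
  ext m
  obtain ⟨N₁, h₁⟩ := key (PowerSeries.exp ℚ) m
  obtain ⟨N₂, h₂⟩ := key (PowerSeries.exp ℚ) (m + Finsupp.single u 1)
  -- The differentiated side needs one more term, since differentiation shifts the index by one and
  -- its term at `d = 0` is zero.
  rw [MvPowerSeries.coeff_mul_C, MvPowerSeries.coeff_pderiv, h₁ (max N₁ N₂) (le_max_left _ _),
    h₂ (max N₁ N₂ + 1) ((le_max_right _ _).trans (Nat.le_succ _)), Finset.sum_mul, Finset.sum_mul,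
    Finset.sum_range_succ']
  have h0 (d : ℕ) : MvPowerSeries.coeff (m + Finsupp.single u 1) (a ^ d) * ((m u : S) + 1) =
      d * (MvPowerSeries.coeff m (a ^ (d - 1)) * s) := by
    rw [← MvPowerSeries.coeff_pderiv, MvPowerSeries.pderiv_pow, hs, mul_assoc,
      ← nsmul_eq_mul, map_nsmul, MvPowerSeries.coeff_mul_C, nsmul_eq_mul]
  rw [smul_mul_assoc, h0, Nat.cast_zero, zero_mul, smul_zero, add_zero]
  refine Finset.sum_congr rfl fun d _ => ?_
  rw [smul_mul_assoc, h0, smul_mul_assoc, Nat.add_sub_cancel, ← nsmul_eq_mul,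
    ← Nat.cast_smul_eq_nsmul ℚ, smul_smul]
  congr 1
  rw [PowerSeries.coeff_exp, PowerSeries.coeff_exp, Nat.factorial_succ]
  simp only [Algebra.algebraMap_self, RingHom.id_apply, Nat.cast_mul]
  field_simp

theorem constantCoeff_exp_subst {S : Type*} [CommRing S] [Algebra ℚ S] {a : MvPowerSeries σ S}
    (ha : MvPowerSeries.constantCoeff a = 0) :
    MvPowerSeries.constantCoeff ((PowerSeries.exp ℚ).subst a) = 1 := by
  rw [PowerSeries.constantCoeff_subst (PowerSeries.HasSubst.of_constantCoeff_zero ha),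
    finsum_eq_single _ 0]
  · simp
  · intro d hd
    rw [map_pow, ha, zero_pow hd, smul_zero]

variable {A B C : Type*} [CommRing A] [CommRing B] [Algebra A B] [CommRing C] [Algebra A C]

theorem sum_indicator_smul {W : Type*} [Fintype W] [DecidableEq W] (w : W)
    (f : W → MvPowerSeries σ B) :
    ∑ v, (if v = w then (1 : MvPowerSeries σ A) else 0) • f v = f w := by
  simp

theorem sum_sum_indicator_smul {W : Type*} [Fintype W] [DecidableEq W] (u w : W)
    (f : W → W → MvPowerSeries σ B) :
    ∑ x, ∑ v, ((if x = u then (1 : MvPowerSeries σ A) else 0) * (if v = w then 1 else 0)) • f x v =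
      f u w := by
  simp

theorem pderiv_map (φ : B →+* C) (u : σ) (g : MvPowerSeries σ B) :
    MvPowerSeries.pderiv C u (MvPowerSeries.map φ g) =
      MvPowerSeries.map φ (MvPowerSeries.pderiv B u g) := by
  ext m
  simp [MvPowerSeries.coeff_pderiv]

theorem coeff_smul_C (c : MvPowerSeries σ A) (b : B) (m : σ →₀ ℕ) :
    MvPowerSeries.coeff m (c • (MvPowerSeries.C b : MvPowerSeries σ B)) =
      MvPowerSeries.coeff m c • b := by
  have : c • (MvPowerSeries.C b : MvPowerSeries σ B) =
      MvPowerSeries.map (algebraMap A B) c * MvPowerSeries.C b := by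
    rw [Algebra.smul_def]; rfl
  rw [this, MvPowerSeries.coeff_mul_C, MvPowerSeries.coeff_map, Algebra.smul_def]

theorem pderiv_smul_C (u : σ) (c : MvPowerSeries σ A) (b : B) :
    MvPowerSeries.pderiv B u (c • (MvPowerSeries.C b : MvPowerSeries σ B)) =
      MvPowerSeries.pderiv A u c • MvPowerSeries.C b := by
  ext m
  rw [MvPowerSeries.coeff_pderiv, coeff_smul_C, coeff_smul_C, MvPowerSeries.coeff_pderiv,
    mul_comm (_ • b), mul_comm _ ((m u : A) + 1), mul_smul, Algebra.smul_def ((m u : A) + 1)]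
  simp

theorem map_smul_C {φ : B →+* C} (hφ : ∀ (a : A) (b : B), φ (a • b) = a • φ b)
    (c : MvPowerSeries σ A) (b : B) :
    MvPowerSeries.map φ (c • (MvPowerSeries.C b : MvPowerSeries σ B)) =
      c • MvPowerSeries.C (φ b) := by
  ext m
  rw [MvPowerSeries.coeff_map, coeff_smul_C, coeff_smul_C, hφ]

theorem pderiv_mul_C (u : σ) (g : MvPowerSeries σ B) (b : B) :
    MvPowerSeries.pderiv B u (g * MvPowerSeries.C b) =
      MvPowerSeries.pderiv B u g * MvPowerSeries.C b := by
  rw [Derivation.leibniz, MvPowerSeries.pderiv_C, smul_zero, zero_add, smul_eq_mul, mul_comm]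

/-- A linear functional applied to each coefficient. -/
def coeffMap (L : B →ₗ[A] A) (g : MvPowerSeries σ B) : MvPowerSeries σ A :=
  fun m => L (MvPowerSeries.coeff m g)

theorem coeff_coeffMap (L : B →ₗ[A] A) (g : MvPowerSeries σ B) (m : σ →₀ ℕ) :
    MvPowerSeries.coeff m (coeffMap L g) = L (MvPowerSeries.coeff m g) := rfl

theorem pderiv_coeffMap (L : B →ₗ[A] A) (u : σ) (g : MvPowerSeries σ B) :
    MvPowerSeries.pderiv A u (coeffMap L g) = coeffMap L (MvPowerSeries.pderiv B u g) := by
  ext m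
  rw [MvPowerSeries.coeff_pderiv, coeff_coeffMap, coeff_coeffMap, MvPowerSeries.coeff_pderiv]
  have h : MvPowerSeries.coeff (m + Finsupp.single u 1) g * ((m u : B) + 1) =
      ((m u : A) + 1) • MvPowerSeries.coeff (m + Finsupp.single u 1) g := by
    rw [Algebra.smul_def]
    simp [mul_comm]
  rw [h, map_smul, smul_eq_mul, mul_comm]

/-- The basis elements are constant in `t`, so the dual expansion and its uniqueness apply to each
coefficient in `t` separately. -/
theorem eq_sum_smul_C_iff {W : Type*} [Fintype W] {L : B →ₗ[A] A} {b b' : W → B}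
    (hspan : ∀ x, x = ∑ w, L (x * b' w) • b w)
    (hind : ∀ c : W → A, ∑ w, c w • b w = 0 → c = 0) (g : MvPowerSeries σ B)
    (c : W → MvPowerSeries σ A) :
    g = ∑ w, c w • MvPowerSeries.C (b w) ↔
      c = fun w => coeffMap L (g * MvPowerSeries.C (b' w)) := by
  have hg : g = ∑ w, coeffMap L (g * MvPowerSeries.C (b' w)) • MvPowerSeries.C (b w) := by
    ext m
    rw [map_sum]
    refine (hspan _).trans (Finset.sum_congr rfl fun w _ => ?_)
    rw [coeff_smul_C, coeff_coeffMap, MvPowerSeries.coeff_mul_C]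
  refine ⟨fun h => ?_, fun h => h ▸ hg⟩
  funext w
  ext m
  have hm := congrArg (MvPowerSeries.coeff m) (h.symm.trans hg)
  rw [map_sum, map_sum, ← sub_eq_zero, ← Finset.sum_sub_distrib] at hm
  simp only [coeff_smul_C, ← sub_smul] at hm
  exact sub_eq_zero.1 (congrFun (hind _ hm) w)

end Series

/-! ### The deformation -/

section Deformation

variable (n : ℕ)

theorem schubertClass_eq (w : Perm (Fin n)) : schubertClass n w = MvPowerSeries.C (cls n w) :=
  MvPowerSeries.map_C _ _

/-- The residue on `Q_t H^*(Fl_n)`, coefficientwise in `t`. -/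
def topSeries (g : QtH n) : TQ n := coeffMap (topCoeff n) g

theorem eq_sum_schubertClass_iff (g : QtH n) (c : Perm (Fin n) → TQ n) :
    g = ∑ w, c w • schubertClass n w ↔
      c = fun w => topSeries n (g * schubertClass n (longest n * w)) := by
  simp only [schubertClass_eq]
  exact eq_sum_smul_C_iff (sum_topCoeff_smul n) (fun c => cls_independent n) g c

/-- An expansion exists, so the chosen family is one; uniqueness then identifies it with the
residues against the dual basis. -/
theorem schubertCoord_eq (g : QtH n) (w : Perm (Fin n)) :
    schubertCoord n g w = topSeries n (g * schubertClass n (longest n * w)) :=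
  congrFun ((eq_sum_schubertClass_iff n g _).1
    (Classical.epsilon_spec (p := fun c : Perm (Fin n) → TQ n => g = ∑ w, c w • schubertClass n w)
      ⟨_, (eq_sum_schubertClass_iff n g _).2 rfl⟩)) w

theorem sum_schubertCoord (g : QtH n) : g = ∑ w, schubertCoord n g w • schubertClass n w :=
  (eq_sum_schubertClass_iff n g _).2 (funext (schubertCoord_eq n g))

theorem schubertCoord_schubertClass (u w : Perm (Fin n)) :
    schubertCoord n (schubertClass n u) w = if w = u then 1 else 0 := by
  have h : schubertClass n u =
      ∑ w, (if w = u then (1 : TQ n) else 0) • schubertClass n w :=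
    (sum_indicator_smul (A := QRing n) (B := QH n) u (schubertClass n)).symm
  rw [schubertCoord_eq]
  exact (congrFun ((eq_sum_schubertClass_iff n _ _).1 h) w).symm

theorem toQtH_smul_schubertX (c : TQ n) (w : Perm (Fin n)) :
    toQtH n (c • schubertX n w) = c • schubertClass n w := by
  rw [schubertClass_eq]
  exact map_smul_C (A := QRing n) (B := XRing n) (C := QH n)
    (φ := Ideal.Quotient.mk (quantumIdeal n)) (fun _ _ => rfl) c (schubert n w)

theorem toQtH_bracket (f : TX n) : toQtH n (bracket n f) = toQtH n f := by
  rw [bracket, map_sum]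
  refine Eq.trans ?_ (sum_schubertCoord n _).symm
  exact Finset.sum_congr rfl fun w _ => toQtH_smul_schubertX n _ w

theorem bracket_congr {f g : TX n} (h : toQtH n f = toQtH n g) : bracket n f = bracket n g := by
  rw [bracket, bracket, h]

theorem residue_eq (f : TX n) : residue n f = topSeries n (toQtH n f) := by
  rw [residue, schubertCoord_eq, longest_mul_self, schubertClass_eq, cls_one, map_one, mul_one]

/-- The coordinates of the projection are coefficientwise linear functionals of the class, and the
polynomials they multiply do not depend on `t`. -/
theorem dX_bracket (u : Perm (Fin n)) (f : TX n) :
    dX n u (bracket n f) = bracket n (dX n u f) := by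
  rw [bracket, bracket, dX, map_sum]
  refine Finset.sum_congr rfl fun w _ => ?_
  rw [schubertX, pderiv_smul_C, schubertCoord_eq, schubertCoord_eq, topSeries, topSeries,
    pderiv_coeffMap, schubertClass_eq, pderiv_mul_C, dX, toQtH, pderiv_map]

/-! ### The kernel -/

theorem constantCoeff_exponent : MvPowerSeries.constantCoeff (exponent n) = 0 := by
  rw [exponent, map_sum]
  refine Finset.sum_eq_zero fun w _ => ?_
  rw [map_mul, MvPowerSeries.constantCoeff_X, zero_mul]

theorem dX_exponent (u : Perm (Fin n)) : dX n u (exponent n) = schubertX n u := by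
  rw [exponent, dX, map_sum, Finset.sum_eq_single u]
  · rw [Derivation.leibniz, schubertX, MvPowerSeries.pderiv_C, smul_zero, zero_add,
      MvPowerSeries.pderiv_X_self, smul_eq_mul, mul_one]
  · intro w _ hw
    rw [Derivation.leibniz, schubertX, MvPowerSeries.pderiv_C, smul_zero, zero_add,
      MvPowerSeries.pderiv_X_of_ne hw, smul_zero]
  · intro h
    exact absurd (Finset.mem_univ u) h

theorem dX_expSeries (u : Perm (Fin n)) : dX n u (expSeries n) = expSeries n * schubertX n u :=
  pderiv_exp_subst (constantCoeff_exponent n) (dX_exponent n u)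

theorem dX_expSeries_mul (u w : Perm (Fin n)) :
    dX n u (expSeries n * schubertX n w) = expSeries n * schubertX n u * schubertX n w := by
  rw [← dX_expSeries n u, dX, schubertX.eq_1 n w, pderiv_mul_C, dX]

/-- The class of the kernel. -/
def kernelClass : QtH n := toQtH n (expSeries n)

theorem isUnit_kernelClass : IsUnit (kernelClass n) := by
  have h : IsUnit (expSeries n) := by
    rw [MvPowerSeries.isUnit_iff_constantCoeff]
    have := constantCoeff_exp_subst (constantCoeff_exponent n)
    rw [expSeries, this]
    exact isUnit_one
  exact h.map (toQtH n)

theorem toQtH_kernelK : toQtH n (kernelK n) = kernelClass n := toQtH_bracket n _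

theorem schubertTClass_eq (w : Perm (Fin n)) :
    schubertTClass n w = kernelClass n * schubertClass n w := by
  rw [schubertTClass, schubertT, toQtH_bracket, map_mul, toQtH_kernelK]
  rfl

theorem kernelClass_mul_eq_sum_iff (g : QtH n) (c : Perm (Fin n) → TQ n) :
    kernelClass n * g = ∑ w, c w • schubertTClass n w ↔ g = ∑ w, c w • schubertClass n w := by
  have h : ∑ w, c w • schubertTClass n w = kernelClass n * ∑ w, c w • schubertClass n w := by
    rw [Finset.mul_sum]
    refine Finset.sum_congr rfl fun w _ => ?_
    rw [schubertTClass_eq, mul_smul_comm]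
  rw [h]
  exact (isUnit_kernelClass n).mul_right_inj

/-- Multiplication by the unit `kernelClass` carries the Schubert basis to the deformed one and
preserves coordinates. -/
theorem schubertTCoord_kernelClass_mul (g : QtH n) :
    schubertTCoord n (kernelClass n * g) = schubertCoord n g := by
  have hp : ∃ c : Perm (Fin n) → TQ n, kernelClass n * g = ∑ w, c w • schubertTClass n w :=
    ⟨_, (kernelClass_mul_eq_sum_iff n g _).2 (sum_schubertCoord n g)⟩
  have h := (kernelClass_mul_eq_sum_iff n g (schubertTCoord n (kernelClass n * g))).1
    (Classical.epsilon_spec hp)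
  rw [(eq_sum_schubertClass_iff n g _).1 h]
  exact (funext (schubertCoord_eq n g)).symm

theorem dQ_topSeries (u : Perm (Fin n)) (f : TX n) :
    dQ n u (topSeries n (toQtH n f)) = topSeries n (toQtH n (dX n u f)) := by
  rw [dQ, topSeries, topSeries, pderiv_coeffMap, toQtH, pderiv_map, dX]

theorem potential_eq : potential n = topSeries n (toQtH n (expSeries n)) := by
  rw [potential, residue_eq, toQtH_kernelK, kernelClass]

theorem dX_expSeries_mul_mul (u w τ : Perm (Fin n)) :
    dX n u (expSeries n * schubertX n w * schubertX n τ) =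
      expSeries n * schubertX n u * schubertX n w * schubertX n τ := by
  rw [← dX_expSeries_mul n u, dX, schubertX.eq_1 n τ, pderiv_mul_C, dX]

/-- The product of two deformed classes contains the kernel twice; one factor is absorbed by the
deformed basis. -/
theorem Lam_eq_schubertCoord (u w τ : Perm (Fin n)) :
    Lam n u w τ = schubertCoord n
      (kernelClass n * schubertClass n u * schubertClass n w) (longest n * τ) := by
  have h : toQtH n (circ n (schubertT n u) (schubertT n w)) =
      kernelClass n * (kernelClass n * schubertClass n u * schubertClass n w) := by
    have h1 := schubertTClass_eq n u
    have h2 := schubertTClass_eq n w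
    rw [schubertTClass] at h1 h2
    rw [circ, toQtH_bracket, map_mul, h1, h2]
    ring
  rw [Lam, h, schubertTCoord_kernelClass_mul]

/-- Each derivative brings down one Schubert factor, so the right side is the residue of `K S_u S_w
S_τ`. By duality this is the coefficient of `S_{w₀τ}` in `K S_u S_w`. -/
theorem Lam_eq_dQ (u w τ : Perm (Fin n)) :
    Lam n u w τ = dQ n u (dQ n w (dQ n τ (potential n))) := by
  rw [potential_eq, dQ_topSeries, dX_expSeries, dQ_topSeries, dX_expSeries_mul, dQ_topSeries,
    dX_expSeries_mul_mul, Lam_eq_schubertCoord, schubertCoord_eq, longest_mul_cancel]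
  simp only [map_mul]
  rfl

theorem toQtH_kernelK_mul (w : Perm (Fin n)) :
    toQtH n (kernelK n * schubertX n w) = toQtH n (expSeries n * schubertX n w) := by
  rw [map_mul, toQtH_kernelK, map_mul, kernelClass]

theorem dX_schubertT (u w : Perm (Fin n)) :
    dX n u (schubertT n w) = circ n (schubertX n u) (schubertT n w) := by
  rw [schubertT, bracket_congr n (toQtH_kernelK_mul n w), dX_bracket, dX_expSeries_mul, circ]
  apply bracket_congr
  rw [map_mul _ (schubertX n u), toQtH_bracket]
  simp only [map_mul]
  ring

theorem nabla_schubertClass (u w : Perm (Fin n)) :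
    nabla n u (schubertClass n w) = toQtH n (dX n u (schubertT n w)) := by
  simp only [nabla, schubertCoord_schubertClass]
  exact sum_indicator_smul (A := QRing n) (B := QH n) w fun v => toQtH n (dX n u (schubertT n v))

theorem star_schubertClass (u w : Perm (Fin n)) :
    star n (schubertClass n u) (schubertClass n w) =
      ∑ τ, Lam n u w τ • schubertClass n (longest n * τ) := by
  simp only [star, schubertCoord_schubertClass]
  exact sum_sum_indicator_smul (A := QRing n) (B := QH n) u w fun x v =>
    ∑ τ, Lam n x v τ • schubertClass n (longest n * τ)

/-- Both sides are `K S_u S_w`: on the left from the derivative of `S_w^t`, on the right from its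
expansion in the basis reindexed by `τ ↦ w₀τ`. -/
theorem nabla_eq_star (u w : Perm (Fin n)) :
    nabla n u (schubertClass n w) = star n (schubertClass n u) (schubertClass n w) := by
  have h : toQtH n (dX n u (schubertT n w)) =
      kernelClass n * schubertClass n u * schubertClass n w := by
    have hw := schubertTClass_eq n w
    rw [schubertTClass] at hw
    rw [dX_schubertT, circ, toQtH_bracket, map_mul, hw, schubertClass, schubertClass]
    ring
  rw [nabla_schubertClass, star_schubertClass, h]
  simp only [Lam_eq_schubertCoord]
  refine (sum_schubertCoord n _).trans ?_
  exact (Equiv.sum_comp (Equiv.mulLeft (longest n)) _).symm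

theorem existsUnique_schubertClass (g : QtH n) :
    ∃! c : Perm (Fin n) → TQ n, g = ∑ w, c w • schubertClass n w :=
  ⟨_, (eq_sum_schubertClass_iff n g _).2 rfl, fun c => (eq_sum_schubertClass_iff n g c).1⟩

theorem existsUnique_schubertTClass (g : QtH n) :
    ∃! c : Perm (Fin n) → TQ n, g = ∑ w, c w • schubertTClass n w := by
  obtain ⟨κ, hκ⟩ := isUnit_kernelClass n
  have hg : g = kernelClass n * (κ⁻¹ : (QtH n)ˣ) * g := by
    rw [← hκ, Units.mul_inv, one_mul]
  -- Expanding `g` in the deformed basis is expanding `K⁻¹ g` in the Schubert basis.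
  rw [hg, mul_assoc]
  simp only [kernelClass_mul_eq_sum_iff]
  exact existsUnique_schubertClass n _

end Deformation

end

end QFlag

theorem lemmal2p8 (n : ℕ) :
    -- the quantum Schubert classes form a basis of `Q_t H^*(Fl_n)` over `ℚ[q][[t]]`
    (∀ g : QFlag.QtH n, ∃! c : Equiv.Perm (Fin n) → QFlag.TQ n,
      g = ∑ w, c w • QFlag.schubertClass n w) ∧
    -- so do the `t`-deformed ones
    (∀ g : QFlag.QtH n, ∃! c : Equiv.Perm (Fin n) → QFlag.TQ n,
      g = ∑ w, c w • QFlag.schubertTClass n w) ∧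
    -- the structure constants are the third derivatives of the potential
    (∀ u w τ : Equiv.Perm (Fin n),
      QFlag.Lam n u w τ = QFlag.dQ n u (QFlag.dQ n w (QFlag.dQ n τ (QFlag.potential n)))) ∧
    -- `∂ 𝔖̃_w^t / ∂ t_u = 𝔖̃_u ∘ 𝔖̃_w^t`
    (∀ u w : Equiv.Perm (Fin n),
      QFlag.dX n u (QFlag.schubertT n w) =
        QFlag.circ n (QFlag.schubertX n u) (QFlag.schubertT n w)) ∧
    -- the defining rules of `∇_u` and `*` on the basis
    (∀ u w : Equiv.Perm (Fin n),
      QFlag.nabla n u (QFlag.schubertClass n w) =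
        QFlag.toQtH n (QFlag.dX n u (QFlag.schubertT n w))) ∧
    (∀ u w : Equiv.Perm (Fin n),
      QFlag.star n (QFlag.schubertClass n u) (QFlag.schubertClass n w) =
        ∑ τ, QFlag.Lam n u w τ • QFlag.schubertClass n (QFlag.longest n * τ)) ∧
    -- `∇_u 𝔖̃_w = 𝔖̃_u * 𝔖̃_w`
    (∀ u w : Equiv.Perm (Fin n),
      QFlag.nabla n u (QFlag.schubertClass n w) =
        QFlag.star n (QFlag.schubertClass n u) (QFlag.schubertClass n w)) :=
  ⟨QFlag.existsUnique_schubertClass n, QFlag.existsUnique_schubertTClass n, QFlag.Lam_eq_dQ n,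
    QFlag.dX_schubertT n, QFlag.nabla_schubertClass n, QFlag.star_schubertClass n,
    QFlag.nabla_eq_star n⟩
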